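/- Let $\mathbb F$ be a field of characteristic $2$, let $n\ge 1$, and let $\Delta$ be an $\mathbb F$-homology $(2n-1)$-sphere, i.e. a finite simplicial complex such that for every face $\sigma\in\Delta$ (including $\sigma=\emptyset$) the link $\mathrm{lk}_\sigma\Delta$ has the same (reduced) homology with coefficients in $\mathbb F$ as the sphere $S^{2n-1-|\sigma|}$ (with $S^{-1}=\emptyset$). Suppose that $\Delta'$ is obtained from $\Delta$ by a bistellar $q$-move: there are a nonempty face $\sigma\in\Delta$ with $\dim\sigma=2n-1-q$ and a $q$-dimensional simplex $\tau\notin\Delta$ (a new vertex if $q=0$) such that $\mathrm{lk}_\sigma\Delta=\partial\tau$, and $$\Delta'=(\Delta\setminus \mathrm{st}_\sigma\Delta)\cup(\partial\sigma*\tau).$$ Then $\Delta$ is generically anisotropic over $\mathbb F$ if and only if $\Delta'$ is generically anisotropic over $\mathbb F$. Here a $(d-1)$-dimensional simplicial complex $\Gamma$ with vertex set $[m]$ is called generically anisotropic over $\mathbb F$ if the following holds. Let $\Bbbk=\mathbb F(a_{ij}:1\le i\le d,\ 1\le j\le m)$ be the field of rational functions in $dm$ variables, let $\Bbbk[\Gamma]=\Bbbk[x_1,\dots,x_m]/I_\Gamma$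 be the Stanley–Reisner ring, let $\theta_i=\sum_{j=1}^m a_{ij}x_j$ for $1\le i\le d$, which is a linear system of parameters, and let $\Bbbk(\Gamma)=\Bbbk[\Gamma]/(\theta_1,\dots,\theta_d)$ be the corresponding Artinian reduction. Then for every $i\le d/2$ and every nonzero homogeneous element $u\in\Bbbk(\Gamma)_i$ of degree $i$, the square $u^2$ is nonzero. -/

import Mathlib

/-- A finite (abstract) simplicial complex with vertices in `V`. As usual for Stanley-Reisner rings,
the empty set is a face of every complex (Mathlib's `PreAbstractSimplicialComplex` excludes the
empty face and allows infinitely many faces). Not every element of `V` has to be a vertex. -/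
@[ext]
structure FinComplex (V : Type*) where
  faces : Finset (Finset V)
  empty_mem : ∅ ∈ faces
  down_closed : ∀ s ∈ faces, ∀ t ⊆ s, t ∈ faces

namespace FinComplex

section Combinatorics

variable {V : Type*}

/-- `dim Δ + 1`, the maximal cardinality of a face. -/
def rank (Δ : FinComplex V) : ℕ := Δ.faces.sup Finset.card

/-- All facets (maximal faces) have the same dimension. -/
def IsPure (Δ : FinComplex V) : Prop :=
  ∀ s ∈ Δ.faces, (∀ t ∈ Δ.faces, s ⊆ t → t = s) → s.card = Δ.rank

variable [DecidableEq V]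

/-- The set of vertices of `Δ`. -/
def vertices (Δ : FinComplex V) : Finset V := Δ.faces.sup id

/-- Check of the definition: `v` is a vertex iff `{v}` is a face. -/
theorem mem_vertices (Δ : FinComplex V) (v : V) : v ∈ Δ.vertices ↔ {v} ∈ Δ.faces := by
  simp only [vertices, Finset.mem_sup, id]
  constructor
  · rintro ⟨s, hs, hv⟩
    exact Δ.down_closed s hs _ (by simpa using hv)
  · intro h
    exact ⟨{v}, h, by simp⟩

/-- The link of the face `σ`. -/
def link (Δ : FinComplex V) (σ : Finset V) (hσ : σ ∈ Δ.faces) : FinComplex V where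
  faces := Δ.faces.filter (fun t => t ∪ σ ∈ Δ.faces ∧ t ∩ σ = ∅)
  empty_mem := by simp [Δ.empty_mem, hσ]
  down_closed := by
    intro s hs t hts
    simp only [Finset.mem_filter] at hs ⊢
    refine ⟨Δ.down_closed s hs.1 t hts,
      Δ.down_closed _ hs.2.1 _ (Finset.union_subset_union_left hts), ?_⟩
    exact Finset.subset_empty.mp (hs.2.2 ▸ Finset.inter_subset_inter_right hts)

/-- The faces of the star of `σ`. -/
def starFaces (Δ : FinComplex V) (σ : Finset V) : Finset (Finset V) :=
  Δ.faces.filter (fun t => t ∪ σ ∈ Δ.faces)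

/-- The faces `a ∪ b` of the join of two families `A`, `B` of faces. -/
def joinFaces (A B : Finset (Finset V)) : Finset (Finset V) :=
  Finset.image₂ (fun a b => a ∪ b) A B

/-- `Δ'` is obtained from the pure complex `Δ` by a bistellar `q`-move: there are a nonempty face
`σ` of `Δ` of dimension `dim Δ - q` and a `q`-simplex `τ` that is not a face of `Δ`, such that the
link of `σ` is `∂τ` (the complex of all proper subsets of `τ`), and
`Δ' = (Δ \ st σ) ∪ (∂σ * τ)`. For `q = 0` the simplex `τ` is a new vertex. -/
def IsBistellarMove (q : ℕ) (Δ Δ' : FinComplex V) : Prop :=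
  Δ.IsPure ∧ ∃ (σ τ : Finset V) (hσ : σ ∈ Δ.faces),
    σ.Nonempty ∧ σ.card + q = Δ.rank ∧ τ.card = q + 1 ∧ τ ∉ Δ.faces ∧
    (Δ.link σ hσ).faces = τ.ssubsets ∧
    Δ'.faces = (Δ.faces \ Δ.starFaces σ) ∪ joinFaces σ.ssubsets τ.powerset

end Combinatorics

section Homology

variable {V : Type*} (F : Type*) [Field F]

/-- Simplicial chains of `Δ` (in all degrees, including the empty face) supported on the faces with
`k` elements, i.e. the chains of degree `k - 1` of the augmented chain complex. A chain is given by
its coefficients on the faces. -/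
def chains (Δ : FinComplex V) (k : ℕ) : Submodule F (Δ.faces → F) where
  carrier := {c | ∀ s : Δ.faces, s.1.card ≠ k → c s = 0}
  zero_mem' := fun _ _ => rfl
  add_mem' := fun {a b} ha hb s hs => by simp [ha s hs, hb s hs]
  smul_mem' := fun r a ha s hs => by simp [ha s hs]

variable [LinearOrder V]

/-- The coefficient of `t` in the boundary `∑ᵢ (-1)^i {v₀, …, vᵢ₋₁, vᵢ₊₁, …, vₘ}` of the simplex
`s = {v₀ < v₁ < ⋯ < vₘ}`. -/
def incidence (s t : Finset V) : F :=
  ∑ v ∈ s, if s.erase v = t then (-1) ^ (s.filter (fun w => w < v)).card else 0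

/-- The boundary map of the augmented simplicial chain complex. -/
def boundary (Δ : FinComplex V) : (Δ.faces → F) →ₗ[F] (Δ.faces → F) :=
  Matrix.mulVecLin (Matrix.of fun t s : Δ.faces => incidence F s.1 t.1)

/-- Cycles of degree `k - 1`. -/
def cycles (Δ : FinComplex V) (k : ℕ) : Submodule F (Δ.faces → F) :=
  Δ.chains F k ⊓ LinearMap.ker (Δ.boundary F)

/-- Boundaries of degree `k - 1`. -/
def boundaries (Δ : FinComplex V) (k : ℕ) : Submodule F (Δ.faces → F) :=
  (Δ.chains F (k + 1)).map (Δ.boundary F)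

/-- Reduced simplicial homology of `Δ` in degree `k - 1` with coefficients in `F`: cycles modulo
boundaries. -/
abbrev ReducedHomology (Δ : FinComplex V) (k : ℕ) : Type _ :=
  ↥(Δ.cycles F k) ⧸ (Δ.boundaries F k).submoduleOf (Δ.cycles F k)

/-- `Δ` is an `F`-homology `d`-sphere: for every face `σ` (including `∅`), the link of `σ` has the
homology of a sphere of dimension `d - |σ|`, i.e. its reduced homology in degree `k - 1` is `F` if
`k - 1 = d - |σ|`, and zero otherwise (the sphere of dimension `-1` is the complex `{∅}`). -/
def IsHomologySphere (Δ : FinComplex V) (d : ℕ) : Prop :=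
  ∀ (σ : Finset V) (hσ : σ ∈ Δ.faces) (k : ℕ),
    (k + σ.card = d + 1 → Nonempty ((Δ.link σ hσ).ReducedHomology F k ≃ₗ[F] F)) ∧
    (k + σ.card ≠ d + 1 → Subsingleton ((Δ.link σ hσ).ReducedHomology F k))

end Homology

section FaceRing

variable {V : Type*} [DecidableEq V] (Δ : FinComplex V) (K : Type*) [Field K]

/-- The Stanley-Reisner ideal of `Δ` in the polynomial ring on the vertices of `Δ`. -/
noncomputable def stanleyReisnerIdeal : Ideal (MvPolynomial Δ.vertices K) :=
  Ideal.span {p | ∃ s : Finset Δ.vertices,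
    s.map (Function.Embedding.subtype _) ∉ Δ.faces ∧ p = ∏ v ∈ s, MvPolynomial.X v}

variable {K}

/-- The ideal generated by the Stanley-Reisner ideal and the sequence `Θ`. -/
noncomputable def reductionIdeal (Θ : Fin Δ.rank → MvPolynomial Δ.vertices K) :
    Ideal (MvPolynomial Δ.vertices K) :=
  Δ.stanleyReisnerIdeal K ⊔ Ideal.span (Set.range Θ)

/-- The quotient `K(Δ; Θ) = K[Δ] / (Θ)` of the face ring `K[Δ]`. -/
abbrev Reduction (Θ : Fin Δ.rank → MvPolynomial Δ.vertices K) : Type _ :=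
  MvPolynomial Δ.vertices K ⧸ Δ.reductionIdeal Θ

/-- The homogeneous component `K(Δ; Θ)ᵢ` of degree `i`. -/
noncomputable def reductionComponent (Θ : Fin Δ.rank → MvPolynomial Δ.vertices K) (i : ℕ) :
    Submodule K (Δ.Reduction Θ) :=
  (MvPolynomial.homogeneousSubmodule Δ.vertices K i).map
    (Ideal.Quotient.mkₐ K (Δ.reductionIdeal Θ)).toLinearMap

/-- `Θ` is a linear system of parameters for `K[Δ]`: `dim Δ + 1` linear forms such that `K(Δ; Θ)` is
a finite-dimensional vector space. -/
def IsLSOP (Θ : Fin Δ.rank → MvPolynomial Δ.vertices K) : Prop :=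
  (∀ i, (Θ i).IsHomogeneous 1) ∧ Module.Finite K (Δ.Reduction Θ)

/-- `K(Δ; Θ)` is an anisotropic Artinian reduction: `Θ` is an l.s.o.p., and `u² ≠ 0` for every
nonzero `u ∈ K(Δ; Θ)ᵢ` with `i ≤ (dim Δ + 1) / 2`. -/
def IsAnisotropicReduction (Θ : Fin Δ.rank → MvPolynomial Δ.vertices K) : Prop :=
  Δ.IsLSOP Θ ∧
  ∀ i : ℕ, 2 * i ≤ Δ.rank → ∀ u ∈ Δ.reductionComponent Θ i, u ≠ 0 → u ^ 2 ≠ 0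

variable (F : Type*) [Field F]

/-- The field `F(a_{iv})` of rational functions in variables indexed by `1 ≤ i ≤ dim Δ + 1` and the
vertices `v` of `Δ`. -/
abbrev GenericField : Type _ := FractionRing (MvPolynomial (Fin Δ.rank × Δ.vertices) F)

/-- The generic linear forms `θᵢ = ∑ᵥ a_{iv} xᵥ`. -/
noncomputable def genericForms (i : Fin Δ.rank) : MvPolynomial Δ.vertices (Δ.GenericField F) :=
  ∑ v : Δ.vertices,
    MvPolynomial.C (algebraMap (MvPolynomial (Fin Δ.rank × Δ.vertices) F) (Δ.GenericField F)
      (MvPolynomial.X (i, v))) * MvPolynomial.X v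

/-- `Δ` is generically anisotropic over `F`. -/
def GenericallyAnisotropic : Prop :=
  Δ.IsAnisotropicReduction (Δ.genericForms F)

end FaceRing

end FinComplex

set_option linter.unusedSectionVars false

/-! In characteristic 2 both sides of the equivalence are true, so the two Artinian reductions never
have to be compared. It suffices that bistellar moves preserve a homological sphere condition
(`IsModTwoSphere`) and that every complex of odd dimension with this property is generically
anisotropic (`genericallyAnisotropic_of_isModTwoSphere`).

Moves. Let Γ consist of the faces of Δ and all subsets of σ ∪ τ. Deleting from Γ the faces
containing τ gives Δ, and deleting those containing σ gives Δ'. Inside the star of a face common to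
both, the deleted faces form a Boolean interval or nothing. Such intervals are acyclic, so the
homology of stars passes from Δ to Γ and on to Δ' (`IsModTwoSphere.flip`).

Duality. The face ring K[Δ] is the module of top cycles of a complex whose j-th term is the sum of
the polynomial rings K[τ] over faces τ with j elements; it is exact below the top because each of
its multigraded pieces is the chain complex of a star. Let Z_j be its cycles. Dividing by θ_{j+1}
modulo the earlier forms and then taking the boundary embeds Z_{j+1}/(θ_1, …, θ_{j+1}) in positive
degree into Z_j/(θ_1, …, θ_j) with degree lowered by one, ending at Z_0 = K. Hence K(Δ) vanishes
above degree d = dim Δ + 1, is at most a line in degree d, and has no socle below degree d.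

Degree map and derivatives. For a facet σ let p_σ be the point supported on σ where the forms take
the values 0, …, 0, 1, and let A_σ be the columns of σ. The functional deg f = ∑_σ f(p_σ) / (det A_σ
· ∏_{x ∈ σ} p_σ(x)) detects degree d of K(Δ); that it is well defined comes from Lagrange
interpolation on a cone. Derivations kill squares in characteristic 2, and for d = 2m the composite
D_J of the derivatives with respect to the entries of rows 2k and 2k+1 in column J_k, k < m,
satisfies D_J deg(g²) = deg(x_J g)² (`iterDer_degreeMap_sq`). If u ≠ 0 but u² = 0, absence of socle
gives a nonzero multiple g of u in degree m and a monomial with x_J g ≠ 0 in degree d. But deg(x_J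
g)² = D_J 0 = 0, a contradiction. -/

namespace ModTwo

open Finset

/-! ### Unsigned simplicial chains and the exactness of Boolean intervals -/

section Boundary

variable {V R : Type*} [DecidableEq V] [CommRing R]

/-- The members of `G` that are obtained from `t` by adding one element. -/
def cofacets (G : Finset (Finset V)) (t : Finset V) : Finset (Finset V) :=
  G.filter fun u => t ⊆ u ∧ u.card = t.card + 1

/-- The boundary of a simplicial chain, without signs. -/
def bdry (G : Finset (Finset V)) (c : Finset V → R) (t : Finset V) : R := ∑ u ∈ cofacets G t, c u

/-- The part of `c` supported on sets of cardinality `j` is a cycle. -/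
def IsCycleAt (G : Finset (Finset V)) (c : Finset V → R) (j : ℕ) : Prop :=
  ∀ t ∈ G, t.card + 1 = j → bdry G c t = 0

variable (R) in
/-- Every cycle on sets of cardinality `j` is a boundary. -/
def ExactAt (G : Finset (Finset V)) (j : ℕ) : Prop :=
  ∀ c : Finset V → R, IsCycleAt G c j → ∃ e : Finset V → R, ∀ u ∈ G, u.card = j → bdry G e u = c u

/-- The members of `G` that contain `s`. -/
def star (G : Finset (Finset V)) (s : Finset V) : Finset (Finset V) := G.filter (s ⊆ ·)

@[simp] lemma mem_star {G : Finset (Finset V)} {s t : Finset V} :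
    t ∈ star G s ↔ t ∈ G ∧ s ⊆ t := by simp [star]

@[simp] lemma mem_cofacets {G : Finset (Finset V)} {t u : Finset V} :
    u ∈ cofacets G t ↔ u ∈ G ∧ t ⊆ u ∧ u.card = t.card + 1 := by simp [cofacets]

lemma bdry_congr {G : Finset (Finset V)} {c c' : Finset V → R} {t : Finset V}
    (h : ∀ u ∈ G, t ⊆ u → u.card = t.card + 1 → c u = c' u) : bdry G c t = bdry G c' t :=
  sum_congr rfl fun u hu => by
    rw [mem_cofacets] at hu
    exact h u hu.1 hu.2.1 hu.2.2

lemma bdry_star {G : Finset (Finset V)} (c : Finset V → R) {s t : Finset V} (h : s ⊆ t) :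
    bdry (star G s) c t = bdry G c t := by
  refine sum_congr ?_ fun _ _ => rfl
  ext u
  simp only [mem_cofacets, mem_star]
  exact ⟨fun hu => ⟨hu.1.1, hu.2⟩, fun hu => ⟨⟨hu.1, h.trans hu.2.1⟩, hu.2⟩⟩

lemma bdry_add (G : Finset (Finset V)) (c c' : Finset V → R) (t : Finset V) :
    bdry G (c + c') t = bdry G c t + bdry G c' t := sum_add_distrib

lemma bdry_sub (G : Finset (Finset V)) (c c' : Finset V → R) (t : Finset V) :
    bdry G (c - c') t = bdry G c t - bdry G c' t := sum_sub_distrib _ _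

lemma bdry_eq_zero {G : Finset (Finset V)} {c : Finset V → R} {t : Finset V}
    (h : ∀ u ∈ G, t ⊆ u → u.card = t.card + 1 → c u = 0) : bdry G c t = 0 :=
  sum_eq_zero fun u hu => by
    rw [mem_cofacets] at hu
    exact h u hu.1 hu.2.1 hu.2.2

lemma bdry_of_subset {G G₁ : Finset (Finset V)} {c : Finset V → R} {t : Finset V} (hsub : G₁ ⊆ G)
    (h : ∀ u ∈ G, u ∉ G₁ → t ⊆ u → u.card = t.card + 1 → c u = 0) :
    bdry G c t = bdry G₁ c t := by
  symm
  refine sum_subset (fun u hu => ?_) fun u hu hu' => ?_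
  · rw [mem_cofacets] at hu ⊢
    exact ⟨hsub hu.1, hu.2⟩
  · rw [mem_cofacets] at hu hu'
    exact h u hu.1 (fun h' => hu' ⟨h', hu.2⟩) hu.2.1 hu.2.2

lemma bdry_ite {G G₁ : Finset (Finset V)} (hsub : G₁ ⊆ G) (c : Finset V → R) (t : Finset V) :
    bdry G (fun u => if u ∈ G₁ then c u else 0) t = bdry G₁ c t := by
  rw [bdry_of_subset hsub fun u _ hu _ _ => if_neg hu]
  exact bdry_congr fun u hu _ _ => if_pos hu

lemma exists_eq_insert_of_cofacet {t u : Finset V} (h : t ⊆ u) (hc : u.card = t.card + 1) :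
    ∃ x, x ∉ t ∧ u = insert x t := by
  have h1 : (u \ t).card = 1 := by rw [card_sdiff_of_subset h]; omega
  obtain ⟨x, hx⟩ := card_eq_one.1 h1
  refine ⟨x, ?_, ?_⟩
  · have : x ∈ u \ t := by simp [hx]
    exact (mem_sdiff.1 this).2
  · rw [← sdiff_union_of_subset h, hx]; rfl

lemma bdry_Icc {α U : Finset V} (c : Finset V → R) {u : Finset V} (hu : u ∈ Icc α U) :
    bdry (Icc α U) c u = ∑ x ∈ U \ u, c (insert x u) := by
  rw [mem_Icc] at hu
  symm
  refine sum_bij (fun x _ => insert x u) ?_ ?_ ?_ ?_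
  · intro x hx
    rw [mem_sdiff] at hx
    rw [mem_cofacets, mem_Icc]
    exact ⟨⟨hu.1.trans (subset_insert _ _), insert_subset hx.1 hu.2⟩, subset_insert _ _,
      card_insert_of_notMem hx.2⟩
  · intro x hx y hy hxy
    rw [mem_sdiff] at hx hy
    have : x ∈ insert y u := hxy ▸ mem_insert_self x u
    exact (mem_insert.1 this).resolve_right hx.2
  · intro w hw
    rw [mem_cofacets, mem_Icc] at hw
    obtain ⟨x, hx, rfl⟩ := exists_eq_insert_of_cofacet hw.2.1 hw.2.2
    exact ⟨x, mem_sdiff.2 ⟨hw.1.2 (mem_insert_self _ _), hx⟩, rfl⟩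
  · intros; rfl

/-- `G₁` is a subcomplex and `G \ G₁` carries the quotient complex: a cofacet of a set outside `G₁`
is again outside. -/
lemma bdry_sdiff {G G₁ : Finset (Finset V)} (hdown : ∀ u ∈ G₁, ∀ t ∈ G, t ⊆ u → t ∈ G₁)
    (c : Finset V → R) {t : Finset V} (ht : t ∈ G) (ht' : t ∉ G₁) :
    bdry G c t = bdry (G \ G₁) c t :=
  bdry_of_subset sdiff_subset fun u hu hu' htu _ =>
    absurd (hdown u (by_contra fun h => hu' (mem_sdiff.2 ⟨hu, h⟩)) t ht htu) ht'

lemma exactAt_of_forall_card_ne {G : Finset (Finset V)} {j : ℕ} (h : ∀ u ∈ G, u.card ≠ j) :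
    ExactAt R G j := fun _ _ => ⟨0, fun u hu huj => absurd huj (h u hu)⟩

variable [CharP R 2]

/-- Between `t` and a set with two more elements lie exactly two sets, both in `G` by
order-convexity; their contributions cancel in characteristic 2. -/
lemma bdry_bdry {G : Finset (Finset V)} (hG : ∀ t ∈ G, ∀ w ∈ G, ∀ u, t ⊆ u → u ⊆ w → u ∈ G)
    (c : Finset V → R) {t : Finset V} (ht : t ∈ G) : bdry G (bdry G c) t = 0 := by
  unfold bdry
  rw [sum_sigma']
  have key : ∀ u w : Finset V, u ∈ cofacets G t → w ∈ cofacets G u →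
      ∃ x y, x ∉ t ∧ y ∉ t ∧ x ≠ y ∧ u = insert x t ∧ w = insert y (insert x t) := by
    intro u w hu hw
    rw [mem_cofacets] at hu hw
    obtain ⟨x, hx, rfl⟩ := exists_eq_insert_of_cofacet hu.2.1 hu.2.2
    obtain ⟨y, hy, rfl⟩ := exists_eq_insert_of_cofacet hw.2.1 hw.2.2
    simp only [mem_insert, not_or] at hy
    exact ⟨x, y, hx, hy.2, fun h => hy.1 h.symm, rfl, rfl⟩
  have hinv : ∀ x y : V, x ∉ t → y ∉ t → x ≠ y →
      t ∪ (insert y (insert x t) \ insert x t) = insert y t := by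
    intro x y hx hy hxy
    ext z
    simp only [mem_union, mem_sdiff, mem_insert, not_or]
    constructor
    · rintro (h | ⟨h1 | h1 | h1, h2, h3⟩)
      · exact Or.inr h
      · exact Or.inl h1
      · exact absurd h1 h2
      · exact absurd h1 h3
    · rintro (rfl | h)
      · exact Or.inr ⟨Or.inl rfl, fun h => hxy h.symm, hy⟩
      · exact Or.inl h
  -- If u = t ∪ {x} and w = t ∪ {x, y}, then t ∪ (w \ u) = t ∪ {y} is the other intermediate set.
  refine sum_involution (fun p _ => ⟨t ∪ (p.2 \ p.1), p.2⟩) ?_ ?_ ?_ ?_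
  · rintro ⟨u, w⟩ _
    exact CharTwo.add_self_eq_zero _
  · rintro ⟨u, w⟩ hp _ heq
    rw [mem_sigma] at hp
    obtain ⟨x, y, hx, hy, hxy, rfl, rfl⟩ := key u w hp.1 hp.2
    have h1 := congrArg Sigma.fst heq
    simp only [hinv x y hx hy hxy] at h1
    have : y ∈ insert x t := h1 ▸ mem_insert_self y t
    simp only [mem_insert] at this
    exact this.elim (fun h => hxy h.symm) hy
  · rintro ⟨u, w⟩ hp
    rw [mem_sigma] at hp
    obtain ⟨x, y, hx, hy, hxy, rfl, rfl⟩ := key u w hp.1 hp.2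
    have hw := (mem_cofacets.1 hp.2).1
    simp only [mem_sigma, hinv x y hx hy hxy, mem_cofacets]
    have hsub : insert y t ⊆ insert y (insert x t) := insert_subset_insert _ (subset_insert _ _)
    refine ⟨⟨hG t ht _ hw _ (subset_insert _ _) hsub, subset_insert _ _,
      card_insert_of_notMem hy⟩, hw, hsub, ?_⟩
    rw [card_insert_of_notMem hy, card_insert_of_notMem, card_insert_of_notMem hx]
    simp [hy, Ne.symm hxy]
  · rintro ⟨u, w⟩ hp
    rw [mem_sigma] at hp
    obtain ⟨x, y, hx, hy, hxy, rfl, rfl⟩ := key u w hp.1 hp.2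
    simp only [hinv x y hx hy hxy]
    congr 1
    rw [insert_comm, hinv y x hy hx hxy.symm]

/-- Adding a point p of U \ α is a contracting homotopy: the interval is a cone with apex p. -/
lemma exactAt_Icc {α U : Finset V} (h : α ⊂ U) (j : ℕ) : ExactAt R (Icc α U) j := by
  intro c hc
  obtain ⟨p, hpU, hpα⟩ := exists_of_ssubset h
  refine ⟨fun w => if p ∈ w then c (w.erase p) else 0, fun u hu hj => ?_⟩
  rw [bdry_Icc _ hu]
  rw [mem_Icc] at hu
  by_cases hp : p ∈ u
  · have hmem : u.erase p ∈ Icc α U :=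
      mem_Icc.2 ⟨subset_erase.2 ⟨hu.1, hpα⟩, (erase_subset _ _).trans hu.2⟩
    have h0 := hc (u.erase p) hmem (by rw [card_erase_add_one hp, hj])
    rw [bdry_Icc _ hmem] at h0
    have hins : U \ u.erase p = insert p (U \ u) := by
      ext z
      simp only [mem_sdiff, mem_erase, mem_insert, not_and]
      by_cases hz : z = p
      · subst hz; simp [hpU]
      · simp [hz]
    rw [hins, sum_insert (by simp [hp]), insert_erase hp] at h0
    rw [CharTwo.add_eq_zero.1 h0]
    refine sum_congr rfl fun x hx => ?_
    rw [mem_sdiff] at hx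
    have hxp : x ≠ p := fun h => hx.2 (h ▸ hp)
    simp [hp, erase_insert_of_ne hxp]
  · rw [sum_eq_single p]
    · simp [erase_insert hp]
    · intro x _ hxp
      simp [hp, Ne.symm hxp]
    · intro h'
      exact absurd (mem_sdiff.2 ⟨hpU, hp⟩) h'

/-- The piece H(G₁) → H(G) → H(G, G₁) of the long exact sequence of a pair. The relative primitive
`e` is corrected by a primitive in `G₁` of what remains. -/
lemma ExactAt.of_sub {G G₁ : Finset (Finset V)} {j : ℕ}
    (hG : ∀ t ∈ G, ∀ w ∈ G, ∀ u, t ⊆ u → u ⊆ w → u ∈ G) (hsub : G₁ ⊆ G)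
    (hdown : ∀ u ∈ G₁, ∀ t ∈ G, t ⊆ u → t ∈ G₁)
    (hI : ExactAt R (G \ G₁) j) (h : ExactAt R G₁ j) : ExactAt R G j := by
  intro c hc
  obtain ⟨e, he⟩ := hI c fun t ht htj => by
    rw [mem_sdiff] at ht
    rw [← bdry_sdiff hdown c ht.1 ht.2]
    exact hc t ht.1 htj
  have he' : ∀ u ∈ G, u ∉ G₁ → u.card = j → bdry G e u = c u := fun u hu hu' huj => by
    rw [bdry_sdiff hdown e hu hu']
    exact he u (mem_sdiff.2 ⟨hu, hu'⟩) huj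
  obtain ⟨e₁, he₁⟩ := h (c - bdry G e) fun t ht htj => by
    rw [← bdry_of_subset hsub, bdry_sub, bdry_bdry hG e (hsub ht), hc t (hsub ht) htj, sub_zero]
    intro u hu hu' _ huc
    simp [he' u hu hu' (by omega)]
  refine ⟨e + fun u => if u ∈ G₁ then e₁ u else 0, fun u hu huj => ?_⟩
  rw [bdry_add]
  by_cases hu' : u ∈ G₁
  · rw [bdry_ite hsub, he₁ u hu' huj]
    simp
  · rw [he' u hu hu' huj, bdry_eq_zero, add_zero]
    intro w _ huw _
    exact if_neg fun h => hu' (hdown w h u hu huw)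

/-- The piece of the long exact sequence with the connecting map, H(G, G₁) → H(G₁) → H(G), which is
why the relative term is needed one cardinality higher. -/
lemma ExactAt.sub {G G₁ : Finset (Finset V)} {j : ℕ}
    (hG : ∀ t ∈ G, ∀ w ∈ G, ∀ u, t ⊆ u → u ⊆ w → u ∈ G) (hsub : G₁ ⊆ G)
    (hdown : ∀ u ∈ G₁, ∀ t ∈ G, t ⊆ u → t ∈ G₁)
    (hI : ExactAt R (G \ G₁) (j + 1)) (h : ExactAt R G j) : ExactAt R G₁ j := by
  intro c hc
  obtain ⟨e, he⟩ := h (fun u => if u ∈ G₁ then c u else 0) fun t ht htj => by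
    by_cases ht' : t ∈ G₁
    · rw [bdry_ite hsub, hc t ht' htj]
    · exact bdry_eq_zero fun w _ htw _ => if_neg fun h => ht' (hdown w h t ht htw)
  obtain ⟨k, hk⟩ := hI e fun t ht htj => by
    rw [mem_sdiff] at ht
    rw [← bdry_sdiff hdown e ht.1 ht.2, he t ht.1 (by omega), if_neg ht.2]
  -- The correction makes `e` vanish on the larger sets outside `G₁` without changing its boundary.
  refine ⟨e - bdry G k, fun u hu huj => ?_⟩
  rw [← bdry_of_subset hsub, bdry_sub, bdry_bdry hG k (hsub hu), he u (hsub hu) huj, if_pos hu,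
    sub_zero]
  intro w hw hw' _ hwc
  rw [Pi.sub_apply, bdry_sdiff hdown k hw hw', hk w (mem_sdiff.2 ⟨hw, hw'⟩) (by omega), sub_self]

end Boundary

/-! ### Mod-two spheres and their invariance under flips -/

section Sphere

variable {V : Type*} (R : Type*) [DecidableEq V] [CommRing R]

/-- `G` is the set of faces of a simplicial complex all of whose links have the homology with
coefficients in the ring `R` of characteristic two of a sphere of dimension `d - 1 - |s|`. The links
are described through stars. -/
structure IsModTwoSphere (G : Finset (Finset V)) (d : ℕ) : Prop where
  empty_mem : ∅ ∈ G
  down : ∀ s ∈ G, ∀ t ⊆ s, t ∈ G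
  card_le : ∀ s ∈ G, s.card ≤ d
  exact : ∀ s ∈ G, ∀ j < d, ExactAt R (star G s) j
  top : ∀ s ∈ G, ∀ c : Finset V → R, IsCycleAt (star G s) c d →
    ∃ a, ∀ u ∈ star G s, u.card = d → c u = a
  even : IsCycleAt G (1 : Finset V → R) d

variable {R}

/-- In the star of `s`, every chain is a cycle at the cardinality of `s`, since no smaller sets
occur. Exactness there forces `s` to have a cofacet as long as it has fewer than `d` elements. -/
lemma IsModTwoSphere.exists_facet [Nontrivial R] {G : Finset (Finset V)} {d : ℕ}
    (h : IsModTwoSphere R G d) {s : Finset V} (hs : s ∈ G) : ∃ u ∈ G, s ⊆ u ∧ u.card = d := by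
  induction hk : d - s.card generalizing s with
  | zero => exact ⟨s, hs, Subset.rfl, le_antisymm (h.card_le s hs) (by omega)⟩
  | succ k ih =>
    obtain ⟨e, he⟩ := h.exact s hs s.card (by omega) 1 fun t ht htc => by
      have := card_le_card (mem_star.1 ht).2
      omega
    have h1 := he s (mem_star.2 ⟨hs, Subset.rfl⟩) rfl
    have : ∃ u ∈ cofacets (star G s) s, e u ≠ 0 := by
      by_contra! hcon
      rw [bdry, sum_eq_zero hcon] at h1
      exact zero_ne_one h1
    obtain ⟨u, hu, _⟩ := this
    rw [mem_cofacets, mem_star] at hu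
    obtain ⟨w, hw, huw, hwd⟩ := ih hu.1.1 (by omega)
    exact ⟨w, hw, hu.2.1.trans huw, hwd⟩

variable [CharP R 2]

lemma star_ordConnected {G : Finset (Finset V)} (hG : ∀ s ∈ G, ∀ t ⊆ s, t ∈ G) (s : Finset V) :
    ∀ t ∈ star G s, ∀ w ∈ star G s, ∀ u, t ⊆ u → u ⊆ w → u ∈ star G s := by
  intro t ht w hw u htu huw
  rw [mem_star] at *
  exact ⟨hG w hw.1 u huw, ht.2.trans htu⟩

/-- Replacing the simplices containing `τ` by those containing `σ`, where both are the interior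
faces of complementary balls in the boundary of the simplex `σ ∪ τ`. -/
theorem IsModTwoSphere.flip [Nontrivial R] {Γ G G' : Finset (Finset V)} {σ τ : Finset V} {d : ℕ}
    (hΓ : ∀ s ∈ Γ, ∀ t ⊆ s, t ∈ Γ) (hU : σ ∪ τ ∈ Γ) (hσne : σ.Nonempty)
    (hdisj : Disjoint σ τ) (hcard : (σ ∪ τ).card = d + 1)
    (hσ : ∀ t ∈ Γ, σ ⊆ t → t ⊆ σ ∪ τ) (hτ : ∀ t ∈ Γ, τ ⊆ t → t ⊆ σ ∪ τ)
    (hG : ∀ t, t ∈ G ↔ t ∈ Γ ∧ ¬ τ ⊆ t) (hG' : ∀ t, t ∈ G' ↔ t ∈ Γ ∧ ¬ σ ⊆ t)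
    (h : IsModTwoSphere R G d) : IsModTwoSphere R G' d := by
  have hconn := star_ordConnected hΓ
  have hsub : ∀ s, star G s ⊆ star Γ s := fun s t ht => by
    rw [mem_star, hG] at ht; exact mem_star.2 ⟨ht.1.1, ht.2⟩
  have hsub' : ∀ s, star G' s ⊆ star Γ s := fun s t ht => by
    rw [mem_star, hG'] at ht; exact mem_star.2 ⟨ht.1.1, ht.2⟩
  have hdown : ∀ s, ∀ u ∈ star G s, ∀ t ∈ star Γ s, t ⊆ u → t ∈ star G s := by
    intro s u hu t ht htu
    rw [mem_star, hG] at *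
    exact ⟨⟨ht.1, fun h' => hu.1.2 (h'.trans htu)⟩, ht.2⟩
  have hdown' : ∀ s, ∀ u ∈ star G' s, ∀ t ∈ star Γ s, t ⊆ u → t ∈ star G' s := by
    intro s u hu t ht htu
    rw [mem_star] at *
    rw [hG'] at *
    exact ⟨⟨ht.1, fun h' => hu.1.2 (h'.trans htu)⟩, ht.2⟩
  -- The faces that separate the star in `Γ` from the star in `G` form a Boolean interval. It is
  -- nondegenerate, hence acyclic, unless `s` contains σ, which is excluded for faces of `G'`.
  have hIcc : ∀ s, s ⊆ σ ∪ τ → star Γ s \ star G s = Icc (τ ∪ s) (σ ∪ τ) := by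
    intro s hs
    ext t
    simp only [mem_sdiff, mem_star, hG, mem_Icc, union_subset_iff]
    constructor
    · rintro ⟨⟨h1, h2⟩, h3⟩
      have : τ ⊆ t := by tauto
      exact ⟨⟨this, h2⟩, hτ t h1 this⟩
    · rintro ⟨⟨h1, h2⟩, h3⟩
      exact ⟨⟨hΓ _ hU t h3, h2⟩, by tauto⟩
  have hIcc' : ∀ s, s ⊆ σ ∪ τ → star Γ s \ star G' s = Icc (σ ∪ s) (σ ∪ τ) := by
    intro s hs
    ext t
    simp only [mem_sdiff, mem_star, hG', mem_Icc, union_subset_iff]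
    constructor
    · rintro ⟨⟨h1, h2⟩, h3⟩
      have : σ ⊆ t := by tauto
      exact ⟨⟨this, h2⟩, hσ t h1 this⟩
    · rintro ⟨⟨h1, h2⟩, h3⟩
      exact ⟨⟨hΓ _ hU t h3, h2⟩, by tauto⟩
  have hexI : ∀ s, ¬ σ ⊆ s → ∀ j, ExactAt R (star Γ s \ star G s) j := by
    intro s hs j
    by_cases hsU : s ⊆ σ ∪ τ
    · rw [hIcc s hsU]
      refine exactAt_Icc (ssubset_of_subset_of_ne (union_subset subset_union_right hsU) ?_) j
      intro heq
      refine hs fun x hx => ?_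
      have : x ∈ τ ∪ s := heq ▸ mem_union_left τ hx
      exact (mem_union.1 this).resolve_left (disjoint_left.1 hdisj hx)
    · refine exactAt_of_forall_card_ne fun u hu => ?_
      simp only [mem_sdiff, mem_star, hG] at hu
      exact absurd (hu.1.2.trans (hτ u hu.1.1 (by tauto))) hsU
  have hexI' : ∀ s, ¬ τ ⊆ s → ∀ j, ExactAt R (star Γ s \ star G' s) j := by
    intro s hs j
    by_cases hsU : s ⊆ σ ∪ τ
    · rw [hIcc' s hsU]
      refine exactAt_Icc (ssubset_of_subset_of_ne (union_subset subset_union_left hsU) ?_) j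
      intro heq
      refine hs fun x hx => ?_
      have : x ∈ σ ∪ s := heq ▸ mem_union_right σ hx
      exact (mem_union.1 this).resolve_left (disjoint_right.1 hdisj hx)
    · refine exactAt_of_forall_card_ne fun u hu => ?_
      simp only [mem_sdiff, mem_star, hG'] at hu
      exact absurd (hu.1.2.trans (hσ u hu.1.1 (by tauto))) hsU
  -- For the new faces, those containing τ, the link is the boundary of the simplex (σ ∪ τ) \ s.
  have hIco : ∀ s, τ ⊆ s → s ⊆ σ ∪ τ → star G' s = Icc s (σ ∪ τ) \ {σ ∪ τ} := by
    intro s hs hsU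
    ext t
    simp only [mem_star, hG', mem_sdiff, mem_Icc, mem_singleton]
    constructor
    · rintro ⟨⟨h1, h2⟩, h3⟩
      exact ⟨⟨h3, hτ t h1 (hs.trans h3)⟩, fun heq => h2 (heq ▸ subset_union_left)⟩
    · rintro ⟨⟨h1, h2⟩, h3⟩
      exact ⟨⟨hΓ _ hU t h2, fun h4 => h3 (h2.antisymm (union_subset h4 (hs.trans h1)))⟩, h1⟩
  -- a subset of `σ ∪ τ` with `d` elements misses one element
  have hmiss : ∀ u, u ⊆ σ ∪ τ → u.card = d → (σ ⊆ u ↔ ¬ τ ⊆ u) := by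
    intro u hu hud
    have h1 : ((σ ∪ τ) \ u).card = 1 := by rw [card_sdiff_of_subset hu]; omega
    obtain ⟨x, hx⟩ := card_eq_one.1 h1
    have hx' : ∀ y, y ∈ (σ ∪ τ) \ u ↔ y = x := by simp [hx]
    have hxm := (hx' x).2 rfl
    rw [mem_sdiff, mem_union] at hxm
    constructor
    · intro h2 h3
      exact hxm.2 (hxm.1.elim (fun h => h2 h) fun h => h3 h)
    · intro h2 y hy
      by_contra hyu
      have hyx := (hx' y).1 (mem_sdiff.2 ⟨mem_union_left _ hy, hyu⟩)
      refine h2 fun z hz => ?_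
      by_contra hzu
      have hzx := (hx' z).1 (mem_sdiff.2 ⟨mem_union_right _ hz, hzu⟩)
      exact disjoint_left.1 hdisj hy (by rw [hyx, ← hzx]; exact hz)
  -- Since σ ∪ τ has d + 1 elements, it is the only possible cofacet inside it of a set with d
  -- elements.
  have hUcof : ∀ (c : Finset V → R) (X : Finset (Finset V)), X ⊆ Icc ∅ (σ ∪ τ) → σ ∪ τ ∈ X →
      ∀ u ∈ X, u.card = d → bdry X c u = c (σ ∪ τ) := by
    intro c X hX hUX u hu hud
    have hcof : cofacets X u = {σ ∪ τ} := by
      ext w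
      rw [mem_cofacets, mem_singleton]
      constructor
      · rintro ⟨h1, h2, h3⟩
        exact eq_of_subset_of_card_le (mem_Icc.1 (hX h1)).2 (by omega)
      · rintro rfl
        exact ⟨hUX, (mem_Icc.1 (hX hu)).2, by omega⟩
    rw [bdry, hcof, sum_singleton]
  refine ⟨(hG' _).2 ⟨hΓ _ hU _ (empty_subset _), fun h' => hσne.ne_empty (subset_empty.1 h')⟩,
    ?_, ?_, ?_, ?_, ?_⟩
  · intro s hs t hts
    rw [hG'] at hs ⊢
    exact ⟨hΓ s hs.1 t hts, fun h' => hs.2 (h'.trans hts)⟩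
  · intro s hs
    rw [hG'] at hs
    by_cases hsτ : τ ⊆ s
    · have h1 : s ⊂ σ ∪ τ := ssubset_of_subset_of_ne (hτ s hs.1 hsτ)
        fun heq => hs.2 (heq ▸ subset_union_left)
      have := card_lt_card h1
      omega
    · exact h.card_le s ((hG s).2 ⟨hs.1, hsτ⟩)
  · intro s hs j hj
    have hs' := (hG' s).1 hs
    by_cases hsτ : τ ⊆ s
    · have hsU := hτ s hs'.1 hsτ
      rw [hIco s hsτ hsU]
      refine ExactAt.sub (G := Icc s (σ ∪ τ)) ?_ sdiff_subset ?_ ?_ (exactAt_Icc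
        (ssubset_of_subset_of_ne hsU fun heq => hs'.2 (heq ▸ subset_union_left)) j)
      · intro t ht w hw u htu huw
        rw [mem_Icc] at *
        exact ⟨ht.1.trans htu, huw.trans hw.2⟩
      · intro u hu t ht htu
        rw [mem_sdiff, mem_singleton] at *
        exact ⟨ht, fun heq => hu.2 ((mem_Icc.1 hu.1).2.antisymm (heq ▸ htu))⟩
      · refine exactAt_of_forall_card_ne fun u hu => ?_
        rw [mem_sdiff, mem_sdiff, mem_singleton, not_and, not_not] at hu
        rw [hu.2 hu.1, hcard]
        omega
    -- Exactness goes up from the star in `G` to the star in `Γ`, then down to the star in `G'`.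
    · exact ExactAt.sub (hconn s) (hsub' s) (hdown' s) (hexI' s hsτ _)
        (ExactAt.of_sub (hconn s) (hsub s) (hdown s) (hexI s hs'.2 j)
          (h.exact s ((hG s).2 ⟨hs'.1, hsτ⟩) j hj))
  · intro s hs c hc
    have hs' := (hG' s).1 hs
    by_cases hsτ : τ ⊆ s
    · have hsU := hτ s hs'.1 hsτ
      rw [hIco s hsτ hsU] at hc ⊢
      obtain ⟨e, he⟩ := exactAt_Icc (R := R)
        (ssubset_of_subset_of_ne hsU fun heq => hs'.2 (heq ▸ subset_union_left)) d c
        fun t ht htd => by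
          rw [bdry_of_subset (G₁ := Icc s (σ ∪ τ) \ {σ ∪ τ}) sdiff_subset]
          · refine hc t (mem_sdiff.2 ⟨ht, fun heq => ?_⟩) htd
            rw [mem_singleton.1 heq] at htd
            omega
          · intro u hu hu' _ huc
            rw [mem_sdiff, mem_singleton, not_and, not_not] at hu'
            rw [hu' hu, hcard] at huc
            omega
      refine ⟨e (σ ∪ τ), fun u hu hud => ?_⟩
      rw [mem_sdiff] at hu
      rw [← he u hu.1 hud]
      exact hUcof e _ (Icc_subset_Icc_left (empty_subset _)) (by simp [hsU]) u hu.1 hud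
    · have hsG : s ∈ G := (hG s).2 ⟨hs'.1, hsτ⟩
      -- Extension by zero turns a top cycle of `G'` into a cycle of `Γ`; subtracting a multiple of
      -- the boundary of σ ∪ τ will move it into `G`.
      set c₀ : Finset V → R := fun u => if u ∈ star G' s then c u else 0 with hc₀
      have hc₀c : IsCycleAt (star Γ s) c₀ d := by
        intro t ht htd
        by_cases ht' : t ∈ star G' s
        · rw [hc₀, bdry_ite (hsub' s), hc t ht' htd]
        · exact bdry_eq_zero fun w _ htw _ => if_neg fun h => ht' (hdown' s w h t ht htw)
      by_cases hsU : s ⊆ σ ∪ τ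
      · obtain ⟨e, he⟩ := hexI s hs'.2 d c₀ fun t ht htd => by
          rw [mem_sdiff] at ht
          rw [← bdry_sdiff (hdown s) c₀ ht.1 ht.2]
          exact hc₀c t ht.1 htd
        set e₁ : Finset V → R := fun w => if w = σ ∪ τ then e w else 0 with he₁
        have hb : ∀ u ∈ star Γ s, u.card = d →
            bdry (star Γ s) e₁ u = if u ⊆ σ ∪ τ then e (σ ∪ τ) else 0 := by
          intro u hu hud
          split_ifs with huU
          · rw [bdry_of_subset (G₁ := Icc s (σ ∪ τ)), hUcof e₁ _
              (Icc_subset_Icc_left (empty_subset _)) (by simp [hsU]) u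
              (mem_Icc.2 ⟨(mem_star.1 hu).2, huU⟩) hud]
            · simp [he₁]
            · intro t ht
              rw [mem_Icc] at ht
              exact mem_star.2 ⟨hΓ _ hU t ht.2, ht.1⟩
            · intro w hw hw' _ _
              refine if_neg fun heq => hw' ?_
              rw [heq]
              simp [hsU]
          · exact bdry_eq_zero fun w _ huw _ => if_neg fun heq : w = σ ∪ τ => huU (heq ▸ huw)
        have hc₁ : ∀ u ∈ star Γ s, u ∉ star G s → u.card = d →
            (c₀ - bdry (star Γ s) e₁) u = 0 := by
          intro u hu hu' hud
          have huI : u ∈ star Γ s \ star G s := mem_sdiff.2 ⟨hu, hu'⟩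
          have huU : u ⊆ σ ∪ τ := by
            rw [hIcc s hsU, mem_Icc] at huI
            exact huI.2
          rw [Pi.sub_apply, ← he u huI hud, hb u hu hud, if_pos huU]
          rw [hUcof e (star Γ s \ star G s) ?_ ?_ u huI hud, sub_self]
          · rw [hIcc s hsU]
            exact Icc_subset_Icc_left (empty_subset _)
          · rw [hIcc s hsU]
            exact mem_Icc.2 ⟨union_subset subset_union_right hsU, Subset.rfl⟩
        obtain ⟨a, ha⟩ := h.top s hsG (c₀ - bdry (star Γ s) e₁) fun t ht htd => by
          rw [← bdry_of_subset (hsub s), bdry_sub, bdry_bdry (hconn s) e₁ (hsub s ht),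
            hc₀c t (hsub s ht) htd, sub_zero]
          intro u hu hu' _ huc
          exact hc₁ u hu hu' (by omega)
        -- The constant on `G` and the multiple of ∂(σ ∪ τ) are compared on the facet omitting some
        -- p ∈ τ \ s: it contains σ, so `c₀` vanishes there, and it does not contain τ, so it lies
        -- in `G`.
        have ha' : a = e (σ ∪ τ) := by
          obtain ⟨p, hp, hps⟩ := not_subset.1 hsτ
          have hpU : p ∈ σ ∪ τ := mem_union_right _ hp
          have hud : ((σ ∪ τ).erase p).card = d := by rw [card_erase_of_mem hpU]; omega
          have hu1 : ¬ τ ⊆ (σ ∪ τ).erase p := fun h' => by simpa using h' hp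
          have hu2 : (σ ∪ τ).erase p ∈ star Γ s :=
            mem_star.2 ⟨hΓ _ hU _ (erase_subset _ _), subset_erase.2 ⟨hsU, hps⟩⟩
          have hu3 : (σ ∪ τ).erase p ∈ star G s :=
            mem_star.2 ⟨(hG _).2 ⟨(mem_star.1 hu2).1, hu1⟩, (mem_star.1 hu2).2⟩
          rw [← ha _ hu3 hud, Pi.sub_apply, hb _ hu2 hud, if_pos (erase_subset _ _)]
          have : c₀ ((σ ∪ τ).erase p) = 0 := by
            refine if_neg fun h' => ?_
            rw [mem_star, hG'] at h'
            exact h'.1.2 ((hmiss _ (erase_subset _ _) hud).2 hu1)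
          rw [this, zero_sub, CharTwo.neg_eq]
        refine ⟨a, fun u hu hud => ?_⟩
        have hcu : c₀ u = c u := if_pos hu
        have hu' := (hG' u).1 (mem_star.1 hu).1
        by_cases huU : u ⊆ σ ∪ τ
        · have huτ : τ ⊆ u := by
            by_contra h'
            exact hu'.2 ((hmiss u huU hud).2 h')
          have huG : u ∉ star G s := fun h' => by
            rw [mem_star, hG] at h'
            exact h'.1.2 huτ
          have := hc₁ u (hsub' s hu) huG hud
          rw [Pi.sub_apply, hb u (hsub' s hu) hud, if_pos huU, sub_eq_zero] at this
          rw [← hcu, this, ha']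
        · have huτ : ¬ τ ⊆ u := fun h' => huU (hτ u hu'.1 h')
          have := ha u (mem_star.2 ⟨(hG u).2 ⟨hu'.1, huτ⟩, (mem_star.1 hu).2⟩) hud
          rw [Pi.sub_apply, hb u (hsub' s hu) hud, if_neg huU, sub_zero] at this
          rw [← hcu, this]
      · have hnot : ∀ u ∈ star Γ s, ¬ σ ⊆ u ∧ ¬ τ ⊆ u := fun u hu => by
          rw [mem_star] at hu
          exact ⟨fun h' => hsU (hu.2.trans (hσ u hu.1 h')),
            fun h' => hsU (hu.2.trans (hτ u hu.1 h'))⟩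
        have heq : star G s = star G' s := by
          ext u
          constructor
          · intro hu
            exact mem_star.2 ⟨(hG' u).2 ⟨(mem_star.1 (hsub s hu)).1, (hnot u (hsub s hu)).1⟩,
              (mem_star.1 hu).2⟩
          · intro hu
            exact mem_star.2 ⟨(hG u).2 ⟨(mem_star.1 (hsub' s hu)).1, (hnot u (hsub' s hu)).2⟩,
              (mem_star.1 hu).2⟩
        rw [← heq] at hc ⊢
        exact h.top s hsG c hc
  · intro t ht htd
    have ht' := (hG' t).1 ht
    have hsubΓ : G ⊆ Γ := fun u hu => ((hG u).1 hu).1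
    have hsubΓ' : G' ⊆ Γ := fun u hu => ((hG' u).1 hu).1
    have hconnΓ : ∀ t ∈ Γ, ∀ w ∈ Γ, ∀ u, t ⊆ u → u ⊆ w → u ∈ Γ :=
      fun t _ w hw u _ huw => hΓ w hw u huw
    have h1 : bdry Γ (fun u => if u ∈ G then (1 : R) else 0) t = 0 := by
      by_cases htG : t ∈ G
      · rw [bdry_ite hsubΓ fun _ => (1 : R)]
        exact h.even t htG htd
      · refine bdry_eq_zero fun w _ htw _ => if_neg fun hw => htG ?_
        exact h.down w hw t htw
    have h2 := bdry_bdry hconnΓ (fun w => if w = σ ∪ τ then (1 : R) else 0) ht'.1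
    change bdry G' (fun _ => (1 : R)) t = 0
    rw [← bdry_ite hsubΓ']
    -- On sets with d elements, the indicators of `G` and `G'` differ by the boundary of σ ∪ τ,
    -- because each facet of this simplex contains exactly one of σ and τ.
    suffices hs : bdry Γ ((fun u => if u ∈ G' then (1 : R) else 0) +
        bdry Γ fun w => if w = σ ∪ τ then (1 : R) else 0) t =
        bdry Γ (fun u => if u ∈ G then (1 : R) else 0) t by
      rwa [bdry_add, h2, add_zero, h1] at hs
    refine bdry_congr fun u hu htu huc => ?_
    have hud : u.card = d := by omega
    have hb : bdry Γ (fun w => if w = σ ∪ τ then (1 : R) else 0) u =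
        if u ⊆ σ ∪ τ then 1 else 0 := by
      split_ifs with huU
      · rw [bdry_of_subset (G₁ := Icc ∅ (σ ∪ τ)), hUcof _ _ Subset.rfl (by simp) u
          (mem_Icc.2 ⟨empty_subset _, huU⟩) hud, if_pos rfl]
        · intro w hw
          exact hΓ _ hU w (mem_Icc.1 hw).2
        · intro w _ hw' _ _
          refine if_neg fun heq => hw' ?_
          simp [heq]
      · exact bdry_eq_zero fun w _ huw _ => if_neg fun heq : w = σ ∪ τ => huU (heq ▸ huw)
    rw [Pi.add_apply, hb]
    by_cases huU : u ⊆ σ ∪ τ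
    · have hm := hmiss u huU hud
      rw [if_pos huU]
      by_cases huσ : σ ⊆ u
      · rw [if_neg (fun h' => ((hG' u).1 h').2 huσ), if_pos ((hG u).2 ⟨hu, hm.1 huσ⟩), zero_add]
      · rw [if_pos ((hG' u).2 ⟨hu, huσ⟩), if_neg (fun h' => huσ (hm.2 ((hG u).1 h').2)),
          CharTwo.add_self_eq_zero]
    · rw [if_neg huU, add_zero, if_pos ((hG' u).2 ⟨hu, fun h' => huU (hσ u hu h')⟩),
        if_pos ((hG u).2 ⟨hu, fun h' => huU (hτ u hu h')⟩)]

end Sphere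

/-! ### Extension of the coefficient field -/

section BaseChange

variable {V W F K : Type*} [DecidableEq V] [DecidableEq W] [Field F] [Field K] [Algebra F K]

lemma map_bdry {R M : Type*} [CommRing R] [CommRing M] (φ : R →+ M) (G : Finset (Finset V))
    (c : Finset V → R) (t : Finset V) : bdry G (fun u => φ (c u)) t = φ (bdry G c t) := by
  simp [bdry, map_sum]

lemma IsCycleAt.map {R M : Type*} [CommRing R] [CommRing M] (φ : R →+ M) {G : Finset (Finset V)}
    {c : Finset V → R} {j : ℕ} (h : IsCycleAt G c j) : IsCycleAt G (fun u => φ (c u)) j :=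
  fun t ht htj => by rw [map_bdry, h t ht htj, map_zero]

/-- The boundary has coefficients in the prime field, so it acts separately on the coordinates with
respect to an `F`-basis of `K`; only finitely many coordinates occur. -/
lemma ExactAt.baseChange {G : Finset (Finset V)} {j : ℕ} (h : ExactAt F G j) : ExactAt K G j := by
  classical
  intro c hc
  let b := Module.Basis.ofVectorSpace F K
  have hcyc : ∀ i, IsCycleAt G (fun u => b.repr (c u) i) j := fun i =>
    hc.map (b.coord i).toAddMonoidHom
  choose e he using fun i => h _ (hcyc i)
  let T := G.biUnion fun u => (b.repr (c u)).support
  refine ⟨∑ i ∈ T, fun u => algebraMap F K (e i u) * b i, fun u hu huj => ?_⟩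
  have h1 : bdry G (∑ i ∈ T, fun u => algebraMap F K (e i u) * b i) u =
      ∑ i ∈ T, algebraMap F K (bdry G (e i) u) * b i := by
    simp only [bdry, Finset.sum_apply, map_sum, sum_mul]
    exact sum_comm
  rw [h1]
  conv_rhs => rw [← b.linearCombination_repr (c u)]
  rw [Finsupp.linearCombination_apply, Finsupp.sum_of_support_subset (s := T)]
  · exact sum_congr rfl fun i _ => by rw [he i u hu huj, Algebra.smul_def]
  · exact fun i hi => mem_biUnion.2 ⟨u, hu, hi⟩
  · simp

lemma IsModTwoSphere.baseChange {G : Finset (Finset V)} {d : ℕ}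
    (h : IsModTwoSphere F G d) : IsModTwoSphere K G d where
  empty_mem := h.empty_mem
  down := h.down
  card_le := h.card_le
  exact s hs j hj := (h.exact s hs j hj).baseChange
  top s hs c hc := by
    let b := Module.Basis.ofVectorSpace F K
    obtain ⟨w, hw, hsw, hwd⟩ := h.exists_facet hs
    refine ⟨c w, fun u hu hud => b.repr.injective (Finsupp.ext fun i => ?_)⟩
    obtain ⟨a, ha⟩ := h.top s hs _ (hc.map (b.coord i).toAddMonoidHom)
    exact (ha u hu hud).trans (ha w (mem_star.2 ⟨hw, hsw⟩) hwd).symm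
  even := by
    have := h.even.map (algebraMap F K).toAddMonoidHom
    simpa [Pi.one_def] using this

end BaseChange

/-! ### Changing the ambient vertex type -/

section Transfer

variable {V W R : Type*} [DecidableEq V] [DecidableEq W] [CommRing R]

/-- Needed because the face ring has variables only for the actual vertices, while faces are sets in
an ambient type. -/
lemma IsModTwoSphere.comap {G : Finset (Finset V)} {d : ℕ} (h : IsModTwoSphere R G d)
    (f : W ↪ V) (hf : ∀ s ∈ G, ∃ t : Finset W, t.map f = s) {G' : Finset (Finset W)}
    (hG' : ∀ t, t ∈ G' ↔ t.map f ∈ G) : IsModTwoSphere R G' d := by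
  let g : Finset V → Finset W := fun s => s.preimage f f.injective.injOn
  have hg : ∀ t : Finset W, g (t.map f) = t := fun t => by
    ext x; simp [g]
  have hb : ∀ (s t : Finset W) (c : Finset V → R),
      bdry (star G' s) (fun u => c (u.map f)) t = bdry (star G (s.map f)) c (t.map f) := by
    intro s t c
    refine sum_bij (fun u _ => u.map f) ?_ ?_ ?_ ?_
    · intro u hu
      simp only [mem_cofacets, mem_star, hG'] at hu ⊢
      simpa using hu
    · intro u _ u' _ huu'
      exact map_injective f huu'
    · intro u hu
      simp only [mem_cofacets, mem_star] at hu
      obtain ⟨u', rfl⟩ := hf u hu.1.1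
      refine ⟨u', ?_, rfl⟩
      simp only [mem_cofacets, mem_star, hG']
      simpa using hu
    · intros; rfl
  have hb' : ∀ (s t : Finset W) (c : Finset W → R),
      bdry (star G (s.map f)) (fun u => c (g u)) (t.map f) = bdry (star G' s) c t := by
    intro s t c
    rw [← hb s t fun u => c (g u)]
    simp only [hg]
  have hcyc : ∀ (s : Finset W) (c : Finset W → R) (j : ℕ), IsCycleAt (star G' s) c j →
      IsCycleAt (star G (s.map f)) (fun u => c (g u)) j := by
    intro s c j hc t ht htj
    obtain ⟨t, rfl⟩ := hf t (mem_star.1 ht).1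
    rw [hb']
    refine hc t ?_ (by simpa using htj)
    rw [mem_star, hG']
    simpa using ht
  refine ⟨(hG' _).2 (by simpa using h.empty_mem), ?_, ?_, ?_, ?_, ?_⟩
  · intro s hs t hts
    exact (hG' _).2 (h.down _ ((hG' s).1 hs) _ (map_subset_map.2 hts))
  · intro s hs
    simpa using h.card_le _ ((hG' s).1 hs)
  · intro s hs j hj c hc
    obtain ⟨e, he⟩ := h.exact _ ((hG' s).1 hs) j hj _ (hcyc s c j hc)
    refine ⟨fun u => e (u.map f), fun u hu huj => ?_⟩
    rw [hb, he (u.map f) ?_ (by simpa using huj), hg]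
    simpa [hG'] using hu
  · intro s hs c hc
    obtain ⟨a, ha⟩ := h.top _ ((hG' s).1 hs) _ (hcyc s c d hc)
    refine ⟨a, fun u hu hud => ?_⟩
    rw [← ha (u.map f) ?_ (by simpa using hud), hg]
    simpa [hG'] using hu
  · intro t ht htd
    have h1 := hb ∅ t 1
    rw [bdry_star _ (empty_subset _), bdry_star _ (by simp),
      h.even _ ((hG' t).1 ht) (by simpa using htd)] at h1
    exact h1

end Transfer

/-! ### Bistellar moves as flips -/

section Complex

variable {V : Type*} {R : Type*} [DecidableEq V] [CommRing R] [Nontrivial R]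

theorem IsModTwoSphere.bistellarMove [CharP R 2] {Δ Δ' : FinComplex V} {q : ℕ}
    (h : IsModTwoSphere R Δ.faces Δ.rank) (hq : FinComplex.IsBistellarMove q Δ Δ') :
    IsModTwoSphere R Δ'.faces Δ.rank := by
  obtain ⟨_, σ, τ, hσ, hσne, hσq, hτq, hτ, hlink, hfaces⟩ := hq
  have hl : ∀ t, (t ∈ Δ.faces ∧ t ∪ σ ∈ Δ.faces ∧ t ∩ σ = ∅) ↔ t ⊂ τ := by
    intro t
    rw [← mem_ssubsets, ← hlink]
    simp [FinComplex.link]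
  have hdisj : Disjoint σ τ := by
    rw [disjoint_left]
    intro v hvσ hvτ
    have hsub : {v} ⊆ τ := singleton_subset_iff.2 hvτ
    by_cases hv : {v} = τ
    · exact hτ (hv ▸ Δ.down_closed σ hσ _ (singleton_subset_iff.2 hvσ))
    · have := ((hl {v}).2 (ssubset_of_subset_of_ne hsub hv)).2.2
      rw [singleton_inter_of_mem hvσ] at this
      simp at this
  have hstar : ∀ t ∈ Δ.faces, σ ⊆ t → t ⊆ σ ∪ τ := by
    intro t ht hσt
    have h1 := (hl (t \ σ)).1 ⟨Δ.down_closed t ht _ sdiff_subset,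
      by rwa [sdiff_union_of_subset hσt], sdiff_inter_self _ _⟩
    rw [← sdiff_union_of_subset hσt, union_comm]
    exact union_subset_union_right h1.1
  -- Γ adds to Δ the full simplex on σ ∪ τ, whose boundary is the union of the ball removed by the
  -- move and the ball inserted by it.
  refine h.flip (Γ := Δ.faces ∪ (σ ∪ τ).powerset) (σ := σ) (τ := τ) ?_ ?_ hσne hdisj ?_ ?_ ?_ ?_ ?_
  · intro s hs t hts
    rw [mem_union, mem_powerset] at *
    exact hs.imp (fun h1 => Δ.down_closed s h1 t hts) hts.trans
  · exact mem_union_right _ (mem_powerset.2 Subset.rfl)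
  · rw [card_union_of_disjoint hdisj]; omega
  · intro t ht hσt
    rw [mem_union, mem_powerset] at ht
    exact ht.elim (fun h1 => hstar t h1 hσt) id
  · intro t ht hτt
    rw [mem_union, mem_powerset] at ht
    exact ht.elim (fun h1 => absurd (Δ.down_closed t h1 τ hτt) hτ) id
  · intro t
    rw [mem_union, mem_powerset]
    constructor
    · exact fun ht => ⟨Or.inl ht, fun hτt => hτ (Δ.down_closed t ht τ hτt)⟩
    · rintro ⟨ht | ht, hτt⟩
      · exact ht
      -- A subset of σ ∪ τ not containing τ meets τ in a proper subset, hence in a face of the link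
      -- of σ, so it lies in a face of Δ.
      · have h1 := (hl (t ∩ τ)).2 (ssubset_of_subset_of_ne inter_subset_right
          fun heq => hτt (inter_eq_right.1 heq))
        refine Δ.down_closed _ h1.2.1 t fun x hx => ?_
        rcases mem_union.1 (ht hx) with hxσ | hxτ
        · exact mem_union_right _ hxσ
        · exact mem_union_left _ (mem_inter.2 ⟨hx, hxτ⟩)
  · intro t
    rw [hfaces]
    simp only [mem_union, mem_sdiff, mem_powerset, FinComplex.starFaces, mem_filter, not_and,
      FinComplex.joinFaces, mem_image₂, mem_ssubsets]
    constructor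
    · rintro (⟨ht, ht'⟩ | ⟨a, ha, b, hb, rfl⟩)
      · exact ⟨Or.inl ht, fun hσt => ht' ht (by rwa [union_eq_left.2 hσt])⟩
      · refine ⟨Or.inr (union_subset_union ha.1 hb), fun hσt => ha.2 fun x hx => ?_⟩
        exact (mem_union.1 (hσt hx)).resolve_right fun h1 => disjoint_left.1 hdisj hx (hb h1)
    · rintro ⟨ht, hσt⟩
      by_cases htU : t ⊆ σ ∪ τ
      · refine Or.inr ⟨t ∩ σ, ssubset_of_subset_of_ne inter_subset_right
          fun heq => hσt (inter_eq_right.1 heq), t ∩ τ, inter_subset_right, ?_⟩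
        rw [← inter_union_distrib_left, inter_eq_left.2 htU]
      · refine Or.inl ⟨ht.resolve_right htU, fun _ h1 => htU ?_⟩
        exact subset_union_left.trans (hstar _ h1 subset_union_right)

lemma IsModTwoSphere.rank_eq {Δ : FinComplex V} {d : ℕ} (h : IsModTwoSphere R Δ.faces d) :
    Δ.rank = d := by
  refine le_antisymm (Finset.sup_le h.card_le) ?_
  obtain ⟨u, hu, -, hud⟩ := h.exists_facet h.empty_mem
  rw [← hud]
  exact le_sup (f := card) hu

end Complex

/-! ### From homology spheres to mod-two spheres -/

section HomologySphere

variable {V F : Type*} [LinearOrder V] [Field F]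

lemma incidence_eq [CharP F 2] (u t : Finset V) :
    FinComplex.incidence F u t = if t ⊆ u ∧ u.card = t.card + 1 then 1 else 0 := by
  have h1 : (-1 : F) = 1 := CharTwo.neg_eq 1
  simp only [FinComplex.incidence, h1, one_pow]
  split_ifs with h
  · obtain ⟨x, hx, rfl⟩ := exists_eq_insert_of_cofacet h.1 h.2
    rw [sum_eq_single x]
    · simp [erase_insert hx]
    · intro y hy hyx
      refine if_neg fun heq => hx ?_
      rw [← heq]
      exact mem_erase.2 ⟨Ne.symm hyx, mem_insert_self _ _⟩
    · intro h'
      exact absurd (mem_insert_self _ _) h'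
  · refine sum_eq_zero fun v hv => if_neg fun heq => h ?_
    rw [← heq]
    exact ⟨erase_subset _ _, (card_erase_add_one hv).symm⟩

lemma boundary_apply [CharP F 2] (L : FinComplex V) (c : Finset V → F) (t : L.faces) :
    L.boundary F (fun u => c u.1) t = bdry L.faces c t.1 := by
  simp only [FinComplex.boundary, Matrix.mulVecLin_apply, Matrix.mulVec, dotProduct,
    Matrix.of_apply, incidence_eq, bdry, cofacets, sum_filter]
  rw [← Finset.sum_coe_sort L.faces]
  exact sum_congr rfl fun u _ => by simp only [ite_mul, one_mul, zero_mul]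

variable {Δ : FinComplex V} {s : Finset V} (hs : s ∈ Δ.faces)

lemma mem_link {t : Finset V} :
    t ∈ (Δ.link s hs).faces ↔ t ∪ s ∈ Δ.faces ∧ Disjoint t s := by
  simp only [FinComplex.link, mem_filter, disjoint_iff_inter_eq_empty]
  exact ⟨fun h => h.2, fun h => ⟨Δ.down_closed _ h.1 _ subset_union_left, h⟩⟩

/-- Joining with `s` identifies the chain complex of the link with that of the star, shifted by the
cardinality of `s`. -/
lemma bdry_link (c : Finset V → F) {t : Finset V} (ht : t ∈ (Δ.link s hs).faces) :
    bdry (Δ.link s hs).faces (fun u => c (u ∪ s)) t = bdry (star Δ.faces s) c (t ∪ s) := by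
  rw [mem_link] at ht
  refine sum_bij (fun u _ => u ∪ s) ?_ ?_ ?_ ?_
  · intro u hu
    rw [mem_cofacets, mem_link] at hu
    rw [mem_cofacets, mem_star, card_union_of_disjoint hu.1.2, card_union_of_disjoint ht.2]
    exact ⟨⟨hu.1.1, subset_union_right⟩, union_subset_union_left hu.2.1, by omega⟩
  · intro u hu u' hu' huu'
    rw [mem_cofacets, mem_link] at hu hu'
    rw [← union_sdiff_cancel_right hu.1.2, huu', union_sdiff_cancel_right hu'.1.2]
  · intro w hw
    rw [mem_cofacets, mem_star] at hw
    have hws : w \ s ∪ s = w := sdiff_union_of_subset hw.1.2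
    refine ⟨w \ s, ?_, hws⟩
    rw [mem_cofacets, mem_link, hws]
    refine ⟨⟨hw.1.1, sdiff_disjoint⟩, ?_, ?_⟩
    · rw [subset_sdiff]
      exact ⟨subset_union_left.trans hw.2.1, ht.2⟩
    · rw [card_sdiff_of_subset hw.1.2, hw.2.2, card_union_of_disjoint ht.2]
      omega
  · intros; rfl

/-- The chain of the link corresponding to a chain of the star. -/
def linkChain (k : ℕ) (c : Finset V → F) : (Δ.link s hs).faces → F :=
  fun u => if u.1.card = k then c (u.1 ∪ s) else 0

lemma linkChain_apply (c : Finset V → F) {u : Finset V} (hu : u ∈ star Δ.faces s) {k : ℕ}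
    (huk : u.card = k + s.card) : ∃ t : (Δ.link s hs).faces, t.1 ∪ s = u ∧
      linkChain hs k c t = c u := by
  rw [mem_star] at hu
  have hus : u \ s ∪ s = u := sdiff_union_of_subset hu.2
  refine ⟨⟨u \ s, (mem_link hs).2 ⟨by rw [hus]; exact hu.1, sdiff_disjoint⟩⟩, hus, ?_⟩
  rw [linkChain, if_pos, hus]
  rw [card_sdiff_of_subset hu.2]
  omega

variable [CharP F 2]

lemma linkChain_mem_cycles {c : Finset V → F} {k : ℕ}
    (hc : IsCycleAt (star Δ.faces s) c (k + s.card)) :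
    linkChain hs k c ∈ (Δ.link s hs).cycles F k := by
  refine Submodule.mem_inf.2 ⟨fun u hu => if_neg hu, ?_⟩
  rw [LinearMap.mem_ker]
  refine funext fun t => ?_
  refine (boundary_apply (Δ.link s hs) (fun u => if u.card = k then c (u ∪ s) else 0) t).trans ?_
  have ht := (mem_link hs).1 t.2
  by_cases htk : t.1.card + 1 = k
  · rw [bdry_congr (c' := fun u => c (u ∪ s)) fun u _ _ huc => if_pos (huc.trans htk),
      bdry_link hs c t.2]
    refine hc _ (mem_star.2 ⟨ht.1, subset_union_right⟩) ?_
    rw [card_union_of_disjoint ht.2]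
    omega
  · exact bdry_eq_zero fun u _ _ huc => if_neg (by omega)

lemma exists_bdry_of_mem_boundaries {z : (Δ.link s hs).faces → F} {k : ℕ}
    (hz : z ∈ (Δ.link s hs).boundaries F k) :
    ∃ e : Finset V → F, ∀ t : (Δ.link s hs).faces, z t = bdry (star Δ.faces s) e (t.1 ∪ s) := by
  obtain ⟨y, -, rfl⟩ := hz
  let e : Finset V → F := fun w => if h : w \ s ∈ (Δ.link s hs).faces then y ⟨w \ s, h⟩ else 0
  refine ⟨e, fun t => ?_⟩
  rw [← bdry_link hs e t.2, ← boundary_apply]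
  have hye : y = fun u => e (u.1 ∪ s) := funext fun u => by
    have : (u.1 ∪ s) \ s = u.1 := union_sdiff_cancel_right ((mem_link hs).1 u.2).2
    simp only [e, this, u.2, dite_true]
  rw [← hye]

lemma exactAt_star_of_isHomologySphere (hs : s ∈ Δ.faces) {d : ℕ} (h : Δ.IsHomologySphere F d) {j : ℕ}
    (hj : j ≠ d + 1) : ExactAt F (star Δ.faces s) j := by
  rcases lt_or_ge j s.card with hjs | hjs
  · refine exactAt_of_forall_card_ne fun u hu => ?_
    have := card_le_card (mem_star.1 hu).2
    omega
  obtain ⟨k, rfl⟩ := Nat.exists_eq_add_of_le' hjs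
  intro c hc
  have hsub := (h s hs k).2 hj
  have hz := linkChain_mem_cycles hs hc
  have h0 : (Submodule.Quotient.mk ⟨_, hz⟩ : (Δ.link s hs).ReducedHomology F k) = 0 :=
    Subsingleton.elim _ _
  rw [Submodule.Quotient.mk_eq_zero, Submodule.submoduleOf, Submodule.mem_comap] at h0
  obtain ⟨e, he⟩ := exists_bdry_of_mem_boundaries hs h0
  refine ⟨e, fun u hu huj => ?_⟩
  obtain ⟨t, ht, htc⟩ := linkChain_apply hs c hu huj
  rw [← htc, ← ht]
  exact (he t).symm

/-- A largest face `u` containing `s` has no cofacet, so the constant chain 1 on its star is a cycle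
but not a boundary at the cardinality of `u`; the sphere condition allows this only at d + 1. -/
lemma card_le_of_isHomologySphere {d : ℕ} (h : Δ.IsHomologySphere F d) {s : Finset V}
    (hs : s ∈ Δ.faces) : s.card ≤ d + 1 := by
  obtain ⟨u, hu, hmax⟩ := exists_max_image (star Δ.faces s) card ⟨s, mem_star.2 ⟨hs, Subset.rfl⟩⟩
  by_contra hcon
  rw [mem_star] at hu
  have hsu := card_le_card hu.2
  obtain ⟨e, he⟩ := exactAt_star_of_isHomologySphere hu.1 h (j := u.card) (by omega) 1
    fun t ht htc => by
      have := card_le_card (mem_star.1 ht).2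
      omega
  have h1 := he u (mem_star.2 ⟨hu.1, Subset.rfl⟩) rfl
  rw [bdry_eq_zero] at h1
  · exact zero_ne_one h1
  · intro w hw huw hwc
    have := hmax w (mem_star.2 ⟨(mem_star.1 hw).1, hu.2.trans huw⟩)
    omega

lemma exists_top_cycle_of_isHomologySphere (hs : s ∈ Δ.faces) {d : ℕ} (h : Δ.IsHomologySphere F d) :
    ∃ z : Finset V → F, IsCycleAt (star Δ.faces s) z (d + 1) ∧
      (∃ u ∈ star Δ.faces s, u.card = d + 1 ∧ z u ≠ 0) ∧
      ∀ c : Finset V → F, IsCycleAt (star Δ.faces s) c (d + 1) →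
        ∃ a, ∀ u ∈ star Δ.faces s, u.card = d + 1 → c u = a * z u := by
  obtain ⟨k, hk⟩ := Nat.exists_eq_add_of_le' (card_le_of_isHomologySphere h hs)
  obtain ⟨φ⟩ := (h s hs k).1 hk.symm
  -- There are no larger faces, so top homology equals top cycles.
  have hbd : ∀ y ∈ (Δ.link s hs).boundaries F k, y = 0 := by
    rintro _ ⟨y, hy, rfl⟩
    have : y = 0 := by
      ext u
      refine hy u fun huk => ?_
      have hu := (mem_link hs).1 u.2
      have := card_le_of_isHomologySphere h hu.1
      rw [card_union_of_disjoint hu.2] at this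
      omega
    rw [this, map_zero]
  obtain ⟨⟨y, hy⟩, hy1⟩ := Submodule.Quotient.mk_surjective _ (φ.symm 1)
  have hy0 : y ≠ 0 := by
    rintro rfl
    have : φ.symm 1 = 0 := by
      rw [← hy1, Submodule.Quotient.mk_eq_zero, Submodule.submoduleOf, Submodule.mem_comap]
      exact Submodule.zero_mem _
    simp at this
  let z : Finset V → F := fun w => if h : w \ s ∈ (Δ.link s hs).faces then y ⟨w \ s, h⟩ else 0
  have hzy : ∀ t : (Δ.link s hs).faces, z (t.1 ∪ s) = y t := by
    intro t
    have : (t.1 ∪ s) \ s = t.1 := union_sdiff_cancel_right ((mem_link hs).1 t.2).2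
    simp only [z, this, t.2, dite_true]
  have hzc : IsCycleAt (star Δ.faces s) z (d + 1) := by
    intro t ht htd
    obtain ⟨t', ht', -⟩ := linkChain_apply hs z ht (k := t.card - s.card) (by
      have := card_le_card (mem_star.1 ht).2
      omega)
    rw [← ht', ← bdry_link hs z t'.2, ← boundary_apply]
    simp only [hzy]
    exact congrFun (LinearMap.mem_ker.1 (Submodule.mem_inf.1 hy).2) t'
  refine ⟨z, hzc, ?_, fun c hc => ?_⟩
  · obtain ⟨t, ht⟩ : ∃ t, y t ≠ 0 := by
      by_contra! hcon
      exact hy0 (funext hcon)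
    have htk : t.1.card = k := by
      by_contra hcon
      exact ht ((Submodule.mem_inf.1 hy).1 t hcon)
    have hm := (mem_link hs).1 t.2
    exact ⟨t.1 ∪ s, mem_star.2 ⟨hm.1, subset_union_right⟩,
      by rw [card_union_of_disjoint hm.2]; omega, by rwa [hzy]⟩
  · rw [hk] at hc
    have hw := linkChain_mem_cycles hs hc
    let a : F := φ (Submodule.Quotient.mk ⟨_, hw⟩)
    have h0 : (Submodule.Quotient.mk (⟨_, hw⟩ - a • ⟨y, hy⟩) :
        (Δ.link s hs).ReducedHomology F k) = 0 := by
      rw [Submodule.Quotient.mk_sub, Submodule.Quotient.mk_smul, hy1, ← φ.map_eq_zero_iff,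
        map_sub, map_smul, φ.apply_symm_apply]
      simp [a]
    rw [Submodule.Quotient.mk_eq_zero, Submodule.submoduleOf, Submodule.mem_comap] at h0
    have h1 := hbd _ h0
    refine ⟨a, fun u hu hud => ?_⟩
    obtain ⟨t, ht, htc⟩ := linkChain_apply hs c hu (hud.trans hk)
    have h2 := congrFun h1 t
    simp only [Submodule.subtype_apply, AddSubgroupClass.coe_sub, SetLike.val_smul, Pi.sub_apply,
      Pi.smul_apply, smul_eq_mul, Pi.zero_apply, sub_eq_zero] at h2
    rw [← htc, h2, ← hzy, ht]

/-- A codimension-one face has a link with the homology of two points, which gives it exactly two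
cofacets. So the constant chain is a cycle, and being nonzero on facets it spans the one-dimensional
space of top cycles of each star. -/
theorem isModTwoSphere_of_isHomologySphere {d : ℕ} (h : Δ.IsHomologySphere F d) :
    IsModTwoSphere F Δ.faces (d + 1) := by
  have heven : IsCycleAt Δ.faces (1 : Finset V → F) (d + 1) := by
    intro t ht htd
    obtain ⟨z, hz, ⟨u, hu, hud, hzu⟩, huniq⟩ := exists_top_cycle_of_isHomologySphere ht h
    have hcof : ∀ w, w ∈ cofacets Δ.faces t ↔ w ∈ star Δ.faces t ∧ w.card = d + 1 := by
      intro w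
      rw [mem_cofacets, mem_star, htd]
      tauto
    have hcyc : ∀ c : Finset V → F, bdry Δ.faces c t = 0 → IsCycleAt (star Δ.faces t) c (d + 1) := by
      intro c hc t' ht' htd'
      have : t = t' := eq_of_subset_of_card_le (mem_star.1 ht').2 (by omega)
      rw [← this, bdry_star _ Subset.rfl, hc]
    have hz0 := hz t (mem_star.2 ⟨ht, Subset.rfl⟩) htd
    rw [bdry_star _ Subset.rfl] at hz0
    have hu' := (hcof u).2 ⟨hu, hud⟩
    obtain ⟨v, hv, hvu, hzv⟩ : ∃ v ∈ cofacets Δ.faces t, v ≠ u ∧ z v ≠ 0 := by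
      by_contra! hcon
      rw [bdry, sum_eq_single_of_mem u hu' hcon] at hz0
      exact hzu hz0
    -- Pairs {u, v} and {u, w} with a third facet w would give two independent top cycles of the
    -- same star.
    have hpair : ∀ w ∈ cofacets Δ.faces t, w ≠ u →
        IsCycleAt (star Δ.faces t) (fun x => if x = u ∨ x = w then (1 : F) else 0) (d + 1) := by
      intro w hw hwu
      refine hcyc _ ?_
      rw [bdry, ← sum_filter]
      have : (cofacets Δ.faces t).filter (fun x => x = u ∨ x = w) = {u, w} := by
        ext x
        simp only [mem_filter, mem_insert, mem_singleton]
        constructor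
        · exact fun hx => hx.2
        · rintro (rfl | rfl)
          · exact ⟨hu', Or.inl rfl⟩
          · exact ⟨hw, Or.inr rfl⟩
      rw [this, sum_pair (Ne.symm hwu), CharTwo.add_self_eq_zero]
    have honly : ∀ w ∈ cofacets Δ.faces t, w = u ∨ w = v := by
      intro w hw
      by_contra! hcon
      obtain ⟨a, ha⟩ := huniq _ (hpair v hv hvu)
      obtain ⟨b, hb⟩ := huniq _ (hpair w hw hcon.1)
      have h1 := ha u hu hud
      have h2 := ha w ((hcof w).1 hw).1 ((hcof w).1 hw).2
      have h3 := hb w ((hcof w).1 hw).1 ((hcof w).1 hw).2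
      simp only [true_or, if_true, hcon, or_self, if_false, or_true] at h1 h2 h3
      have ha0 : a ≠ 0 := by
        rintro rfl
        simp at h1
      rw [eq_comm, mul_eq_zero, or_iff_right ha0] at h2
      rw [h2] at h3
      simp at h3
    have : cofacets Δ.faces t = {u, v} := by
      ext x
      simp only [mem_insert, mem_singleton]
      constructor
      · exact honly x
      · rintro (rfl | rfl)
        · exact hu'
        · exact hv
    rw [bdry, this, sum_pair (Ne.symm hvu)]
    exact CharTwo.add_self_eq_zero _
  refine ⟨Δ.empty_mem, Δ.down_closed, fun s hs => card_le_of_isHomologySphere h hs,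
    fun s hs j hj => exactAt_star_of_isHomologySphere hs h (by omega), fun s hs c hc => ?_, heven⟩
  obtain ⟨z, -, ⟨u, hu, hud, hzu⟩, huniq⟩ := exists_top_cycle_of_isHomologySphere hs h
  obtain ⟨a, ha⟩ := huniq 1 fun t ht htd => by
    rw [bdry_star _ (mem_star.1 ht).2]
    exact heven t (mem_star.1 ht).1 htd
  obtain ⟨b, hb⟩ := huniq c hc
  have ha0 : a ≠ 0 := by
    rintro rfl
    have := ha u hu hud
    simp at this
  refine ⟨b / a, fun w hw hwd => ?_⟩
  have h1 : 1 = a * z w := ha w hw hwd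
  rw [hb w hw hwd, eq_div_iff ha0, mul_assoc, mul_comm (z w), ← h1, mul_one]

end HomologySphere

open MvPolynomial

/-! ### The complex of polynomial rings attached to faces -/

section FaceModules

variable {W K : Type*} [DecidableEq W] [Field K]

variable (K) in
/-- The ideal generated by the variables outside `τ`. -/
noncomputable def faceIdeal (τ : Finset W) : Ideal (MvPolynomial W K) :=
  Ideal.span (X '' {v | v ∉ τ})

/-- Only monomials supported in τ survive: working modulo this ideal is working in K[τ]. -/
lemma mem_faceIdeal {τ : Finset W} {f : MvPolynomial W K} :
    f ∈ faceIdeal K τ ↔ ∀ m : W →₀ ℕ, m.support ⊆ τ → coeff m f = 0 := by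
  rw [faceIdeal, mem_ideal_span_X_image]
  constructor
  · intro h m hm
    by_contra hcon
    obtain ⟨i, hi, hmi⟩ := h m (mem_support_iff.2 hcon)
    exact hi (hm (Finsupp.mem_support_iff.2 hmi))
  · intro h m hm
    by_contra! hcon
    refine mem_support_iff.1 hm (h m fun i hi => ?_)
    by_contra hiτ
    exact Finsupp.mem_support_iff.1 hi (hcon i hiτ)

lemma faceIdeal_anti {σ τ : Finset W} (h : σ ⊆ τ) : faceIdeal K τ ≤ faceIdeal K σ := fun _ hf =>
  mem_faceIdeal.2 fun m hm => mem_faceIdeal.1 hf m (hm.trans h)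

/-- The boundary map on families of polynomials indexed by sets. -/
noncomputable def bd (G : Finset (Finset W)) :
    (Finset W → MvPolynomial W K) →ₗ[MvPolynomial W K] (Finset W → MvPolynomial W K) where
  toFun c := bdry G c
  map_add' c c' := funext fun t => bdry_add G c c' t
  map_smul' p c := funext fun t => by simp [bdry, mul_sum]

lemma bd_apply (G : Finset (Finset W)) (c : Finset W → MvPolynomial W K) (t : Finset W) :
    bd G c t = bdry G c t := rfl

lemma coeff_bdry (G : Finset (Finset W)) (c : Finset W → MvPolynomial W K) (t : Finset W)
    (m : W →₀ ℕ) : coeff m (bdry G c t) = bdry G (fun u => coeff m (c u)) t := by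
  simp [bdry, coeff_sum]

variable (K) in
/-- Families that vanish on the faces of cardinality `j`, where the polynomial attached to a face is
considered as a polynomial in the variables of this face. -/
def nullChains (G : Finset (Finset W)) (j : ℕ) :
    Submodule (MvPolynomial W K) (Finset W → MvPolynomial W K) where
  carrier := {c | ∀ τ ∈ G, τ.card = j → c τ ∈ faceIdeal K τ}
  zero_mem' := fun _ _ _ => Submodule.zero_mem _
  add_mem' := fun ha hb τ hτ hj => Submodule.add_mem _ (ha τ hτ hj) (hb τ hτ hj)
  smul_mem' := fun p _ hc τ hτ hj => Submodule.smul_mem _ p (hc τ hτ hj)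

variable (K) in
/-- Families whose part on the faces of cardinality `j` is a cycle. -/
def polyCycles (G : Finset (Finset W)) (j : ℕ) :
    Submodule (MvPolynomial W K) (Finset W → MvPolynomial W K) where
  carrier := {c | ∀ t ∈ G, t.card + 1 = j → bd G c t ∈ faceIdeal K t}
  zero_mem' := fun _ _ _ => by simp
  add_mem' := fun ha hb τ hτ hj => by
    rw [map_add]
    exact Submodule.add_mem _ (ha τ hτ hj) (hb τ hτ hj)
  smul_mem' := fun p _ hc τ hτ hj => by
    rw [map_smul]
    exact Submodule.smul_mem _ p (hc τ hτ hj)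

variable {G : Finset (Finset W)}

lemma mem_nullChains {c : Finset W → MvPolynomial W K} {j : ℕ} :
    c ∈ nullChains K G j ↔ ∀ τ ∈ G, τ.card = j → c τ ∈ faceIdeal K τ := Iff.rfl

lemma mem_polyCycles {c : Finset W → MvPolynomial W K} {j : ℕ} :
    c ∈ polyCycles K G j ↔ ∀ t ∈ G, t.card + 1 = j → bd G c t ∈ faceIdeal K t := Iff.rfl

lemma mem_polyCycles_succ {c : Finset W → MvPolynomial W K} {j : ℕ} :
    c ∈ polyCycles K G (j + 1) ↔ bd G c ∈ nullChains K G j := by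
  simp [mem_polyCycles, mem_nullChains]

lemma nullChains_le_polyCycles (j : ℕ) : nullChains K G j ≤ polyCycles K G j := by
  intro c hc t _ htj
  refine Submodule.sum_mem _ fun u hu => ?_
  rw [mem_cofacets] at hu
  exact faceIdeal_anti hu.2.1 (hc u hu.1 (hu.2.2.trans htj))

variable {d : ℕ} [CharP K 2]

lemma bd_mem_polyCycles (hG : ∀ s ∈ G, ∀ t ⊆ s, t ∈ G) (c : Finset W → MvPolynomial W K) (j : ℕ) :
    bd G c ∈ polyCycles K G j := by
  intro t ht _
  have : bd G (bd G c) t = 0 := bdry_bdry (fun _ _ w hw u _ huw => hG w hw u huw) c ht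
  rw [this]
  exact Submodule.zero_mem _

/-- The complex splits by monomials. The coefficient of β lives on the faces containing the support
of β, so it is a chain on a star, where exactness is known. -/
lemma polyCycles_le_map_bd (h : IsModTwoSphere K G d) {j : ℕ} (hj : j < d) :
    polyCycles K G j ≤ (⊤ : Submodule (MvPolynomial W K) _).map (bd G) ⊔ nullChains K G j := by
  intro f hf
  have hcyc : ∀ β : W →₀ ℕ, IsCycleAt (star G β.support) (fun u => coeff β (f u)) j := by
    intro β t ht htj
    rw [mem_star] at ht
    rw [bdry_star _ ht.2, ← coeff_bdry]
    exact mem_faceIdeal.1 (hf t ht.1 htj) β ht.2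
  have hex : ∀ β : W →₀ ℕ, ∃ e : Finset W → K, β.support ∈ G → ∀ u ∈ star G β.support, u.card = j →
      bdry (star G β.support) e u = coeff β (f u) := by
    intro β
    by_cases hβ : β.support ∈ G
    · obtain ⟨e, he⟩ := h.exact _ hβ j hj _ (hcyc β)
      exact ⟨e, fun _ => he⟩
    · exact ⟨0, fun h' => absurd h' hβ⟩
  choose e he using hex
  -- Only finitely many monomials occur, so the monomialwise primitives assemble into polynomials.
  let T : Finset (W →₀ ℕ) := G.biUnion fun u => (f u).support
  let E : Finset W → MvPolynomial W K := fun u => ∑ β ∈ T, monomial β (e β u)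
  have hE : ∀ u m, coeff m (bd G E u) = if m ∈ T then bdry G (e m) u else 0 := by
    intro u m
    rw [bd_apply, coeff_bdry]
    simp only [E, coeff_sum, coeff_monomial, sum_ite_eq']
    split_ifs with hm
    · simp
    · simp [bdry]
  rw [Submodule.mem_sup]
  refine ⟨bd G E, ⟨E, trivial, rfl⟩, f - bd G E, fun u hu huj => ?_, by abel⟩
  refine mem_faceIdeal.2 fun m hm => ?_
  rw [Pi.sub_apply, coeff_sub, hE, sub_eq_zero]
  split_ifs with hmT
  · rw [← he m (h.down u hu _ hm) u (mem_star.2 ⟨hu, hm⟩) huj, bdry_star _ hm]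
  · by_contra hcon
    exact hmT (mem_biUnion.2 ⟨u, hu, mem_support_iff.2 hcon⟩)

variable (W K) in
/-- Constant families. -/
def constFamily :
    MvPolynomial W K →ₗ[MvPolynomial W K] (Finset W → MvPolynomial W K) where
  toFun f := fun _ => f
  map_add' _ _ := rfl
  map_smul' _ _ := rfl

lemma constFamily_mem_polyCycles (h : IsModTwoSphere K G d) (f : MvPolynomial W K) :
    constFamily W K f ∈ polyCycles K G d := by
  intro t ht htd
  have h1 := (h.even.map (C (σ := W)).toAddMonoidHom) t ht htd
  have h2 : bd G (constFamily W K f) t = f * bdry G (fun _ => (1 : MvPolynomial W K)) t := by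
    simp [bd_apply, bdry, constFamily, mul_comm]
  have h3 : bdry G (fun _ => (1 : MvPolynomial W K)) t = 0 := by simpa using h1
  rw [h2, h3, mul_zero]
  exact Submodule.zero_mem _

/-- Top cycles on a star are constant, so monomial by monomial a top cycle is the family of
restrictions of one polynomial. This realises the face ring as the module of top cycles. -/
lemma polyCycles_top_le (h : IsModTwoSphere K G d) :
    polyCycles K G d ≤ (⊤ : Submodule (MvPolynomial W K) _).map (constFamily W K) ⊔
      nullChains K G d := by
  intro c hc
  have hcyc : ∀ β : W →₀ ℕ, IsCycleAt (star G β.support) (fun u => coeff β (c u)) d := by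
    intro β t ht htj
    rw [mem_star] at ht
    rw [bdry_star _ ht.2, ← coeff_bdry]
    exact mem_faceIdeal.1 (hc t ht.1 htj) β ht.2
  have hex : ∀ β : W →₀ ℕ, ∃ x : K, β.support ∈ G → ∀ u ∈ star G β.support, u.card = d →
      coeff β (c u) = x := by
    intro β
    by_cases hβ : β.support ∈ G
    · obtain ⟨e, he⟩ := h.top _ hβ _ (hcyc β)
      exact ⟨e, fun _ => he⟩
    · exact ⟨0, fun h' => absurd h' hβ⟩
  choose x hx using hex
  let T : Finset (W →₀ ℕ) := G.biUnion fun u => (c u).support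
  let f : MvPolynomial W K := ∑ β ∈ T, monomial β (x β)
  rw [Submodule.mem_sup]
  refine ⟨constFamily W K f, ⟨f, trivial, rfl⟩, c - constFamily W K f, fun u hu huj => ?_, by abel⟩
  refine mem_faceIdeal.2 fun m hm => ?_
  have hf : coeff m f = if m ∈ T then x m else 0 := by
    simp only [f, coeff_sum, coeff_monomial, sum_ite_eq']
  change coeff m (c u - f) = 0
  rw [coeff_sub, hf, sub_eq_zero]
  split_ifs with hmT
  · exact hx m (h.down u hu _ hm) u (mem_star.2 ⟨hu, hm⟩) huj
  · by_contra hcon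
    exact hmT (mem_biUnion.2 ⟨u, hu, mem_support_iff.2 hcon⟩)

end FaceModules

/-! ### Generic linear forms on a simplex -/

section Generic

variable {W K : Type*} [DecidableEq W] [Field K]

/-- The square submatrices of the first `d` rows of `a` are invertible. -/
def IsGeneric (a : ℕ → W → K) (d : ℕ) : Prop :=
  ∀ (R : Finset ℕ) (C : Finset W), R ⊆ range d → R.card = C.card → ∀ y : W → K,
    (∀ r ∈ R, ∑ v ∈ C, a r v * y v = 0) → ∀ v ∈ C, y v = 0

variable {a : ℕ → W → K} {d : ℕ}

lemma IsGeneric.exists_inverse (ha : IsGeneric a d) {τ : Finset W} {j : ℕ} (hτj : τ.card = j)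
    (hj : j ≤ d) :
    ∃ b : W → ℕ → K,
      (∀ r < j, ∀ s < j, ∑ v ∈ τ, a r v * b v s = if r = s then 1 else 0) ∧
      (∀ v ∈ τ, ∀ w ∈ τ, ∑ r ∈ range j, b v r * a r w = if v = w then 1 else 0) := by
  let e : Fin j ≃ τ := (τ.equivFinOfCardEq hτj).symm
  let M : Matrix (Fin j) (Fin j) K := Matrix.of fun r k => a r (e k)
  have hsum : ∀ g : W → K, ∑ v ∈ τ, g v = ∑ k, g (e k) := fun g => by
    rw [← Finset.sum_coe_sort τ, ← e.sum_comp]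
  have hinj : Function.Injective M.mulVec := by
    rw [← Matrix.coe_mulVecLin, injective_iff_map_eq_zero]
    intro y hy
    have h1 := ha (range j) τ (range_subset_range.2 hj) (by simp [hτj])
      (fun v => if hv : v ∈ τ then y (e.symm ⟨v, hv⟩) else 0) fun r hr => by
        rw [hsum]
        have := congrFun hy ⟨r, mem_range.1 hr⟩
        simpa [Matrix.mulVec, dotProduct, M] using this
    ext k
    have := h1 (e k) (e k).2
    simpa using this
  have hM : IsUnit M.det := (Matrix.isUnit_iff_isUnit_det M).1 (Matrix.mulVec_injective_iff_isUnit.1 hinj)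
  let b : W → ℕ → K := fun v s =>
    if hv : v ∈ τ then if hs : s < j then M⁻¹ (e.symm ⟨v, hv⟩) ⟨s, hs⟩ else 0 else 0
  refine ⟨b, fun r hr s hs => ?_, fun v hv w hw => ?_⟩
  · rw [hsum]
    have h1 := congrFun (congrFun (Matrix.mul_nonsing_inv M hM) ⟨r, hr⟩) ⟨s, hs⟩
    simp only [Matrix.mul_apply, Matrix.one_apply, Fin.mk.injEq] at h1
    rw [← h1]
    exact sum_congr rfl fun k _ => by simp [b, hs, M]
  · have h1 := congrFun (congrFun (Matrix.nonsing_inv_mul M hM) (e.symm ⟨v, hv⟩)) (e.symm ⟨w, hw⟩)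
    simp only [Matrix.mul_apply, Matrix.one_apply, EmbeddingLike.apply_eq_iff_eq,
      Subtype.mk.injEq] at h1
    rw [← h1, Finset.sum_range]
    exact sum_congr rfl fun k _ => by simp [b, hv, M]

variable [Fintype W]

/-- The linear form with coefficients given by the row `r` of `a`. -/
noncomputable def linForm (a : ℕ → W → K) (r : ℕ) : MvPolynomial W K := ∑ v, C (a r v) * X v

/-- The ideal generated by the first `p` linear forms. -/
noncomputable def formIdeal (a : ℕ → W → K) (p : ℕ) : Ideal (MvPolynomial W K) :=
  Ideal.span (linForm a '' {r | r < p})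

lemma linForm_mem_formIdeal {r p : ℕ} (h : r < p) : linForm a r ∈ formIdeal a p :=
  Ideal.subset_span ⟨r, h, rfl⟩

lemma formIdeal_zero : formIdeal a 0 = ⊥ := by simp [formIdeal]

lemma formIdeal_succ (p : ℕ) :
    formIdeal a (p + 1) = formIdeal a p ⊔ Ideal.span {linForm a p} := by
  have : {r | r < p + 1} = {r | r < p} ∪ {p} := by
    ext r
    simp only [Set.mem_ofPred_eq, Set.mem_union, Set.mem_singleton_iff]
    omega
  rw [formIdeal, this, Set.image_union, Ideal.span_union, Set.image_singleton, formIdeal]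

lemma formIdeal_mono {p q : ℕ} (h : p ≤ q) : formIdeal a p ≤ formIdeal a q :=
  Ideal.span_mono (Set.image_mono fun _ hr => lt_of_lt_of_le hr h)

lemma linForm_isHomogeneous (r : ℕ) : (linForm a r).IsHomogeneous 1 :=
  IsHomogeneous.sum _ _ _ fun _ _ => isHomogeneous_C_mul_X _ _

lemma X_sub_sum_mem_faceIdeal {τ : Finset W} {j : ℕ} {b : W → ℕ → K}
    (hb : ∀ v ∈ τ, ∀ w ∈ τ, ∑ r ∈ range j, b v r * a r w = if v = w then 1 else 0)
    {v : W} (hv : v ∈ τ) : X v - ∑ r ∈ range j, C (b v r) * linForm a r ∈ faceIdeal K τ := by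
  have h1 : ∑ r ∈ range j, C (b v r) * linForm a r =
      ∑ w, C (∑ r ∈ range j, b v r * a r w) * X w := by
    simp only [linForm, mul_sum, map_sum, sum_mul, map_mul, mul_assoc]
    exact sum_comm
  have h2 : X v = ∑ w, C (if v = w then (1 : K) else 0) * X w := by
    rw [sum_eq_single v] <;> simp +contextual [eq_comm]
  rw [h1]
  nth_rewrite 1 [h2]
  rw [← sum_sub_distrib]
  refine Submodule.sum_mem _ fun w _ => ?_
  by_cases hw : w ∈ τ
  · rw [hb v hv w hw, sub_self]
    exact Submodule.zero_mem _
  · rw [← sub_mul]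
    exact Ideal.mul_mem_left _ _ (Ideal.subset_span ⟨w, hw, rfl⟩)

/-- The first |τ| forms are linear coordinates on K[τ], hence form a regular sequence. -/
lemma IsGeneric.mem_of_linForm_mul_mem (ha : IsGeneric a d) {τ : Finset W} (hτ : τ.card ≤ d)
    {r : ℕ} (hr : r < τ.card) {f : MvPolynomial W K}
    (hf : linForm a r * f ∈ formIdeal a r ⊔ faceIdeal K τ) :
    f ∈ formIdeal a r ⊔ faceIdeal K τ := by
  obtain ⟨b, hb1, hb2⟩ := ha.exists_inverse rfl hτ
  -- `φ` and `ψ` are the coordinate change between the vertices of τ and the linear forms; after it,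
  -- the claim is about monomial ideals generated by variables.
  let φ : MvPolynomial W K →ₐ[K] MvPolynomial ℕ K :=
    aeval fun v => if v ∈ τ then ∑ s ∈ range τ.card, C (b v s) * X s else 0
  let ψ : MvPolynomial ℕ K →ₐ[K] MvPolynomial W K := aeval fun s => linForm a s
  have hφθ : ∀ s < τ.card, φ (linForm a s) = X s := by
    intro s hs
    have h1 : φ (linForm a s) =
        ∑ v ∈ τ, C (a s v) * ∑ s ∈ range τ.card, C (b v s) * X s := by
      simp [φ, linForm, sum_ite_mem, algHom_C]
    have h2 : ∑ v ∈ τ, C (a s v) * ∑ s ∈ range τ.card, C (b v s) * X s =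
        ∑ t ∈ range τ.card, C (∑ v ∈ τ, a s v * b v t) * (X t : MvPolynomial ℕ K) := by
      simp only [mul_sum, map_sum, sum_mul, map_mul, mul_assoc]
      exact sum_comm
    rw [h1, h2, sum_eq_single s]
    · rw [hb1 s hs s hs]; simp
    · intro t ht hts
      rw [hb1 s hs t (mem_range.1 ht), if_neg (Ne.symm hts)]; simp
    · exact fun h => absurd (mem_range.2 hs) h
  have hφI : ∀ g ∈ faceIdeal K τ, φ g = 0 := by
    intro g hg
    have : faceIdeal K τ ≤ RingHom.ker φ := by
      refine Ideal.span_le.2 ?_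
      rintro _ ⟨v, hv, rfl⟩
      simp only [SetLike.mem_coe, RingHom.mem_ker, φ, aeval_X]
      exact if_neg hv
    exact this hg
  have hψφ : ∀ g, g - ψ (φ g) ∈ faceIdeal K τ := by
    intro g
    have : (Ideal.Quotient.mkₐ K (faceIdeal K τ)).comp (ψ.comp φ) =
        Ideal.Quotient.mkₐ K (faceIdeal K τ) := by
      refine algHom_ext fun v => ?_
      simp only [AlgHom.comp_apply, Ideal.Quotient.mkₐ_eq_mk]
      rw [eq_comm, Ideal.Quotient.eq]
      by_cases hv : v ∈ τ
      · have := X_sub_sum_mem_faceIdeal hb2 hv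
        simpa [φ, ψ, hv, algHom_C] using this
      · simp only [φ, aeval_X, if_neg hv, map_zero, sub_zero]
        exact Ideal.subset_span ⟨v, hv, rfl⟩
    have h2 := DFunLike.congr_fun this g
    simp only [AlgHom.comp_apply, Ideal.Quotient.mkₐ_eq_mk] at h2
    exact Ideal.Quotient.eq.1 h2.symm
  have h1 : X r * φ f ∈ Ideal.span (X '' {s : ℕ | s < r} : Set (MvPolynomial ℕ K)) := by
    rw [← hφθ r hr, ← map_mul]
    obtain ⟨x, hx, y, hy, hxy⟩ := Submodule.mem_sup.1 hf
    rw [← hxy, map_add, hφI y hy, add_zero]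
    have : formIdeal a r ≤ (Ideal.span (X '' {s : ℕ | s < r})).comap φ := by
      refine Ideal.span_le.2 ?_
      rintro _ ⟨s, hs, rfl⟩
      simp only [SetLike.mem_coe, Ideal.mem_comap]
      rw [hφθ s (lt_trans hs hr)]
      exact Ideal.subset_span ⟨s, hs, rfl⟩
    exact this hx
  have h2 : φ f ∈ Ideal.span (X '' {s : ℕ | s < r} : Set (MvPolynomial ℕ K)) := by
    rw [mem_ideal_span_X_image] at h1 ⊢
    intro m hm
    have hm' : Finsupp.single r 1 + m ∈ (X r * φ f).support := by
      rw [mem_support_iff, coeff_X_mul]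
      exact mem_support_iff.1 hm
    obtain ⟨i, hi, hmi⟩ := h1 _ hm'
    refine ⟨i, hi, ?_⟩
    rwa [Finsupp.add_apply, Finsupp.single_eq_of_ne (ne_of_lt hi), zero_add] at hmi
  have h3 : ψ (φ f) ∈ formIdeal a r := by
    have : Ideal.span (X '' {s : ℕ | s < r}) ≤ (formIdeal a r).comap ψ := by
      refine Ideal.span_le.2 ?_
      rintro _ ⟨s, hs, rfl⟩
      simp only [SetLike.mem_coe, Ideal.mem_comap, ψ, aeval_X]
      exact linForm_mem_formIdeal hs
    exact this h2
  rw [← sub_add_cancel f (ψ (φ f)), add_comm]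
  exact Submodule.add_mem_sup h3 (hψφ f)

/-- With j + 1 vertices, K[τ] modulo the first j forms is a polynomial ring in the next form, so
everything of positive degree is divisible by that form. -/
lemma IsGeneric.exists_sub_linForm_mul_mem (ha : IsGeneric a d) {τ : Finset W} {i j : ℕ}
    (hτj : τ.card = j + 1) (hj : j + 1 ≤ d) {f : MvPolynomial W K}
    (hf : f.IsHomogeneous (i + 1)) :
    ∃ g : MvPolynomial W K, g.IsHomogeneous i ∧
      f - linForm a j * g ∈ formIdeal a j ⊔ faceIdeal K τ := by
  obtain ⟨b, -, hb⟩ := ha.exists_inverse hτj hj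
  have hX : ∀ v, ∃ κ : K, X v - linForm a j * C κ ∈ formIdeal a j ⊔ faceIdeal K τ := by
    intro v
    by_cases hv : v ∈ τ
    · refine ⟨b v j, ?_⟩
      have h1 := X_sub_sum_mem_faceIdeal hb hv
      rw [sum_range_succ] at h1
      have h2 : X v - linForm a j * C (b v j) = ∑ r ∈ range j, C (b v r) * linForm a r +
          (X v - (∑ r ∈ range j, C (b v r) * linForm a r + C (b v j) * linForm a j)) := by ring
      rw [h2]
      refine Submodule.add_mem_sup (Submodule.sum_mem _ fun r hr => ?_) h1
      exact Ideal.mul_mem_left _ _ (linForm_mem_formIdeal (mem_range.1 hr))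
    · refine ⟨0, ?_⟩
      rw [map_zero, mul_zero, sub_zero]
      exact Submodule.mem_sup_right (Ideal.subset_span ⟨v, hv, rfl⟩)
  have hlin : ∀ l : MvPolynomial W K, l.IsHomogeneous 1 →
      ∃ κ : K, l - linForm a j * C κ ∈ formIdeal a j ⊔ faceIdeal K τ := by
    intro l hl
    rw [← mem_homogeneousSubmodule, homogeneousSubmodule_one_eq_span_X] at hl
    induction hl using Submodule.span_induction with
    | mem x hx =>
      obtain ⟨v, rfl⟩ := hx
      exact hX v
    | zero => exact ⟨0, by simp⟩
    | add x y _ _ hx hy =>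
      obtain ⟨κ, hκ⟩ := hx
      obtain ⟨μ, hμ⟩ := hy
      refine ⟨κ + μ, ?_⟩
      have := Submodule.add_mem _ hκ hμ
      rw [map_add]
      convert this using 1
      ring
    | smul c x _ hx =>
      obtain ⟨κ, hκ⟩ := hx
      refine ⟨c * κ, ?_⟩
      have := Ideal.mul_mem_left _ (C c) hκ
      rw [smul_eq_C_mul, map_mul]
      convert this using 1
      ring
  rw [← mem_homogeneousSubmodule, ← homogeneousSubmodule_one_pow, pow_succ,
    homogeneousSubmodule_one_pow] at hf
  induction hf using Submodule.mul_induction_on' with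
  | mem_mul_mem m hm l hl =>
    obtain ⟨κ, hκ⟩ := hlin l hl
    refine ⟨m * C κ, ?_, ?_⟩
    · have := IsHomogeneous.mul ((mem_homogeneousSubmodule i m).1 hm) (isHomogeneous_C W κ)
      simpa using this
    · have := Ideal.mul_mem_left _ m hκ
      convert this using 1
      ring
  | add x _ y _ hx hy =>
    obtain ⟨g, hg, hg'⟩ := hx
    obtain ⟨g₂, hg₂, hg₂'⟩ := hy
    refine ⟨g + g₂, hg.add hg₂, ?_⟩
    have := Submodule.add_mem _ hg' hg₂'
    convert this using 1
    ring

end Generic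

/-! ### Duality by descending through the cycle modules -/

section Socle

variable {W K : Type*} [DecidableEq W] [Fintype W] [Field K] [CharP K 2]
  {G : Finset (Finset W)} {d : ℕ} {a : ℕ → W → K}

variable (G a) in
/-- Families that lie in the ideal `(θ₁, …, θ_p)` on all faces of cardinality `j`. -/
noncomputable def formChains (j p : ℕ) :
    Submodule (MvPolynomial W K) (Finset W → MvPolynomial W K) :=
  formIdeal a p • ⊤ ⊔ nullChains K G j

variable (G a) in
/-- The submodule `(θ₁, …, θ_p) Z` of the module `Z` of cycles on the faces of cardinality `j`. -/
noncomputable def formCycles (j p : ℕ) :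
    Submodule (MvPolynomial W K) (Finset W → MvPolynomial W K) :=
  formIdeal a p • polyCycles K G j ⊔ nullChains K G j

lemma mem_formChains {j p : ℕ} {c : Finset W → MvPolynomial W K} :
    c ∈ formChains G a j p ↔ ∀ τ ∈ G, τ.card = j → c τ ∈ formIdeal a p ⊔ faceIdeal K τ := by
  constructor
  · intro hc τ hτ hj
    obtain ⟨x, hx, y, hy, rfl⟩ := Submodule.mem_sup.1 hc
    refine Submodule.add_mem_sup ?_ (hy τ hτ hj)
    refine Submodule.smul_induction_on hx (fun r hr n _ => Ideal.mul_mem_right _ _ hr) ?_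
    exact fun x y hx hy => Submodule.add_mem _ hx hy
  · intro hc
    have : ∀ τ, ∃ x ∈ formIdeal a p, τ ∈ G → τ.card = j → c τ - x ∈ faceIdeal K τ := by
      intro τ
      by_cases hτ : τ ∈ G ∧ τ.card = j
      · obtain ⟨x, hx, y, hy, hxy⟩ := Submodule.mem_sup.1 (hc τ hτ.1 hτ.2)
        exact ⟨x, hx, fun _ _ => by rw [← hxy, add_sub_cancel_left]; exact hy⟩
      · exact ⟨0, Submodule.zero_mem _, fun h1 h2 => absurd ⟨h1, h2⟩ hτ⟩
    choose x hx hcx using this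
    have h1 : ∑ τ ∈ G, x τ • Pi.single τ (1 : MvPolynomial W K) ∈
        formIdeal a p • (⊤ : Submodule (MvPolynomial W K) (Finset W → MvPolynomial W K)) :=
      Submodule.sum_mem _ fun τ _ => Submodule.smul_mem_smul (hx τ) trivial
    rw [← add_sub_cancel (∑ τ ∈ G, x τ • Pi.single τ (1 : MvPolynomial W K)) c]
    refine Submodule.add_mem_sup h1 fun τ hτ hj => ?_
    have h2 : (∑ σ ∈ G, x σ • Pi.single σ (1 : MvPolynomial W K)) τ = x τ := by
      rw [Finset.sum_apply, sum_eq_single_of_mem τ hτ]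
      · simp
      · intro σ _ hστ
        simp [Ne.symm hστ]
    rw [Pi.sub_apply, h2]
    exact hcx τ hτ hj

lemma formCycles_le_formChains (j p : ℕ) : formCycles G a j p ≤ formChains G a j p :=
  sup_le_sup_right (Submodule.smul_mono le_rfl le_top) _

lemma nullChains_le_formCycles (j p : ℕ) : nullChains K G j ≤ formCycles G a j p := le_sup_right

lemma formCycles_mono (j : ℕ) {p q : ℕ} (h : p ≤ q) : formCycles G a j p ≤ formCycles G a j q :=
  sup_le_sup_right (Submodule.smul_mono_left (formIdeal_mono h)) _

lemma bd_mem_formCycles (hG : ∀ s ∈ G, ∀ t ⊆ s, t ∈ G) {j p : ℕ}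
    {c : Finset W → MvPolynomial W K} (hc : c ∈ formChains G a (j + 1) p) :
    bd G c ∈ formCycles G a j p := by
  obtain ⟨x, hx, y, hy, rfl⟩ := Submodule.mem_sup.1 hc
  rw [map_add]
  refine Submodule.add_mem_sup ?_ (mem_polyCycles_succ.1 (nullChains_le_polyCycles _ hy))
  have h1 : bd G x ∈ (formIdeal a p • (⊤ : Submodule (MvPolynomial W K) _)).map (bd G) :=
    ⟨x, hx, rfl⟩
  rw [Submodule.map_smul''] at h1
  refine Submodule.smul_mono le_rfl ?_ h1
  rintro _ ⟨c, -, rfl⟩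
  exact bd_mem_polyCycles hG c j

lemma exists_sub_smul_mem {p : ℕ} {Y N : Submodule (MvPolynomial W K) (Finset W → MvPolynomial W K)}
    {f : Finset W → MvPolynomial W K} (hf : f ∈ formIdeal a (p + 1) • Y ⊔ N) :
    ∃ g ∈ Y, f - linForm a p • g ∈ formIdeal a p • Y ⊔ N := by
  rw [formIdeal_succ, Submodule.sup_smul, sup_assoc, sup_comm (Ideal.span _ • Y), ← sup_assoc] at hf
  obtain ⟨x, hx, y, hy, rfl⟩ := Submodule.mem_sup.1 hf
  rw [Submodule.ideal_span_singleton_smul] at hy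
  obtain ⟨g, hg, rfl⟩ := hy
  exact ⟨g, hg, by simpa using hx⟩

lemma exists_sum_smul_sub_mem {p : ℕ}
    {Y N : Submodule (MvPolynomial W K) (Finset W → MvPolynomial W K)}
    {f : Finset W → MvPolynomial W K} (hf : f ∈ formIdeal a p • Y ⊔ N) :
    ∃ z : ℕ → Finset W → MvPolynomial W K, (∀ r, z r ∈ Y) ∧
      f - ∑ r ∈ range p, linForm a r • z r ∈ N := by
  induction p generalizing f with
  | zero =>
    refine ⟨0, fun _ => Submodule.zero_mem _, ?_⟩
    simpa [formIdeal_zero] using hf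
  | succ p ih =>
    obtain ⟨g, hg, hfg⟩ := exists_sub_smul_mem hf
    obtain ⟨z, hz, hfz⟩ := ih hfg
    refine ⟨Function.update z p g, fun r => ?_, ?_⟩
    · by_cases hr : r = p
      · subst hr; simpa using hg
      · simpa [hr] using hz r
    · rw [sum_range_succ, Function.update_self, sum_congr rfl fun r hr => by
        rw [Function.update_of_ne (ne_of_lt (mem_range.1 hr))], sub_add_eq_sub_sub_swap]
      exact hfz

lemma mem_formChains_of_linForm_smul_mem (ha : IsGeneric a d) {j r : ℕ} (hj : j ≤ d) (hr : r < j)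
    {c : Finset W → MvPolynomial W K} (hc : linForm a r • c ∈ formChains G a j r) :
    c ∈ formChains G a j r := by
  rw [mem_formChains] at hc ⊢
  intro τ hτ hτj
  exact ha.mem_of_linForm_mul_mem (hτj.le.trans hj) (by omega) (hc τ hτ hτj)

/-- The step from cycles on faces of cardinality `j` to those on faces of cardinality `j + 1`. -/
lemma mem_formCycles_of_bd_mem (h : IsModTwoSphere K G d) {j p : ℕ} (hj : j < d)
    (htor : ∀ f ∈ polyCycles K G (j + 1), f ∈ formChains G a (j + 1) p →
      f ∈ formCycles G a (j + 1) p) {f g : Finset W → MvPolynomial W K}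
    (hf : f ∈ polyCycles K G (j + 1)) (hfg : f - linForm a p • g ∈ formChains G a (j + 1) p)
    (hg : bd G g ∈ formCycles G a j p) : f ∈ formCycles G a (j + 1) (p + 1) := by
  -- Cycles below the top are boundaries, so combinations of cycles with coefficients in the ideal
  -- lift to such combinations of chains one level up.
  have h1 : formCycles G a j p ≤
      (formIdeal a p • (⊤ : Submodule (MvPolynomial W K) _)).map (bd G) ⊔ nullChains K G j := by
    refine sup_le ((Submodule.smul_mono le_rfl (polyCycles_le_map_bd h hj)).trans ?_) le_sup_right
    rw [Submodule.smul_sup, Submodule.map_smul'']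
    exact sup_le_sup_left Submodule.smul_le_right _
  obtain ⟨_, ⟨k, hk, rfl⟩, ν, hν, hkν⟩ := Submodule.mem_sup.1 (h1 hg)
  -- Correcting `g` by the lift `k` yields a genuine cycle, while θ_p k stays inside the forms
  -- already divided out.
  have hgk : g - k ∈ polyCycles K G (j + 1) := by
    rw [mem_polyCycles_succ, map_sub, ← hkν, add_sub_cancel_left]
    exact hν
  have hθ : linForm a p • (g - k) ∈ formIdeal a (p + 1) • polyCycles K G (j + 1) :=
    Submodule.smul_mem_smul (linForm_mem_formIdeal (Nat.lt_succ_self p)) hgk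
  have h2 : f - linForm a p • (g - k) ∈ formCycles G a (j + 1) p := by
    refine htor _ (Submodule.sub_mem _ hf (Submodule.smul_mem _ _ hgk)) ?_
    have : f - linForm a p • (g - k) = (f - linForm a p • g) + linForm a p • k := by
      rw [smul_sub]; abel
    rw [this]
    exact Submodule.add_mem _ hfg (Submodule.mem_sup_left (Submodule.smul_mem _ _ hk))
  rw [← sub_add_cancel f (linForm a p • (g - k))]
  exact Submodule.add_mem _ (formCycles_mono _ (Nat.le_succ p) h2) (Submodule.mem_sup_left hθ)

/-- Vanishing of a Tor group: for p < j the cycles meet (θ_1, …, θ_p) times the chains only in (θ_1,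
…, θ_p) times the cycles. The quotient of chains by cycles embeds in the cycles one level down, and
regularity on each K[τ] closes the induction. -/
lemma mem_formCycles_of_mem_formChains (h : IsModTwoSphere K G d) (ha : IsGeneric a d) {j : ℕ}
    (hj : j ≤ d) {p : ℕ} (hp : p < j) {f : Finset W → MvPolynomial W K}
    (hf : f ∈ polyCycles K G j) (hfp : f ∈ formChains G a j p) : f ∈ formCycles G a j p := by
  induction j generalizing p f with
  | zero => omega
  | succ j ihj =>
    induction p generalizing f with
    | zero =>
      rw [formChains, formIdeal_zero, Submodule.bot_smul, bot_sup_eq] at hfp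
      exact nullChains_le_formCycles _ _ hfp
    | succ p ihp =>
      obtain ⟨g, -, hg⟩ := exists_sub_smul_mem hfp
      refine mem_formCycles_of_bd_mem h hj (fun f hf hfp => ihp (by omega) hf hfp) hf hg ?_
      refine ihj (by omega) (by omega) (bd_mem_polyCycles h.down g j) ?_
      refine mem_formChains_of_linForm_smul_mem ha (by omega) (by omega) ?_
      have h1 : linForm a p • bd G g = bd G f - bd G (f - linForm a p • g) := by
        rw [map_sub, map_smul]; abel
      rw [h1]
      refine formCycles_le_formChains _ _ (Submodule.sub_mem _ ?_ (bd_mem_formCycles h.down hg))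
      exact nullChains_le_formCycles _ _ (mem_polyCycles_succ.1 hf)

/-- Families of homogeneous polynomials of degree `i`. -/
def IsHomFamily (i : ℕ) (c : Finset W → MvPolynomial W K) : Prop := ∀ τ, (c τ).IsHomogeneous i

lemma IsHomFamily.bd {i : ℕ} {c : Finset W → MvPolynomial W K} (hc : IsHomFamily i c) :
    IsHomFamily i (bd G c) := fun _ => IsHomogeneous.sum _ _ _ fun u _ => hc u

lemma exists_isHomFamily_sub_smul_mem (ha : IsGeneric a d) {i j : ℕ} (hj : j + 1 ≤ d)
    {f : Finset W → MvPolynomial W K} (hf : IsHomFamily (i + 1) f) :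
    ∃ g, IsHomFamily i g ∧ f - linForm a j • g ∈ formChains G a (j + 1) j := by
  have : ∀ τ : Finset W, ∃ g : MvPolynomial W K, g.IsHomogeneous i ∧ (τ.card = j + 1 →
      f τ - linForm a j * g ∈ formIdeal a j ⊔ faceIdeal K τ) := by
    intro τ
    by_cases hτ : τ.card = j + 1
    · obtain ⟨g, hg, hfg⟩ := ha.exists_sub_linForm_mul_mem hτ hj (hf τ)
      exact ⟨g, hg, fun _ => hfg⟩
    · exact ⟨0, isHomogeneous_zero _ _ _, fun h => absurd h hτ⟩
  choose g hg hfg using this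
  exact ⟨g, hg, mem_formChains.2 fun τ _ hτj => hfg τ hτj⟩

lemma mem_formCycles_succ_of_bd_mem (h : IsModTwoSphere K G d) (ha : IsGeneric a d) {j : ℕ}
    (hj : j + 1 ≤ d) {f g : Finset W → MvPolynomial W K} (hf : f ∈ polyCycles K G (j + 1))
    (hfg : f - linForm a j • g ∈ formChains G a (j + 1) j) (hg : bd G g ∈ formCycles G a j j) :
    f ∈ formCycles G a (j + 1) (j + 1) :=
  mem_formCycles_of_bd_mem h hj
    (fun _ hf hfp => mem_formCycles_of_mem_formChains h ha hj (Nat.lt_succ_self j) hf hfp) hf hfg hg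

/-- Each descent lowers both the level and the degree by one; at level 0 only constants survive on
the empty face. -/
lemma mem_formCycles_of_lt_degree (h : IsModTwoSphere K G d) (ha : IsGeneric a d) {i j : ℕ}
    (hj : j ≤ d) (hij : j < i) {f : Finset W → MvPolynomial W K} (hf : f ∈ polyCycles K G j)
    (hfi : IsHomFamily i f) : f ∈ formCycles G a j j := by
  induction j generalizing i f with
  | zero =>
    refine nullChains_le_formCycles _ _ fun τ _ hτ => mem_faceIdeal.2 fun m hm => ?_
    rw [card_eq_zero.1 hτ, subset_empty, Finsupp.support_eq_empty] at hm
    subst hm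
    refine (hfi τ).coeff_eq_zero ?_
    simpa using hij.ne
  | succ j ih =>
    obtain ⟨i, rfl⟩ : ∃ k, i = k + 1 := ⟨i - 1, by omega⟩
    obtain ⟨g, hg, hfg⟩ := exists_isHomFamily_sub_smul_mem (G := G) ha hj hfi
    exact mem_formCycles_succ_of_bd_mem h ha hj hf hfg
      (ih (by omega) (by omega) (bd_mem_polyCycles h.down g j) hg.bd)

/-- The descent ends in degree 0 at level 0, in the field `K`, where any two elements are dependent.
-/
lemma exists_combination_mem_formCycles (h : IsModTwoSphere K G d) (ha : IsGeneric a d) {j : ℕ}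
    (hj : j ≤ d) {f f' : Finset W → MvPolynomial W K} (hf : f ∈ polyCycles K G j)
    (hf' : f' ∈ polyCycles K G j) (hfj : IsHomFamily j f) (hfj' : IsHomFamily j f') :
    ∃ x y : K, (x ≠ 0 ∨ y ≠ 0) ∧
      (C x : MvPolynomial W K) • f + (C y : MvPolynomial W K) • f' ∈ formCycles G a j j := by
  induction j generalizing f f' with
  | zero =>
    obtain ⟨x, y, hxy, hxy'⟩ : ∃ x y : K, (x ≠ 0 ∨ y ≠ 0) ∧
        x * coeff 0 (f ∅) + y * coeff 0 (f' ∅) = 0 := by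
      by_cases h0 : coeff 0 (f ∅) = 0
      · exact ⟨1, 0, Or.inl one_ne_zero, by simp [h0]⟩
      · exact ⟨-coeff 0 (f' ∅), coeff 0 (f ∅), Or.inr h0, by ring⟩
    refine ⟨x, y, hxy, nullChains_le_formCycles _ _ fun τ _ hτ => mem_faceIdeal.2 fun m hm => ?_⟩
    rw [card_eq_zero.1 hτ, subset_empty, Finsupp.support_eq_empty] at hm
    subst hm
    rw [card_eq_zero.1 hτ]
    simpa using hxy'
  | succ j ih =>
    obtain ⟨g, hg, hfg⟩ := exists_isHomFamily_sub_smul_mem (G := G) ha hj hfj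
    obtain ⟨g', hg', hfg'⟩ := exists_isHomFamily_sub_smul_mem (G := G) ha hj hfj'
    obtain ⟨x, y, hxy, hmem⟩ := ih (by omega) (bd_mem_polyCycles h.down g j)
      (bd_mem_polyCycles h.down g' j) hg.bd hg'.bd
    refine ⟨x, y, hxy, mem_formCycles_succ_of_bd_mem (g := (C x : MvPolynomial W K) • g +
      (C y : MvPolynomial W K) • g') h ha hj (Submodule.add_mem _ (Submodule.smul_mem _ _ hf)
      (Submodule.smul_mem _ _ hf')) ?_ ?_⟩
    · have := Submodule.add_mem _ (Submodule.smul_mem _ (C x : MvPolynomial W K) hfg)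
        (Submodule.smul_mem _ (C y : MvPolynomial W K) hfg')
      convert this using 1
      ext1 τ
      simp only [Pi.sub_apply, Pi.add_apply, Pi.smul_apply, smul_eq_mul]
      ring
    · simpa using hmem

lemma coeff_single_linForm_mul (r : ℕ) (w : W) (f : MvPolynomial W K) :
    coeff (Finsupp.single w 1) (linForm a r * f) = a r w * coeff 0 f := by
  rw [linForm, sum_mul, coeff_sum, sum_eq_single w]
  · rw [mul_assoc, coeff_C_mul, coeff_X_mul']
    simp
  · intro v _ hvw
    rw [mul_assoc, coeff_C_mul, coeff_X_mul']
    simp [hvw]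
  · simp

/-- The base case of the socle computation: constants killed by all variables. Given τ and v ∈ τ,
write x_v f = ∑ θ_r z_r with cycles z_r and compare linear terms. -/
lemma mem_nullChains_of_X_smul_mem (h : IsModTwoSphere K G d) (ha : IsGeneric a d) {j : ℕ}
    (hj : j + 1 ≤ d) {f : Finset W → MvPolynomial W K} (hf : IsHomFamily 0 f)
    (hX : ∀ v, (X v : MvPolynomial W K) • f ∈ formCycles G a (j + 1) (j + 1)) :
    f ∈ nullChains K G (j + 1) := by
  intro τ hτ hτj
  obtain ⟨v, hv⟩ : τ.Nonempty := card_pos.1 (by omega)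
  obtain ⟨z, hz, hfz⟩ := exists_sum_smul_sub_mem (hX v)
  have hcoeff : ∀ σ ∈ G, σ.card = j + 1 → ∀ w ∈ σ,
      (if v = w then coeff 0 (f σ) else 0) =
        ∑ r ∈ range (j + 1), a r w * coeff 0 (z r σ) := by
    intro σ hσ hσj w hw
    have h1 := mem_faceIdeal.1 (hfz σ hσ hσj) (Finsupp.single w 1) (by
      refine Finsupp.support_single_subset.trans ?_
      simpa using hw)
    rw [Pi.sub_apply, coeff_sub, sub_eq_zero, Finset.sum_apply, coeff_sum] at h1
    simp only [Pi.smul_apply, smul_eq_mul, coeff_single_linForm_mul, coeff_X_mul'] at h1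
    rw [← h1]
    by_cases hvw : v = w
    · subst hvw; simp
    · simp [hvw]
  -- On a face avoiding v the linear terms of x_v f vanish, and the invertible matrix of the forms
  -- kills the constants of all z_r.
  have hzero : ∀ σ ∈ G, σ.card = j + 1 → v ∉ σ → ∀ r < j + 1, coeff 0 (z r σ) = 0 := by
    intro σ hσ hσj hvσ r hr
    obtain ⟨b, hb, -⟩ := ha.exists_inverse hσj hj
    have h1 : ∑ w ∈ σ, (∑ s ∈ range (j + 1), a s w * coeff 0 (z s σ)) * b w r = 0 := by
      refine sum_eq_zero fun w hw => ?_
      rw [← hcoeff σ hσ hσj w hw, if_neg (fun heq : v = w => hvσ (heq ▸ hw)), zero_mul]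
    have h2 : ∑ w ∈ σ, (∑ s ∈ range (j + 1), a s w * coeff 0 (z s σ)) * b w r =
        ∑ s ∈ range (j + 1), coeff 0 (z s σ) * ∑ w ∈ σ, a s w * b w r := by
      simp only [sum_mul, mul_sum]
      rw [sum_comm]
      exact sum_congr rfl fun _ _ => sum_congr rfl fun _ _ => by ring
    rw [h2, sum_eq_single r] at h1
    · rwa [hb r hr r hr, if_pos rfl, mul_one] at h1
    · intro s hs hsr
      rw [hb s (mem_range.1 hs) r hr, if_neg hsr, mul_zero]
    · exact fun h' => absurd (mem_range.2 hr) h'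
  -- Among the cofacets of τ \ v only τ contains v, so the cycle condition at τ \ v leaves just the
  -- constant of z_r at τ.
  have hτz : ∀ r < j + 1, coeff 0 (z r τ) = 0 := by
    intro r hr
    have hρ : (τ.erase v).card + 1 = j + 1 := by rw [card_erase_add_one hv, hτj]
    have hρG : τ.erase v ∈ G := h.down τ hτ _ (erase_subset _ _)
    have h1 := mem_faceIdeal.1 (hz r (τ.erase v) hρG hρ) 0 (by simp)
    rw [bd_apply, coeff_bdry, bdry, sum_eq_single_of_mem τ] at h1
    · exact h1
    · exact mem_cofacets.2 ⟨hτ, erase_subset _ _, (card_erase_add_one hv).symm⟩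
    · intro σ hσ hστ
      rw [mem_cofacets] at hσ
      refine hzero σ hσ.1 (by omega) (fun hvσ => hστ ?_) r hr
      refine (eq_of_subset_of_card_le ?_ (by omega)).symm
      rw [← insert_erase hv]
      exact insert_subset hvσ hσ.2.1
  have h0 : coeff 0 (f τ) = 0 := by
    have h1 := hcoeff τ hτ hτj v hv
    rw [if_pos rfl] at h1
    rw [h1]
    exact sum_eq_zero fun r hr => by rw [hτz r (mem_range.1 hr), mul_zero]
  refine mem_faceIdeal.2 fun m _ => ?_
  by_cases hm : m = 0
  · rwa [hm]
  · refine (hf τ).coeff_eq_zero ?_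
    rwa [Ne, Finsupp.degree_eq_zero_iff]

/-- The descent is linear over the polynomial ring, so being killed by all variables is inherited
one level down; this reduces to degree 0 at a positive level. -/
lemma mem_formCycles_of_X_smul_mem (h : IsModTwoSphere K G d) (ha : IsGeneric a d) {i j : ℕ}
    (hj : j ≤ d) (hij : i < j) {f : Finset W → MvPolynomial W K} (hf : f ∈ polyCycles K G j)
    (hfi : IsHomFamily i f) (hX : ∀ v, (X v : MvPolynomial W K) • f ∈ formCycles G a j j) :
    f ∈ formCycles G a j j := by
  induction j generalizing i f with
  | zero => omega
  | succ j ih =>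
    rcases i with _ | i
    · exact nullChains_le_formCycles _ _ (mem_nullChains_of_X_smul_mem h ha hj hfi hX)
    obtain ⟨g, hg, hfg⟩ := exists_isHomFamily_sub_smul_mem (G := G) ha hj hfi
    refine mem_formCycles_succ_of_bd_mem h ha hj hf hfg
      (ih (by omega) (by omega) (bd_mem_polyCycles h.down g j) hg.bd fun v => ?_)
    obtain ⟨z, hz, hzv⟩ := exists_sub_smul_mem (hX v)
    have h1 : linForm a j • ((X v : MvPolynomial W K) • g - z) ∈ formChains G a (j + 1) j := by
      have := Submodule.sub_mem _ (formCycles_le_formChains _ _ hzv)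
        (Submodule.smul_mem _ (X v : MvPolynomial W K) hfg)
      convert this using 1
      ext1 τ
      simp only [Pi.sub_apply, Pi.smul_apply, smul_eq_mul]
      ring
    have h2 := bd_mem_formCycles h.down
      (mem_formChains_of_linForm_smul_mem ha hj (Nat.lt_succ_self j) h1)
    rw [map_sub, map_smul] at h2
    rw [← sub_add_cancel ((X v : MvPolynomial W K) • bd G g) (bd G z)]
    exact Submodule.add_mem _ h2 (nullChains_le_formCycles _ _ (mem_polyCycles_succ.1 hz))

end Socle

/-! ### The Artinian reduction as a quotient of top cycles -/

section Quotient

variable {W K : Type*} [DecidableEq W] [Field K] {G : Finset (Finset W)} {d : ℕ} {a : ℕ → W → K}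

variable (K G) in
/-- The Stanley-Reisner ideal of the complex with faces `G`. -/
noncomputable def nonfaceIdeal : Ideal (MvPolynomial W K) :=
  Ideal.span {p | ∃ s : Finset W, s ∉ G ∧ p = ∏ v ∈ s, X v}

lemma mem_nonfaceIdeal (hG : ∀ s ∈ G, ∀ t ⊆ s, t ∈ G) {f : MvPolynomial W K} :
    f ∈ nonfaceIdeal K G ↔ ∀ m ∈ f.support, m.support ∉ G := by
  have hprod : ∀ s : Finset W, (∏ v ∈ s, X v : MvPolynomial W K) =
      monomial (∑ v ∈ s, Finsupp.single v 1) 1 := by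
    intro s
    rw [monomial_sum_one]
    rfl
  have hset : {p : MvPolynomial W K | ∃ s : Finset W, s ∉ G ∧ p = ∏ v ∈ s, X v} =
      (fun m => monomial m (1 : K)) '' {m | ∃ s : Finset W, s ∉ G ∧
        m = ∑ v ∈ s, Finsupp.single v 1} := by
    ext p
    constructor
    · rintro ⟨s, hs, rfl⟩
      exact ⟨_, ⟨s, hs, rfl⟩, (hprod s).symm⟩
    · rintro ⟨_, ⟨s, hs, rfl⟩, rfl⟩
      exact ⟨s, hs, (hprod s).symm⟩
  have hval : ∀ (s : Finset W) (v : W), (∑ w ∈ s, Finsupp.single w 1 : W →₀ ℕ) v =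
      if v ∈ s then 1 else 0 := by
    intro s v
    simp [Finsupp.finsetSum_apply, Finsupp.single_apply]
  rw [nonfaceIdeal, hset, mem_ideal_span_monomial_image]
  refine forall₂_congr fun m _ => ?_
  constructor
  · rintro ⟨_, ⟨s, hs, rfl⟩, hsm⟩ hm
    refine hs (hG _ hm s fun v hv => Finsupp.mem_support_iff.2 fun h0 => ?_)
    have := hsm v
    rw [hval, if_pos hv, h0] at this
    omega
  · intro hm
    refine ⟨_, ⟨m.support, hm, rfl⟩, fun v => ?_⟩
    rw [hval]
    split_ifs with hv
    · exact Nat.one_le_iff_ne_zero.2 (Finsupp.mem_support_iff.1 hv)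
    · exact Nat.zero_le _

variable [Fintype W]

variable (G) in
/-- The ideal generated by the Stanley-Reisner ideal and the linear forms. -/
noncomputable def artinIdeal (a : ℕ → W → K) (d : ℕ) : Ideal (MvPolynomial W K) :=
  nonfaceIdeal K G ⊔ formIdeal a d

variable [CharP K 2]

/-- By `polyCycles_top_le` top cycles are constant families up to null families, and by purity a
constant family is null exactly for elements of the Stanley-Reisner ideal. -/
lemma mem_artinIdeal_iff (h : IsModTwoSphere K G d) {f : MvPolynomial W K} :
    f ∈ artinIdeal G a d ↔ constFamily W K f ∈ formCycles G a d d := by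
  constructor
  · intro hf
    obtain ⟨x, hx, y, hy, rfl⟩ := Submodule.mem_sup.1 hf
    rw [map_add]
    refine Submodule.add_mem _ (nullChains_le_formCycles _ _ fun τ hτ _ => ?_)
      (Submodule.mem_sup_left ?_)
    · refine mem_faceIdeal.2 fun m hm => ?_
      by_contra hcon
      exact (mem_nonfaceIdeal h.down).1 hx m (mem_support_iff.2 hcon) (h.down τ hτ _ hm)
    · have : constFamily W K y = y • constFamily W K 1 := by
        rw [← map_smul, smul_eq_mul, mul_one]
      rw [this]
      exact Submodule.smul_mem_smul hy (constFamily_mem_polyCycles h 1)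
  · intro hf
    have h1 : formCycles G a d d ≤
        Submodule.map (constFamily W K) (formIdeal a d) ⊔ nullChains K G d := by
      refine sup_le ((Submodule.smul_mono le_rfl (polyCycles_top_le h)).trans ?_) le_sup_right
      rw [Submodule.smul_sup, ← Submodule.map_smul'']
      exact sup_le_sup (Submodule.map_mono Ideal.mul_le_left) Submodule.smul_le_right
    obtain ⟨_, ⟨x, hx, rfl⟩, y, hy, hxy⟩ := Submodule.mem_sup.1 (h1 hf)
    rw [← sub_add_cancel f x]
    refine Submodule.add_mem_sup ((mem_nonfaceIdeal h.down).2 fun m hm hmG => ?_) hx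
    obtain ⟨u, hu, hmu, hud⟩ := h.exists_facet hmG
    have h2 := hy u hu hud
    have h3 : y u = f - x := by
      have := congrFun hxy u
      simp only [Pi.add_apply] at this
      change x + y u = f at this
      rw [← this, add_sub_cancel_left]
    rw [h3] at h2
    exact mem_support_iff.1 hm (mem_faceIdeal.1 h2 m hmu)

lemma mem_artinIdeal_of_lt_degree (h : IsModTwoSphere K G d) (ha : IsGeneric a d) {i : ℕ}
    (hi : d < i) {f : MvPolynomial W K} (hf : f.IsHomogeneous i) : f ∈ artinIdeal G a d :=
  (mem_artinIdeal_iff h).2 (mem_formCycles_of_lt_degree h ha le_rfl hi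
    (constFamily_mem_polyCycles h f) fun _ => hf)

lemma exists_combination_mem_artinIdeal (h : IsModTwoSphere K G d) (ha : IsGeneric a d)
    {f g : MvPolynomial W K} (hf : f.IsHomogeneous d) (hg : g.IsHomogeneous d) :
    ∃ x y : K, (x ≠ 0 ∨ y ≠ 0) ∧ C x * f + C y * g ∈ artinIdeal G a d := by
  obtain ⟨x, y, hxy, hmem⟩ := exists_combination_mem_formCycles h ha le_rfl
    (constFamily_mem_polyCycles h f) (constFamily_mem_polyCycles h g) (fun _ => hf) fun _ => hg
  refine ⟨x, y, hxy, (mem_artinIdeal_iff h).2 ?_⟩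
  rwa [map_add, ← smul_eq_mul, ← smul_eq_mul, map_smul, map_smul]

lemma exists_X_mul_notMem_artinIdeal (h : IsModTwoSphere K G d) (ha : IsGeneric a d) {i : ℕ}
    (hi : i < d) {f : MvPolynomial W K} (hf : f.IsHomogeneous i) (hfJ : f ∉ artinIdeal G a d) :
    ∃ v, X v * f ∉ artinIdeal G a d := by
  by_contra! hcon
  refine hfJ ((mem_artinIdeal_iff h).2 (mem_formCycles_of_X_smul_mem h ha le_rfl hi
    (constFamily_mem_polyCycles h f) (fun _ => hf) fun v => ?_))
  rw [← map_smul]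
  exact (mem_artinIdeal_iff h).1 (hcon v)

lemma exists_prod_X_mul_notMem_artinIdeal (h : IsModTwoSphere K G d) (ha : IsGeneric a d)
    {i : ℕ} (k : ℕ) (hi : i + k ≤ d) {f : MvPolynomial W K} (hf : f.IsHomogeneous i)
    (hfJ : f ∉ artinIdeal G a d) :
    ∃ J : Fin k → W, (∏ l, X (J l)) * f ∉ artinIdeal G a d := by
  induction k generalizing i f with
  | zero => exact ⟨Fin.elim0, by simpa using hfJ⟩
  | succ k ih =>
    obtain ⟨v, hv⟩ := exists_X_mul_notMem_artinIdeal h ha (by omega) hf hfJ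
    obtain ⟨J, hJ⟩ := ih (i := 1 + i) (by omega) ((isHomogeneous_X K v).mul hf) hv
    refine ⟨Fin.cons v J, ?_⟩
    rw [Fin.prod_univ_succ]
    simp only [Fin.cons_zero, Fin.cons_succ]
    rwa [mul_comm (X v), mul_assoc]

end Quotient

/-! ### An interpolation identity for d + 1 columns -/

section Columns

variable {U K : Type*} [LinearOrder U] [Field K] (u : ℕ → U → K) (d : ℕ)

/-- The determinant of the first `d` rows of `u` and the columns in `s`, in increasing order. -/
noncomputable def colDet (s : Finset U) : K :=
  if h : s.card = d then (Matrix.of fun r k : Fin d => u r (s.orderEmbOfFin h k)).det else 0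

/-- `p` is supported on `s`, and its image under the first `d` rows of `u` is the last unit
vector. -/
def IsSolution (s : Finset U) (p : U → K) : Prop :=
  (∀ x ∉ s, p x = 0) ∧ ∀ r < d, ∑ x ∈ s, u r x * p x = if r + 1 = d then 1 else 0

open Classical in
/-- The point at which the linear forms take the values `0, …, 0, 1` and all coordinates outside `s`
vanish. -/
noncomputable def point (s : Finset U) : U → K :=
  if h : ∃ p, IsSolution u d s p then h.choose else 0

/-- The coefficient of the value at `point u d s` in the degree map. -/
noncomputable def weight (s : Finset U) : K := (colDet u d s * ∏ x ∈ s, point u d s x)⁻¹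

variable {u d}

lemma sum_eq_sum_orderEmbOfFin {M : Type*} [AddCommMonoid M] {s : Finset U} {n : ℕ}
    (h : s.card = n) (g : U → M) : ∑ x ∈ s, g x = ∑ k, g (s.orderEmbOfFin h k) := by
  nth_rewrite 1 [← s.map_orderEmbOfFin_univ h]
  rw [sum_map]
  rfl

lemma exists_orderEmbOfFin_eq {s : Finset U} {n : ℕ} (h : s.card = n) {x : U} (hx : x ∈ s) :
    ∃ k, s.orderEmbOfFin h k = x := by
  have : x ∈ Set.range (s.orderEmbOfFin h) := by rwa [range_orderEmbOfFin]
  exact this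

lemma colDet_ne_zero_iff {s : Finset U} (h : s.card = d) :
    colDet u d s ≠ 0 ↔
      ∀ y : U → K, (∀ r < d, ∑ x ∈ s, u r x * y x = 0) → ∀ x ∈ s, y x = 0 := by
  rw [colDet, dif_pos h, Ne, ← Matrix.exists_mulVec_eq_zero_iff, not_exists]
  constructor
  · intro h1 y hy x hx
    by_contra hcon
    refine h1 (fun k => y (s.orderEmbOfFin h k)) ⟨fun h0 => hcon ?_, funext fun r => ?_⟩
    · obtain ⟨k, rfl⟩ := exists_orderEmbOfFin_eq h hx
      exact congrFun h0 k
    · have := hy r r.2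
      rwa [sum_eq_sum_orderEmbOfFin h] at this
  · rintro h1 y ⟨hy0, hy⟩
    have hext : ∀ k, Function.extend (s.orderEmbOfFin h) y 0 (s.orderEmbOfFin h k) = y k :=
      fun k => (s.orderEmbOfFin h).injective.extend_apply _ _ k
    refine hy0 (funext fun k => ?_)
    rw [← hext k]
    refine h1 _ (fun r hr => ?_) _ (orderEmbOfFin_mem _ _ _)
    rw [sum_eq_sum_orderEmbOfFin h]
    simp only [hext]
    exact congrFun hy ⟨r, hr⟩

lemma isSolution_point {s : Finset U} (h : s.card = d) (hs : colDet u d s ≠ 0) :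
    IsSolution u d s (point u d s) := by
  have hex : ∃ p, IsSolution u d s p := by
    rw [colDet, dif_pos h] at hs
    have hu : IsUnit (Matrix.of fun r k : Fin d => u r (s.orderEmbOfFin h k)).det := hs.isUnit
    set M := Matrix.of fun r k : Fin d => u r (s.orderEmbOfFin h k) with hM
    let t : Fin d → K := fun r => if (r : ℕ) + 1 = d then 1 else 0
    have h1 : M.mulVec (M⁻¹.mulVec t) = t := by
      rw [Matrix.mulVec_mulVec, Matrix.mul_nonsing_inv M hu, Matrix.one_mulVec]
    have hext : ∀ k, Function.extend (s.orderEmbOfFin h) (M⁻¹.mulVec t) 0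
        (s.orderEmbOfFin h k) = M⁻¹.mulVec t k :=
      fun k => (s.orderEmbOfFin h).injective.extend_apply _ _ k
    refine ⟨Function.extend (s.orderEmbOfFin h) (M⁻¹.mulVec t) 0, fun x hx => ?_, fun r hr => ?_⟩
    · rw [Function.extend_apply' _ _ _ (fun ⟨k, hk⟩ => hx (hk ▸ orderEmbOfFin_mem s h k))]
      rfl
    · rw [sum_eq_sum_orderEmbOfFin h]
      simp only [hext]
      exact congrFun h1 ⟨r, hr⟩
  rw [point, dif_pos hex]
  exact hex.choose_spec

lemma eq_point {s : Finset U} (h : s.card = d) (hs : colDet u d s ≠ 0) {p : U → K}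
    (hp : IsSolution u d s p) : p = point u d s := by
  have h1 := isSolution_point h hs
  ext x
  by_cases hx : x ∈ s
  · rw [← sub_eq_zero]
    refine (colDet_ne_zero_iff h).1 hs (p - point u d s) (fun r hr => ?_) x hx
    simp only [Pi.sub_apply, mul_sub, sum_sub_distrib]
    rw [hp.2 r hr, h1.2 r hr, sub_self]
  · rw [hp.1 x hx, h1.1 x hx]

variable [CharP K 2]

/-- Expansion of a determinant with a repeated row. The maximal minors thus give a kernel vector,
with no signs in characteristic 2. -/
lemma sum_mul_colDet_erase {S : Finset U} (hS : S.card = d + 1) {r : ℕ} (hr : r < d) :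
    ∑ x ∈ S, u r x * colDet u d (S.erase x) = 0 := by
  let e := S.orderEmbOfFin hS
  let M : Matrix (Fin (d + 1)) (Fin (d + 1)) K :=
    Matrix.of (Fin.cons (fun k => u r (e k)) fun i k => u i (e k))
  have h0 : M.det = 0 := by
    refine Matrix.det_zero_of_row_eq (i := 0) (j := (⟨r, hr⟩ : Fin d).succ)
      (Fin.succ_ne_zero _).symm rfl
  rw [Matrix.det_succ_row_zero] at h0
  rw [sum_eq_sum_orderEmbOfFin hS, ← h0]
  refine sum_congr rfl fun k _ => ?_
  rw [show (-1 : K) = 1 from CharTwo.neg_eq 1, one_pow, one_mul]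
  have hcard : (S.erase (e k)).card = d := by
    rw [card_erase_of_mem (orderEmbOfFin_mem S hS k), hS, Nat.add_sub_cancel]
  have he : (fun l => e (k.succAbove l)) = (S.erase (e k)).orderEmbOfFin hcard := by
    refine orderEmbOfFin_unique hcard (fun l => ?_) fun l l' hl => ?_
    · exact mem_erase.2 ⟨fun h => Fin.succAbove_ne k l (e.injective h), orderEmbOfFin_mem _ _ _⟩
    · exact e.strictMono (Fin.strictMono_succAbove k hl)
  change u r (e k) * colDet u d (S.erase (e k)) = u r (e k) * _
  rw [colDet, dif_pos hcard, ← he]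
  rfl

lemma natDegree_aeval_le {ι : Type*} {L : ι → Polynomial K} (hL : ∀ i, (L i).natDegree ≤ 1)
    (g : MvPolynomial ι K) : (aeval L g).natDegree ≤ g.totalDegree := by
  rw [aeval_def, eval₂_eq]
  refine Polynomial.natDegree_sum_le_of_forall_le _ _ fun m hm => ?_
  refine (Polynomial.natDegree_C_mul_le _ _).trans ((Polynomial.natDegree_prod_le _ _).trans ?_)
  refine le_trans (sum_le_sum fun i _ => ?_) (le_totalDegree hm)
  exact Polynomial.natDegree_pow_le.trans (by simpa using Nat.mul_le_mul_left _ (hL i))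

/-- All the points for S \ x lie on one line, since any two solutions on `S` differ by a multiple of
the kernel vector of minors. On this line the weights become Lagrange denominators, and the sum is
the coefficient of degree d of a polynomial of degree below d. -/
lemma sum_weight_erase_mul_eval {S : Finset U} (hS : S.card = d + 1)
    (hdet : ∀ x ∈ S, colDet u d (S.erase x) ≠ 0)
    (hpt : ∀ x ∈ S, ∀ k ∈ S.erase x, point u d (S.erase x) k ≠ 0)
    {g : MvPolynomial U K} (hg : g.totalDegree < d) :
    ∑ x ∈ S, weight u d (S.erase x) * eval (point u d (S.erase x)) g = 0 := by
  obtain ⟨x₀, hx₀⟩ : S.Nonempty := card_pos.1 (by omega)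
  have hcard : ∀ x ∈ S, (S.erase x).card = d := fun x hx => by
    rw [card_erase_of_mem hx, hS, Nat.add_sub_cancel]
  set q : U → K := fun x => colDet u d (S.erase x) with hq
  set p := point u d (S.erase x₀) with hp
  have hsol := isSolution_point (hcard x₀ hx₀) (hdet x₀ hx₀)
  set z : U → K := fun x => p x / q x with hz
  have hpS : ∀ x ∉ S, p x = 0 := fun x hx => hsol.1 x fun h => hx (mem_of_mem_erase h)
  -- The parameter `z x` is the one at which coordinate x of p + z q vanishes.
  have hline : ∀ x ∈ S, point u d (S.erase x) = fun k => if k ∈ S then p k + z x * q k else 0 := by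
    intro x hx
    have hxx : p x + z x * q x = 0 := by
      simp only [hz]
      rw [div_mul_cancel₀ _ (hdet x hx), CharTwo.add_self_eq_zero]
    refine (eq_point (hcard x hx) (hdet x hx) ⟨fun k hk => ?_, fun r hr => ?_⟩).symm
    · by_cases hkS : k ∈ S
      · have : k = x := by
          by_contra hkx
          exact hk (mem_erase.2 ⟨hkx, hkS⟩)
        rw [if_pos hkS, this, hxx]
      · exact if_neg hkS
    · have h1 : ∑ k ∈ S.erase x, u r k * (if k ∈ S then p k + z x * q k else 0) =
          ∑ k ∈ S, u r k * (p k + z x * q k) := by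
        rw [← add_sum_erase S _ hx, hxx, mul_zero, zero_add]
        exact sum_congr rfl fun k hk => by rw [if_pos (mem_of_mem_erase hk)]
      rw [h1, ← hsol.2 r hr, ← hp]
      have h2 : ∑ k ∈ S, u r k * (p k + z x * q k) =
          ∑ k ∈ S, u r k * p k + z x * ∑ k ∈ S, u r k * q k := by
        rw [mul_sum, ← sum_add_distrib]
        exact sum_congr rfl fun _ _ => by ring
      have h3 : p x₀ = 0 := hsol.1 x₀ (by simp)
      rw [h2, sum_mul_colDet_erase hS hr, mul_zero, add_zero, ← add_sum_erase S _ hx₀, h3,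
        mul_zero, zero_add]
  have hcoord : ∀ x ∈ S, ∀ k ∈ S, point u d (S.erase x) k = q k * (z x - z k) := by
    intro x hx k hk
    rw [hline x hx]
    simp only [if_pos hk]
    have : p k = z k * q k := (div_mul_cancel₀ _ (hdet k hk)).symm
    rw [this, CharTwo.sub_eq_add]
    ring
  -- Equal parameters would make coordinate k of the point for S \ x zero.
  have hinj : Set.InjOn z S := by
    intro x hx k hk hxk
    by_contra hne
    refine hpt x hx k (mem_erase.2 ⟨Ne.symm hne, hk⟩) ?_
    rw [hcoord x hx k hk, hxk, sub_self, mul_zero]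
  let P : Polynomial K := aeval (fun k => if k ∈ S then Polynomial.C (p k) +
    Polynomial.X * Polynomial.C (q k) else 0) g
  have hPdeg : P.natDegree < d := by
    refine lt_of_le_of_lt (natDegree_aeval_le (fun k => ?_) g) hg
    split_ifs
    · refine Polynomial.natDegree_add_le_of_degree_le (by simp) ?_
      refine (Polynomial.natDegree_mul_C_le _ _).trans Polynomial.natDegree_X_le
    · simp
  have hPeval : ∀ x ∈ S, P.eval (z x) = eval (point u d (S.erase x)) g := by
    intro x hx
    have h1 : P.eval (z x) = (Polynomial.aeval (z x)).comp (aeval (R := K) (fun k => if k ∈ S then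
        Polynomial.C (p k) + Polynomial.X * Polynomial.C (q k) else 0)) g := by
      simp [P, Polynomial.coe_aeval_eq_eval]
    rw [h1, comp_aeval, hline x hx, ← coe_aeval_eq_eval]
    simp only [RingHom.coe_coe]
    congr 2
    ext k
    split_ifs with hk
    · simp only [map_add, map_mul, Polynomial.aeval_C, Polynomial.aeval_X, Algebra.algebraMap_self,
        RingHom.id_apply]
    · exact map_zero _
  have hlag := Lagrange.coeff_eq_sum (P := P) hinj (by
    rw [hS]
    refine lt_of_le_of_lt Polynomial.degree_le_natDegree ?_
    exact_mod_cast Nat.lt_succ_of_lt hPdeg)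
  rw [hS, Nat.add_sub_cancel, Polynomial.coeff_eq_zero_of_natDegree_lt hPdeg] at hlag
  have hterm : ∀ x ∈ S, weight u d (S.erase x) * eval (point u d (S.erase x)) g =
      (∏ k ∈ S, q k)⁻¹ * (P.eval (z x) / ∏ k ∈ S.erase x, (z x - z k)) := by
    intro x hx
    have h1 : colDet u d (S.erase x) * ∏ k ∈ S.erase x, point u d (S.erase x) k =
        (∏ k ∈ S, q k) * ∏ k ∈ S.erase x, (z x - z k) := by
      rw [prod_congr rfl fun k hk => hcoord x hx k (mem_of_mem_erase hk), prod_mul_distrib,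
        ← mul_assoc, ← mul_prod_erase S q hx]
    rw [weight, h1, mul_inv, hPeval x hx, div_eq_mul_inv]
    ring
  rw [sum_congr rfl hterm, ← mul_sum, ← hlag, mul_zero]

end Columns

/-! ### The degree map and its kernel -/

section DegreeMap

variable {W K : Type*} [LinearOrder W] [Field K] {a : ℕ → W → K} {d : ℕ}

/-- Adds the first unit vector as a new column. -/
def coneMatrix (a : ℕ → W → K) (r : ℕ) : WithBot W → K :=
  WithBot.recBotCoe (if r = 0 then 1 else 0) (a r)

/-- The embedding of the vertices into those of the cone. -/
def coneEmb (W : Type*) : W ↪ WithBot W := ⟨fun w => w, WithBot.coe_injective⟩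

lemma colDet_map (s : Finset W) :
    colDet (coneMatrix a) d (s.map (coneEmb W)) = colDet a d s := by
  unfold colDet
  by_cases h : s.card = d
  · have h' : (s.map (coneEmb W)).card = d := by rwa [card_map]
    have he : (fun k => coneEmb W (s.orderEmbOfFin h k)) =
        (s.map (coneEmb W)).orderEmbOfFin h' := by
      refine orderEmbOfFin_unique h' (fun k => mem_map_of_mem _ (orderEmbOfFin_mem _ _ _)) ?_
      exact fun k l hkl => WithBot.coe_lt_coe.2 ((s.orderEmbOfFin h).strictMono hkl)
    rw [dif_pos h, dif_pos h', ← he]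
    rfl
  · rw [dif_neg h, dif_neg (by rwa [card_map])]

lemma point_map {s : Finset W} (h : s.card = d) (hs : colDet a d s ≠ 0) (v : W) :
    point (coneMatrix a) d (s.map (coneEmb W)) (coneEmb W v) = point a d s v := by
  have h' : (s.map (coneEmb W)).card = d := by rwa [card_map]
  have hs' : colDet (coneMatrix a) d (s.map (coneEmb W)) ≠ 0 := by rwa [colDet_map]
  have h1 := isSolution_point h' hs'
  refine congrFun (eq_point (p := fun v => point (coneMatrix a) d (s.map (coneEmb W))
    (coneEmb W v)) h hs ⟨fun x hx => h1.1 _ (by simpa using hx), fun r hr => ?_⟩) v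
  have := h1.2 r hr
  rw [sum_map] at this
  exact this

lemma weight_map {s : Finset W} (h : s.card = d) (hs : colDet a d s ≠ 0) :
    weight (coneMatrix a) d (s.map (coneEmb W)) = weight a d s := by
  rw [weight, weight, colDet_map, prod_map, prod_congr rfl fun v _ => point_map h hs v]

lemma IsGeneric.colDet_ne_zero (ha : IsGeneric a d) {s : Finset W} (h : s.card = d) :
    colDet a d s ≠ 0 :=
  (colDet_ne_zero_iff h).2 fun y hy =>
    ha (range d) s Subset.rfl (by simp [h]) y fun r hr => hy r (mem_range.1 hr)

/-- A zero coordinate would leave d - 1 columns satisfying d - 1 homogeneous equations, so the whole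
point would vanish, contradicting the value 1 of the last form. -/
lemma IsGeneric.point_ne_zero (ha : IsGeneric a d) {s : Finset W} (h : s.card = d) {v : W}
    (hv : v ∈ s) : point a d s v ≠ 0 := by
  intro h0
  have hd : 0 < d := h ▸ card_pos.2 ⟨v, hv⟩
  have h1 := isSolution_point h (ha.colDet_ne_zero h)
  have h2 := ha (range (d - 1)) (s.erase v) (range_subset_range.2 (by omega))
    (by rw [card_range, card_erase_of_mem hv, h]) (point a d s) fun r hr => by
      rw [mem_range] at hr
      have := h1.2 r (by omega)
      rwa [← add_sum_erase s _ hv, h0, mul_zero, zero_add, if_neg (by omega)] at this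
  have h3 := h1.2 (d - 1) (by omega)
  rw [if_pos (by omega), sum_eq_zero] at h3
  · exact zero_ne_one h3
  · intro x hx
    by_cases hxv : x = v
    · rw [hxv, h0, mul_zero]
    · rw [h2 x (mem_erase.2 ⟨hxv, hx⟩), mul_zero]

lemma sum_insert_bot {ρ : Finset W} (r : ℕ) (y : WithBot W → K) :
    ∑ x ∈ insert ⊥ (ρ.map (coneEmb W)), coneMatrix a r x * y x =
      (if r = 0 then y ⊥ else 0) + ∑ v ∈ ρ, a r v * y (coneEmb W v) := by
  rw [sum_insert (by simp [coneEmb]), sum_map]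
  congr 1
  change (if r = 0 then 1 else 0) * y ⊥ = _
  split_ifs <;> simp

lemma card_insert_bot {ρ : Finset W} (h : ρ.card + 1 = d) :
    (insert ⊥ (ρ.map (coneEmb W))).card = d := by
  rw [card_insert_of_notMem (by simp [coneEmb]), card_map, h]

lemma IsGeneric.colDet_insert_bot_ne_zero (ha : IsGeneric a d) {ρ : Finset W}
    (h : ρ.card + 1 = d) : colDet (coneMatrix a) d (insert ⊥ (ρ.map (coneEmb W))) ≠ 0 := by
  rw [colDet_ne_zero_iff (card_insert_bot h)]
  intro y hy
  have h1 := ha ((range d).erase 0) ρ (erase_subset _ _)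
    (by rw [card_erase_of_mem (mem_range.2 (by omega)), card_range]; omega)
    (fun v => y (coneEmb W v)) fun r hr => by
      rw [mem_erase, mem_range] at hr
      have := hy r hr.2
      rwa [sum_insert_bot, if_neg hr.1, zero_add] at this
  have h2 := hy 0 (by omega)
  rw [sum_insert_bot, if_pos rfl, sum_eq_zero fun v hv => by rw [h1 v hv, mul_zero],
    add_zero] at h2
  intro x hx
  rw [mem_insert, mem_map] at hx
  rcases hx with rfl | ⟨v, hv, rfl⟩
  · exact h2
  · exact h1 v hv

/-- The cone column is the first unit vector and the right-hand side the last one; d ≥ 2 makes them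
different. -/
lemma IsGeneric.point_insert_bot_ne_zero (ha : IsGeneric a d) (hd : 2 ≤ d) {ρ : Finset W}
    (h : ρ.card + 1 = d) {x : WithBot W} (hx : x ∈ insert ⊥ (ρ.map (coneEmb W))) :
    point (coneMatrix a) d (insert ⊥ (ρ.map (coneEmb W))) x ≠ 0 := by
  intro h0
  set p := point (coneMatrix a) d (insert ⊥ (ρ.map (coneEmb W))) with hp
  have h1 : ∀ r < d, (if r = 0 then p ⊥ else 0) + ∑ v ∈ ρ, a r v * p (coneEmb W v) =
      if r + 1 = d then 1 else 0 := fun r hr => by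
    rw [← sum_insert_bot]
    exact (isSolution_point (card_insert_bot h) (ha.colDet_insert_bot_ne_zero h)).2 r hr
  have h2 : ∀ v ∈ ρ, p (coneEmb W v) = 0 := by
    rw [mem_insert, mem_map] at hx
    rcases hx with rfl | ⟨w, hw, rfl⟩
    · refine ha (range (d - 1)) ρ (range_subset_range.2 (by omega)) (by rw [card_range]; omega)
        (fun v => p (coneEmb W v)) fun r hr => ?_
      rw [mem_range] at hr
      have := h1 r (by omega)
      rwa [h0, ite_self, zero_add, if_neg (by omega)] at this
    · have h3 := ha ((range (d - 1)).erase 0) (ρ.erase w)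
        ((erase_subset _ _).trans (range_subset_range.2 (by omega)))
        (by
          rw [card_erase_of_mem hw, card_erase_of_mem (mem_range.2 (by omega)), card_range]
          omega) (fun v => p (coneEmb W v)) fun r hr => by
          rw [mem_erase, mem_range] at hr
          have := h1 r (by omega)
          rwa [if_neg hr.1, zero_add, if_neg (by omega), ← add_sum_erase ρ _ hw, h0, mul_zero,
            zero_add] at this
      intro v hv
      by_cases hvw : v = w
      · rw [hvw, h0]
      · exact h3 v (mem_erase.2 ⟨hvw, hv⟩)
  have h3 := h1 (d - 1) (by omega)
  rw [if_neg (by omega), if_pos (by omega), sum_eq_zero fun v hv => by rw [h2 v hv, mul_zero],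
    zero_add] at h3
  exact zero_ne_one h3

/-- The degree map of the complex with faces `G`. -/
noncomputable def degreeMap (G : Finset (Finset W)) (a : ℕ → W → K) (d : ℕ) :
    MvPolynomial W K →ₗ[K] K :=
  ∑ σ ∈ G with σ.card = d, weight a d σ • (aeval (point a d σ)).toLinearMap

lemma degreeMap_apply (G : Finset (Finset W)) (f : MvPolynomial W K) :
    degreeMap G a d f = ∑ σ ∈ G with σ.card = d, weight a d σ * eval (point a d σ) f := by
  simp [degreeMap]

variable [CharP K 2] {G : Finset (Finset W)}

/-- The interpolation identity for σ and the cone vertex. Each summand depends only on the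
codimension-one face σ \ v. -/
lemma weight_mul_eval_eq_sum (ha : IsGeneric a d) (hd : 2 ≤ d) {σ : Finset W} (hσ : σ.card = d)
    {g : MvPolynomial W K} (hg : g.totalDegree < d) :
    weight a d σ * eval (point a d σ) g =
      ∑ v ∈ σ, weight (coneMatrix a) d (insert ⊥ ((σ.erase v).map (coneEmb W))) *
        eval (point (coneMatrix a) d (insert ⊥ ((σ.erase v).map (coneEmb W))))
          (rename (coneEmb W) g) := by
  have hbot : (⊥ : WithBot W) ∉ σ.map (coneEmb W) := by simp [coneEmb]
  have hS : (insert ⊥ (σ.map (coneEmb W))).card = d + 1 := by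
    rw [card_insert_of_notMem hbot, card_map, hσ]
  have he1 : (insert ⊥ (σ.map (coneEmb W))).erase ⊥ = σ.map (coneEmb W) := erase_insert hbot
  have he2 : ∀ v, (insert ⊥ (σ.map (coneEmb W))).erase (coneEmb W v) =
      insert ⊥ ((σ.erase v).map (coneEmb W)) := by
    intro v
    rw [erase_insert_of_ne (by simp [coneEmb]), map_erase]
  have hcard : ∀ v ∈ σ, (σ.erase v).card + 1 = d := fun v hv => by
    rw [card_erase_add_one hv, hσ]
  have key := sum_weight_erase_mul_eval (u := coneMatrix a) hS ?_ ?_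
    (lt_of_le_of_lt (totalDegree_rename_le (coneEmb W) g) hg)
  · rw [sum_insert hbot, he1, sum_map, CharTwo.add_eq_zero] at key
    rw [weight_map hσ (ha.colDet_ne_zero hσ), eval_rename] at key
    have hp : point (coneMatrix a) d (σ.map (coneEmb W)) ∘ coneEmb W = point a d σ :=
      funext fun v => point_map hσ (ha.colDet_ne_zero hσ) v
    rw [hp] at key
    rw [key]
    exact sum_congr rfl fun v _ => by rw [he2]
  · intro x hx
    rw [mem_insert, mem_map] at hx
    rcases hx with rfl | ⟨v, hv, rfl⟩
    · rw [he1, colDet_map]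
      exact ha.colDet_ne_zero hσ
    · rw [he2]
      exact ha.colDet_insert_bot_ne_zero (hcard v hv)
  · intro x hx k hk
    rw [mem_insert, mem_map] at hx
    rcases hx with rfl | ⟨v, hv, rfl⟩
    · rw [he1] at hk ⊢
      obtain ⟨v, hv, rfl⟩ := mem_map.1 hk
      rw [point_map hσ (ha.colDet_ne_zero hσ)]
      exact ha.point_ne_zero hσ hv
    · rw [he2] at hk ⊢
      exact ha.point_insert_bot_ne_zero hd (hcard v hv) hk

/-- After coning, the sum over facets becomes a sum over codimension-one faces, each counted an even
number of times. -/
lemma degreeMap_eq_zero_of_totalDegree_lt (h : IsModTwoSphere K G d) (ha : IsGeneric a d)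
    (hd : 2 ≤ d) {g : MvPolynomial W K} (hg : g.totalDegree < d) : degreeMap G a d g = 0 := by
  rw [degreeMap_apply, sum_congr rfl fun σ hσ =>
    weight_mul_eval_eq_sum ha hd (mem_filter.1 hσ).2 hg]
  set T : Finset W → K := fun ρ => weight (coneMatrix a) d (insert ⊥ (ρ.map (coneEmb W))) *
    eval (point (coneMatrix a) d (insert ⊥ (ρ.map (coneEmb W)))) (rename (coneEmb W) g)
  have h1 : ∑ σ ∈ G with σ.card = d, ∑ v ∈ σ, T (σ.erase v) =
      ∑ ρ ∈ G with ρ.card + 1 = d, ∑ σ ∈ cofacets G ρ, T ρ := by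
    rw [sum_sigma', sum_sigma']
    refine sum_bij (fun p _ => ⟨p.1.erase p.2, p.1⟩) ?_ ?_ ?_ ?_
    · rintro ⟨σ, v⟩ hp
      simp only [mem_sigma, mem_filter, mem_cofacets] at hp ⊢
      exact ⟨⟨h.down σ hp.1.1 _ (erase_subset _ _), by rw [card_erase_add_one hp.2, hp.1.2]⟩,
        hp.1.1, erase_subset _ _, (card_erase_add_one hp.2).symm⟩
    · rintro ⟨σ, v⟩ hp ⟨σ', v'⟩ hp' heq
      simp only [Sigma.mk.injEq, heq_eq_eq] at heq
      obtain ⟨h1, rfl⟩ := heq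
      rw [mem_sigma] at hp hp'
      have : v = v' := by
        by_contra hne
        have : v ∈ σ.erase v' := mem_erase.2 ⟨hne, hp.2⟩
        rw [← h1] at this
        simp at this
      rw [this]
    · rintro ⟨ρ, σ⟩ hp
      simp only [mem_sigma, mem_filter, mem_cofacets] at hp
      obtain ⟨x, hx, rfl⟩ := exists_eq_insert_of_cofacet hp.2.2.1 hp.2.2.2
      refine ⟨⟨insert x ρ, x⟩, ?_, ?_⟩
      · simp only [mem_sigma, mem_filter]
        exact ⟨⟨hp.2.1, by rw [card_insert_of_notMem hx, hp.1.2]⟩, mem_insert_self _ _⟩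
      · simp only [erase_insert hx]
    · intros; rfl
  rw [h1]
  refine sum_eq_zero fun ρ hρ => ?_
  rw [mem_filter] at hρ
  have h2 := h.even ρ hρ.1 hρ.2
  have h3 : ∑ σ ∈ cofacets G ρ, T ρ = bdry G (1 : Finset W → K) ρ * T ρ := by
    simp [bdry]
  rw [h3, h2, zero_mul]

lemma degreeMap_eq_zero_of_mem_nonfaceIdeal (h : IsModTwoSphere K G d) (ha : IsGeneric a d)
    {f : MvPolynomial W K} (hf : f ∈ nonfaceIdeal K G) : degreeMap G a d f = 0 := by
  rw [degreeMap_apply]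
  refine sum_eq_zero fun σ hσ => ?_
  rw [mem_filter] at hσ
  rw [eval_eq, sum_eq_zero, mul_zero]
  intro m hm
  have h1 := (mem_nonfaceIdeal h.down).1 hf m hm
  obtain ⟨v, hv, hvσ⟩ := not_subset.1 fun hsub => h1 (h.down σ hσ.1 _ hsub)
  rw [prod_eq_zero hv, mul_zero]
  rw [(isSolution_point hσ.2 (ha.colDet_ne_zero hσ.2)).1 v hvσ,
    zero_pow (Finsupp.mem_support_iff.1 hv)]

variable [Fintype W]

lemma eval_point_linForm (ha : IsGeneric a d) {σ : Finset W} (hσ : σ.card = d) {r : ℕ}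
    (hr : r < d) : eval (point a d σ) (linForm a r) = if r + 1 = d then 1 else 0 := by
  have h1 := isSolution_point hσ (ha.colDet_ne_zero hσ)
  rw [← h1.2 r hr, linForm, map_sum]
  simp only [map_mul, eval_C, eval_X]
  refine (sum_subset (subset_univ σ) fun v _ hv => ?_).symm
  rw [h1.1 v hv, mul_zero]

/-- At every point the forms but the last vanish, and the last equals 1, leaving the degree map of
something of degree d - 1. The component of degree d is singled out because the degree map is not
homogeneous. -/
lemma degreeMap_homogeneousComponent_mul_linForm (h : IsModTwoSphere K G d) (ha : IsGeneric a d)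
    (hd : 2 ≤ d) {r : ℕ} (hr : r < d) (g : MvPolynomial W K) :
    degreeMap G a d (homogeneousComponent d (g * linForm a r)) = 0 := by
  induction g using MvPolynomial.induction_on' with
  | add p q hp hq => rw [add_mul, map_add, map_add, hp, hq, add_zero]
  | monomial m c =>
    have hhom : (monomial m c * linForm a r).IsHomogeneous (m.degree + 1) :=
      (isHomogeneous_monomial c rfl).mul (linForm_isHomogeneous r)
    rw [homogeneousComponent_of_mem hhom]
    split_ifs with hm
    · have h1 : degreeMap G a d (monomial m c * linForm a r) =
          (if r + 1 = d then 1 else 0) * degreeMap G a d (monomial m c) := by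
        rw [degreeMap_apply, degreeMap_apply, mul_sum]
        refine sum_congr rfl fun σ hσ => ?_
        rw [map_mul, eval_point_linForm ha (mem_filter.1 hσ).2 hr]
        ring
      rw [h1, degreeMap_eq_zero_of_totalDegree_lt h ha hd, mul_zero]
      refine lt_of_le_of_lt (isHomogeneous_monomial c rfl).totalDegree_le ?_
      omega
    · rw [map_zero]

lemma degreeMap_eq_zero_of_mem_artinIdeal (h : IsModTwoSphere K G d) (ha : IsGeneric a d)
    (hd : 2 ≤ d) {f : MvPolynomial W K} (hf : f.IsHomogeneous d) (hfJ : f ∈ artinIdeal G a d) :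
    degreeMap G a d f = 0 := by
  obtain ⟨x, hx, y, hy, rfl⟩ := Submodule.mem_sup.1 hfJ
  have h1 : homogeneousComponent d (x + y) = x + y := by
    rw [homogeneousComponent_of_mem hf, if_pos rfl]
  rw [← h1, map_add, map_add, degreeMap_eq_zero_of_mem_nonfaceIdeal h ha, zero_add]
  · have h2 : ∀ w ∈ formIdeal a d, ∀ g, degreeMap G a d (homogeneousComponent d (g * w)) = 0 := by
      intro w hw
      induction hw using Submodule.span_induction with
      | mem w hw =>
        obtain ⟨r, hr, rfl⟩ := hw
        exact degreeMap_homogeneousComponent_mul_linForm h ha hd hr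
      | zero => intro g; simp
      | add w w' _ _ hw hw' => intro g; rw [mul_add, map_add, map_add, hw, hw', add_zero]
      | smul p w _ hw => intro g; rw [smul_eq_mul, ← mul_assoc]; exact hw _
    rw [← h2 y hy 1, one_mul]
  · refine (mem_nonfaceIdeal h.down).2 fun m hm => (mem_nonfaceIdeal h.down).1 hx m ?_
    rw [mem_support_iff, coeff_homogeneousComponent] at hm
    rw [mem_support_iff]
    exact fun h0 => hm (by rw [h0, ite_self])

/-- Degree d is at most one-dimensional, and the monomial of a facet has nonzero degree because only
its own facet contributes. -/
lemma mem_artinIdeal_of_degreeMap_eq_zero (h : IsModTwoSphere K G d) (ha : IsGeneric a d)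
    (hd : 2 ≤ d) {f : MvPolynomial W K} (hf : f.IsHomogeneous d) (hf0 : degreeMap G a d f = 0) :
    f ∈ artinIdeal G a d := by
  obtain ⟨σ, hσ, -, hσd⟩ := h.exists_facet h.empty_mem
  set g : MvPolynomial W K := ∏ v ∈ σ, X v with hgdef
  have hg : g.IsHomogeneous d := by
    have := IsHomogeneous.prod σ (fun v => (X v : MvPolynomial W K)) (fun _ => 1)
      fun v _ => isHomogeneous_X K v
    simpa [hσd] using this
  have hg0 : degreeMap G a d g ≠ 0 := by
    rw [degreeMap_apply, sum_eq_single_of_mem σ (mem_filter.2 ⟨hσ, hσd⟩)]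
    · have hp : ∏ v ∈ σ, point a d σ v ≠ 0 := prod_ne_zero_iff.2 fun v hv => ha.point_ne_zero hσd hv
      rw [hgdef, map_prod]
      simp only [eval_X]
      exact mul_ne_zero (inv_ne_zero (mul_ne_zero (ha.colDet_ne_zero hσd) hp)) hp
    · intro τ hτ hτσ
      rw [mem_filter] at hτ
      obtain ⟨v, hv, hvτ⟩ := not_subset.1 fun hsub : σ ⊆ τ =>
        hτσ (eq_of_subset_of_card_le hsub (by omega)).symm
      rw [hgdef, map_prod, prod_eq_zero hv, mul_zero]
      rw [eval_X, (isSolution_point hτ.2 (ha.colDet_ne_zero hτ.2)).1 v hvτ]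
  obtain ⟨x, y, hxy, hmem⟩ := exists_combination_mem_artinIdeal h ha hf hg
  have h1 := degreeMap_eq_zero_of_mem_artinIdeal h ha hd (by
    have := ((isHomogeneous_C W x).mul hf).add ((isHomogeneous_C W y).mul hg)
    simpa using this) hmem
  rw [map_add, ← smul_eq_C_mul, ← smul_eq_C_mul, map_smul, map_smul, hf0, smul_zero, zero_add,
    smul_eq_mul, mul_eq_zero, or_iff_left hg0] at h1
  have hx : x ≠ 0 := hxy.resolve_right (not_not.2 h1)
  rw [h1, map_zero, zero_mul, add_zero] at hmem
  have h2 := Ideal.mul_mem_left _ (C x⁻¹) hmem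
  rwa [← mul_assoc, ← map_mul, inv_mul_cancel₀ hx, map_one, one_mul] at h2

end DegreeMap

/-! ### Iterated derivations in characteristic two -/

section Derivations

variable {K : Type*} [Field K]

/-- Applies the first `n` maps of the sequence `D`, beginning with `D 0`. -/
def iterDer (D : ℕ → Derivation ℤ K K) : ℕ → K → K
  | 0, x => x
  | n + 1, x => iterDer (fun i => D (i + 1)) n (D 0 x)

lemma iterDer_zero_right (D : ℕ → Derivation ℤ K K) (n : ℕ) : iterDer D n 0 = 0 := by
  induction n generalizing D with
  | zero => rfl
  | succ n ih => rw [iterDer, map_zero, ih]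

lemma iterDer_add (D : ℕ → Derivation ℤ K K) (n : ℕ) (x y : K) :
    iterDer D n (x + y) = iterDer D n x + iterDer D n y := by
  induction n generalizing D x y with
  | zero => rfl
  | succ n ih => rw [iterDer, map_add, ih, iterDer, iterDer]

lemma iterDer_sum {ι : Type*} (D : ℕ → Derivation ℤ K K) (n : ℕ) (s : Finset ι) (f : ι → K) :
    iterDer D n (∑ i ∈ s, f i) = ∑ i ∈ s, iterDer D n (f i) := by
  classical
  induction s using Finset.induction_on with
  | empty => simp [iterDer_zero_right]
  | insert i s hi ih => rw [sum_insert hi, sum_insert hi, iterDer_add, ih]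

lemma der_const_mul {D : Derivation ℤ K K} {c : K} (hc : D c = 0) (x : K) :
    D (c * x) = c * D x := by
  rw [D.leibniz, hc, smul_zero, add_zero, smul_eq_mul]

lemma iterDer_const_mul {D : ℕ → Derivation ℤ K K} {n : ℕ} {c : K} (hc : ∀ i < n, D i c = 0)
    (x : K) : iterDer D n (c * x) = c * iterDer D n x := by
  induction n generalizing D x with
  | zero => rfl
  | succ n ih =>
    rw [iterDer, iterDer, der_const_mul (hc 0 n.succ_pos), ih fun i hi => hc _ (by omega)]

lemma iterDer_eq_zero {D : ℕ → Derivation ℤ K K} (hcomm : ∀ i j x, D i (D j x) = D j (D i x))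
    {n i : ℕ} (hi : i < n) {x : K} (hx : D i x = 0) : iterDer D n x = 0 := by
  induction n generalizing D i x with
  | zero => omega
  | succ n ih =>
    rw [iterDer]
    cases i with
    | zero => rw [hx, iterDer_zero_right]
    | succ i =>
      exact ih (D := fun i => D (i + 1)) (i := i) (fun i j x => hcomm _ _ x) (by omega)
        (by rw [hcomm, hx, map_zero])

lemma der_prod {ι : Type*} (D : Derivation ℤ K K) {s : Finset ι} {f : ι → K}
    (hf : ∀ i ∈ s, f i ≠ 0) : D (∏ i ∈ s, f i) = (∏ i ∈ s, f i) * ∑ i ∈ s, D (f i) / f i := by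
  classical
  induction s using Finset.induction_on with
  | empty => simp
  | insert i s hi ih =>
    have h0 := hf i (mem_insert_self i s)
    rw [prod_insert hi, sum_insert hi, D.leibniz, ih fun j hj => hf j (mem_insert_of_mem hj)]
    simp only [smul_eq_mul]
    field_simp
    ring

lemma der_prod_eq_zero {ι : Type*} {D : Derivation ℤ K K} {s : Finset ι} {f : ι → K}
    (hf : ∀ i ∈ s, D (f i) = 0) : D (∏ i ∈ s, f i) = 0 := by
  classical
  induction s using Finset.induction_on with
  | empty => simp
  | insert i s hi ih =>
    rw [prod_insert hi, D.leibniz, ih fun j hj => hf j (mem_insert_of_mem hj),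
      hf i (mem_insert_self i s), smul_zero, smul_zero, add_zero]

lemma der_det_eq_zero {m : Type*} [Fintype m] [DecidableEq m] {D : Derivation ℤ K K}
    {M : Matrix m m K} (hM : ∀ i j, D (M i j) = 0) : D M.det = 0 := by
  rw [Matrix.det_apply', map_sum]
  refine sum_eq_zero fun σ _ => ?_
  rw [D.leibniz, der_prod_eq_zero fun i _ => hM _ _, smul_zero, zero_add]
  have : D ((((Equiv.Perm.sign σ : ℤˣ) : ℤ) : K)) = 0 := by
    rw [← mul_one (((Equiv.Perm.sign σ : ℤˣ) : ℤ) : K), ← zsmul_eq_mul, map_zsmul,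
      D.map_one_eq_zero, smul_zero]
  rw [this, smul_zero]

variable [CharP K 2]

lemma der_sq (D : Derivation ℤ K K) (x : K) : D (x ^ 2) = 0 := by
  rw [pow_two, D.leibniz, CharTwo.add_self_eq_zero]

lemma der_inv (D : Derivation ℤ K K) (x : K) : D x⁻¹ = (x⁻¹) ^ 2 * D x := by
  rw [D.leibniz_inv, CharTwo.neg_eq, smul_eq_mul]

/-- Derivations with constant values on the factors turn a product into a determinant. -/
lemma iterDer_prod_eq_det {D : ℕ → Derivation ℤ K K} {n : ℕ} {f : Fin n → K} (hf : ∀ i, f i ≠ 0)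
    (hD : ∀ r < n, ∀ s < n, ∀ i, D s (D r (f i)) = 0) :
    iterDer D n (∏ i, f i) = (Matrix.of fun r i : Fin n => D r (f i)).det := by
  induction n generalizing D with
  | zero => simp [iterDer]
  | succ n ih =>
    have h1 : D 0 (∏ i, f i) = ∑ i, D 0 (f i) * ∏ l, f (i.succAbove l) := by
      rw [der_prod _ fun i _ => hf i, mul_sum]
      refine sum_congr rfl fun i _ => ?_
      rw [Fin.prod_univ_succAbove f i]
      field_simp [hf i]
    rw [iterDer, h1, iterDer_sum, Matrix.det_succ_row_zero]
    refine sum_congr rfl fun i _ => ?_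
    rw [iterDer_const_mul fun s hs => hD 0 (by omega) _ (by omega) i,
      ih (fun l => hf _) fun r hr s hs l => hD _ (by omega) _ (by omega) _, CharTwo.neg_eq,
      one_pow, one_mul]
    rfl

end Derivations

/-! ### Derivatives of the weight of a single facet -/

section Simplex

variable {K : Type*} [Field K] [CharP K 2] {n : ℕ}
  {A : Matrix (Fin n) (Fin n) K} {D : Fin n → Fin n → Derivation ℤ K K} {x t : Fin n → K}

lemma der_det (hD : ∀ r j s k, D r j (A s k) = if r = s ∧ j = k then 1 else 0)
    (hA : A.det ≠ 0) (r j : Fin n) : D r j A.det = A.det * A⁻¹ j r := by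
  have h1 : ∀ k, D r j (A.adjugate j k) = 0 := fun k => by
    have h2 : A.adjugate j k = (A.transpose.updateRow j (Pi.single k 1)).det := by
      rw [← Matrix.adjugate_apply, ← Matrix.adjugate_transpose]
      rfl
    rw [h2]
    refine der_det_eq_zero fun i l => ?_
    rw [Matrix.updateRow_apply]
    split_ifs with hi
    · by_cases hl : l = k
      · simp [hl]
      · simp [Pi.single_eq_of_ne hl]
    · rw [Matrix.transpose_apply, hD, if_neg fun h => hi h.2.symm]
  have h2 : A.det * A⁻¹ j r = A.adjugate j r := by
    rw [Matrix.inv_def, Matrix.smul_apply, Ring.inverse_eq_inv', smul_eq_mul,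
      mul_inv_cancel_left₀ hA]
  rw [h2]
  nth_rewrite 1 [A.det_eq_sum_mul_adjugate_col j]
  rw [map_sum, sum_eq_single_of_mem r (mem_univ r)]
  · rw [(D r j).leibniz, h1, hD, if_pos ⟨rfl, rfl⟩]
    simp
  · intro s _ hs
    rw [(D r j).leibniz, h1, hD, if_neg fun h => hs h.1.symm]
    simp

lemma mul_inv_apply_eq (hA : A.det ≠ 0) {y z : Fin n → K} (h : ∀ s, ∑ k, A s k * y k = z s)
    (i : Fin n) : y i = ∑ s, A⁻¹ i s * z s := by
  have h1 : A⁻¹.mulVec (A.mulVec y) = y := by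
    rw [Matrix.mulVec_mulVec, Matrix.nonsing_inv_mul A hA.isUnit, Matrix.one_mulVec]
  have h2 : A.mulVec y = z := funext h
  rw [h2] at h1
  exact (congrFun h1 i).symm

/-- Differentiating A x = t shows that A maps the derivative of x to x_j times a unit vector; the
sign disappears in characteristic 2. -/
lemma der_solution (hD : ∀ r j s k, D r j (A s k) = if r = s ∧ j = k then 1 else 0)
    (hA : A.det ≠ 0) (hx : ∀ s, ∑ k, A s k * x k = t s) (ht : ∀ r j s, D r j (t s) = 0)
    (r j i : Fin n) : D r j (x i) = A⁻¹ i r * x j := by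
  have h1 : ∀ s, ∑ k, A s k * D r j (x k) = if r = s then x j else 0 := fun s => by
    have h2 := congrArg (D r j) (hx s)
    simp only [map_sum, ht, Derivation.leibniz, hD, smul_eq_mul, mul_ite, mul_one, mul_zero,
      sum_add_distrib] at h2
    rw [CharTwo.add_eq_zero.1 h2]
    by_cases h : r = s
    · simp [h]
    · simp [h]
  rw [mul_inv_apply_eq hA h1 i]
  simp

lemma der_inv_apply (hD : ∀ r j s k, D r j (A s k) = if r = s ∧ j = k then 1 else 0)
    (hA : A.det ≠ 0) (r j i s : Fin n) : D r j (A⁻¹ i s) = A⁻¹ i r * A⁻¹ j s := by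
  refine der_solution (x := fun i => A⁻¹ i s) (t := fun k => (1 : Matrix (Fin n) (Fin n) K) k s) hD
    hA (fun k => ?_) (fun r j k => ?_) r j i
  · rw [← Matrix.mul_nonsing_inv A hA.isUnit]
    rfl
  · rw [Matrix.one_apply]
    split_ifs
    · exact Derivation.map_one_eq_zero _
    · exact map_zero _

/-- The second derivatives along one column of the denominator of a weight. -/
lemma der_der_det_mul_prod (hD : ∀ r j s k, D r j (A s k) = if r = s ∧ j = k then 1 else 0)
    (hA : A.det ≠ 0) (hx : ∀ s, ∑ k, A s k * x k = t s) (ht : ∀ r j s, D r j (t s) = 0)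
    (hx0 : ∀ i, x i ≠ 0) (r s : Fin n) : ∃ l : K, ∀ j,
    D s j (D r j (A.det * ∏ i, x i)) = (x j) ^ 2 * l := by
  set L : Fin n → K := fun r => ∑ i, A⁻¹ i r * (x i)⁻¹ with hL
  have h1 : ∀ r j, D r j (A.det * ∏ i, x i) =
      (A.det * ∏ i, x i) * (A⁻¹ j r + x j * L r) := fun r j => by
    rw [(D r j).leibniz, der_det hD hA, der_prod _ fun i _ => hx0 i]
    have : ∑ i, D r j (x i) / x i = x j * L r := by
      rw [hL, mul_sum]
      exact sum_congr rfl fun i _ => by rw [der_solution hD hA hx ht]; ring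
    rw [this, smul_eq_mul, smul_eq_mul]
    ring
  have h2 : ∀ j, D s j (L r) = A⁻¹ j r * L s +
      x j * ∑ i, A⁻¹ i r * A⁻¹ i s * (x i)⁻¹ ^ 2 := fun j => by
    simp only [hL, map_sum, mul_sum]
    rw [← sum_add_distrib]
    refine sum_congr rfl fun i _ => ?_
    rw [(D s j).leibniz, der_inv, der_inv_apply hD hA, der_solution hD hA hx ht]
    simp only [smul_eq_mul]
    ring
  refine ⟨(A.det * ∏ i, x i) * (L s * L r + ∑ i, A⁻¹ i r * A⁻¹ i s * (x i)⁻¹ ^ 2), fun j => ?_⟩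
  rw [h1, (D s j).leibniz, h1, map_add, (D s j).leibniz (x j), h2, der_solution hD hA hx ht,
    der_inv_apply hD hA]
  simp only [smul_eq_mul]
  linear_combination ((A.det * ∏ i, x i) * (A⁻¹ j s * A⁻¹ j r + x j * A⁻¹ j r * L s +
    x j * A⁻¹ j s * L r)) * CharTwo.two_eq_zero (R := K)

lemma det_updateRow_smul_one (c : K) (j : Fin n) (y : Fin n → K) :
    ((c • (1 : Matrix (Fin n) (Fin n) K)).updateRow j y).det = c ^ (n - 1) * y j := by
  rw [← Matrix.cramer_transpose_apply, Matrix.transpose_smul, Matrix.transpose_one,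
    Matrix.cramer_smul, Matrix.cramer_one]
  simp

/-- The derivatives along one column of the denominator of a weight. -/
lemma iterDer_det_mul_prod (hD : ∀ r j s k, D r j (A s k) = if r = s ∧ j = k then 1 else 0)
    (hA : A.det ≠ 0) (hx : ∀ s, ∑ k, A s k * x k = t s) (ht : ∀ r j s, D r j (t s) = 0)
    (hx0 : ∀ i, x i ≠ 0) (hn : Even n) (j : Fin n) {E : ℕ → Derivation ℤ K K}
    (hE : ∀ r : Fin n, E r = D r j) : iterDer E n (A.det * ∏ i, x i) = x j ^ n := by
  -- By Cramer's rule the factors det A and det A · x_i, i ≠ j, have degree at most one in the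
  -- entries of column j, so all their second derivatives along it vanish. The surplus det A^n is a
  -- square because n is even.
  set f : Fin n → K := fun i => A.det * Function.update x j 1 i with hf
  have hf0 : ∀ i, f i ≠ 0 := fun i => by
    refine mul_ne_zero hA ?_
    by_cases hi : i = j
    · simp [hi]
    · rw [Function.update_of_ne hi]
      exact hx0 i
  have hprod : A.det * ∏ i, x i = A.det * x j * ((A.det)⁻¹ ^ n * ∏ i, f i) := by
    rw [hf, prod_mul_distrib, prod_update_of_mem (mem_univ j), one_mul, prod_const, card_univ,
      Fintype.card_fin, ← mul_assoc (A.det⁻¹ ^ n), ← mul_pow, inv_mul_cancel₀ hA, one_pow, one_mul,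
      ← erase_eq, mul_assoc, mul_prod_erase univ x (mem_univ j)]
  have hc1 : ∀ r, D r j (A.det * x j) = 0 := fun r => by
    rw [(D r j).leibniz, der_det hD hA, der_solution hD hA hx ht, smul_eq_mul, smul_eq_mul]
    linear_combination (A.det * A⁻¹ j r * x j) * CharTwo.two_eq_zero (R := K)
  have hc2 : ∀ r, D r j (A.det⁻¹ ^ n) = 0 := fun r => by
    obtain ⟨k, hk⟩ := hn
    have h : A.det⁻¹ ^ n = (A.det⁻¹ ^ k) ^ 2 := by
      rw [← pow_mul]
      congr 1
      omega
    rw [h]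
    exact der_sq _ _
  have hc3 : ∀ s r, D s j (A.det * A⁻¹ j r) = 0 := fun s r => by
    rw [(D s j).leibniz, der_det hD hA, der_inv_apply hD hA, smul_eq_mul, smul_eq_mul]
    linear_combination (A.det * A⁻¹ j r * A⁻¹ j s) * CharTwo.two_eq_zero (R := K)
  have hfj : f j = A.det := by simp [hf]
  have hfi : ∀ i, i ≠ j → f i = A.det * x i := fun i hi => by
    simp only [hf]
    rw [Function.update_of_ne hi]
  have hdj : ∀ r, D r j (f j) = A.det * A⁻¹ j r := fun r => by rw [hfj, der_det hD hA]
  have hdi : ∀ r i, i ≠ j → D r j (f i) =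
      A.det * A⁻¹ j r * x i + A.det * x j * A⁻¹ i r := fun r i hi => by
    rw [hfi i hi, (D r j).leibniz, der_det hD hA, der_solution hD hA hx ht, smul_eq_mul,
      smul_eq_mul]
    ring
  have hsecond : ∀ r s i, D s j (D r j (f i)) = 0 := fun r s i => by
    by_cases hi : i = j
    · rw [hi, hdj, hc3]
    · rw [hdi r i hi, map_add, der_const_mul (hc3 s r), der_const_mul (hc1 s),
        der_solution hD hA hx ht, der_inv_apply hD hA]
      linear_combination (A.det * x j * A⁻¹ i s * A⁻¹ j r) * CharTwo.two_eq_zero (R := K)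
  have hE' : ∀ r < n, ∃ r', E r = D r' j := fun r hr => ⟨⟨r, hr⟩, hE ⟨r, hr⟩⟩
  have hconst : ∀ c, (∀ r, D r j c = 0) → ∀ r < n, E r c = 0 := fun c hc r hr => by
    obtain ⟨r', h⟩ := hE' r hr
    rw [h, hc]
  rw [hprod, iterDer_const_mul (hconst _ hc1), iterDer_const_mul (hconst _ hc2),
    iterDer_prod_eq_det hf0 fun r hr s hs i => by
      obtain ⟨r', h⟩ := hE' r hr
      obtain ⟨s', h'⟩ := hE' s hs
      rw [h, h', hsecond]]
  -- Row j of the second factor collects the derivatives of det A; the other rows collect those of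
  -- the x_i.
  have hM : (Matrix.of fun r i : Fin n => E r (f i)) = A.det • (A⁻¹.transpose *
      (x j • (1 : Matrix (Fin n) (Fin n) K)).updateRow j (Function.update x j 1)) := by
    ext r i
    rw [Matrix.of_apply, hE, Matrix.smul_apply, Matrix.mul_apply,
      ← add_sum_erase univ _ (mem_univ j), Matrix.updateRow_self]
    have h1 : ∑ k ∈ univ.erase j, A⁻¹.transpose r k * (x j • (1 : Matrix (Fin n) (Fin n) K)).updateRow
        j (Function.update x j 1) k i = if i = j then 0 else A⁻¹ i r * x j := by
      rw [sum_congr rfl fun k hk => by rw [Matrix.updateRow_ne (ne_of_mem_erase hk)]]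
      by_cases hi : i = j
      · rw [if_pos hi]
        refine sum_eq_zero fun k hk => ?_
        rw [Matrix.smul_apply, Matrix.one_apply_ne (hi ▸ ne_of_mem_erase hk), smul_zero, mul_zero]
      · rw [if_neg hi, sum_eq_single_of_mem i (mem_erase.2 ⟨hi, mem_univ i⟩)]
        · simp
        · intro k _ hk
          rw [Matrix.smul_apply, Matrix.one_apply_ne hk, smul_zero, mul_zero]
    rw [h1, Matrix.transpose_apply]
    by_cases hi : i = j
    · rw [hi, hdj]
      simp
    · rw [hdi r i hi, if_neg hi, Function.update_of_ne hi, smul_eq_mul]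
      ring
  have hdet : A.det * A⁻¹.det = 1 := by
    rw [← Matrix.det_mul, Matrix.mul_nonsing_inv A hA.isUnit, Matrix.det_one]
  rw [hM, Matrix.det_smul, Matrix.det_mul, Matrix.det_transpose, det_updateRow_smul_one,
    Function.update_self, Fintype.card_fin, mul_one]
  obtain ⟨k, rfl⟩ : ∃ k, n = k + 1 := ⟨n - 1, by have := j.2; omega⟩
  rw [Nat.add_sub_cancel, pow_succ (x j), ← mul_assoc (A.det⁻¹ ^ (k + 1)), ← mul_pow,
    inv_mul_cancel₀ hA, one_pow, one_mul]
  linear_combination (x j * x j ^ k) * hdet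

end Simplex

/-! ### Paired derivatives: rows 2k and 2k + 1 in a common column -/

section Pairs

variable {U K : Type*} [Field K] [CharP K 2] {D : ℕ → U → Derivation ℤ K K}

lemma iterDer_two_mul_succ (D : ℕ → U → Derivation ℤ K K) (J : ℕ → U) (m : ℕ) (y : K) :
    iterDer (fun r => D r (J (r / 2))) (2 * (m + 1)) y =
      iterDer (fun r => D (r + 2) (J (r / 2 + 1))) (2 * m) (D 1 (J 0) (D 0 (J 0) y)) := by
  have h : (fun r => D (r + 1 + 1) (J ((r + 1 + 1) / 2))) =
      fun r => D (r + 2) (J (r / 2 + 1)) := by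
    funext r
    rw [show (r + 1 + 1) / 2 = r / 2 + 1 by omega]
  rw [← h]
  rfl

/-- The column chosen for a pair enters only through the factor p(v)², which later derivations treat
as a constant. Hence one choice of columns determines the result for all others. -/
lemma iterDer_pairs_mul (hcomm : ∀ r v s w x, D r v (D s w x) = D s w (D r v x)) {s : Finset U}
    {p : U → K} {m : ℕ} {y : K}
    (hy : ∀ k < m, ∃ l, ∀ v ∈ s, D (2 * k + 1) v (D (2 * k) v y) = p v ^ 2 * l) {J J' : ℕ → U}
    (hJ : ∀ k < m, J k ∈ s) (hJ' : ∀ k < m, J' k ∈ s) :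
    iterDer (fun r => D r (J (r / 2))) (2 * m) y * ∏ k ∈ range m, p (J' k) ^ 2 =
      iterDer (fun r => D r (J' (r / 2))) (2 * m) y * ∏ k ∈ range m, p (J k) ^ 2 := by
  induction m generalizing D y J J' with
  | zero => simp [iterDer]
  | succ m ih =>
    obtain ⟨l₀, hl₀⟩ := hy 0 m.succ_pos
    have h1 := ih (D := fun r => D (r + 2)) (y := D 1 (J 0) (D 0 (J 0) y))
      (J := fun k => J (k + 1)) (J' := fun k => J' (k + 1))
      (fun r v s w x => hcomm _ _ _ _ _) (fun k hk => by
        obtain ⟨l, hl⟩ := hy (k + 1) (by omega)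
        refine ⟨D 1 (J 0) (D 0 (J 0) l), fun v hv => ?_⟩
        rw [← der_const_mul (der_sq _ _), ← der_const_mul (der_sq _ _), ← hl v hv,
          hcomm (2 * k + 2), hcomm (2 * k + 2), hcomm (2 * k + 1 + 2), hcomm (2 * k + 1 + 2)]
        rfl) (fun k hk => hJ _ (by omega)) fun k hk => hJ' _ (by omega)
    have h2 : ∀ v ∈ s, iterDer (fun r => D (r + 2) (J' (r / 2 + 1))) (2 * m) (D 1 v (D 0 v y)) =
        p v ^ 2 * iterDer (fun r => D (r + 2) (J' (r / 2 + 1))) (2 * m) l₀ := fun v hv => by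
      have h3 : D 1 v (D 0 v y) = p v ^ 2 * l₀ := hl₀ v hv
      rw [h3, iterDer_const_mul fun i _ => der_sq _ _]
    rw [iterDer_two_mul_succ, iterDer_two_mul_succ, prod_range_succ', prod_range_succ', ← mul_assoc,
      h1, h2 _ (hJ 0 m.succ_pos), h2 _ (hJ' 0 m.succ_pos)]
    ring

variable [LinearOrder U] {a : ℕ → U → K} {d : ℕ}

/-- The derivatives of the denominator of a weight are squares. -/
lemma iterDer_colDet_mul_prod (hcomm : ∀ r v s w x, D r v (D s w x) = D s w (D r v x))
    (hD : ∀ r < d, ∀ s < d, ∀ v w, D r v (a s w) = if r = s ∧ v = w then 1 else 0) {m : ℕ}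
    (hm : d = 2 * m) {s : Finset U} (hs : s.card = d) (hdet : colDet a d s ≠ 0)
    (hpt : ∀ v ∈ s, point a d s v ≠ 0) (J : ℕ → U) :
    iterDer (fun r => D r (J (r / 2))) (2 * m) (colDet a d s * ∏ v ∈ s, point a d s v) =
      (∏ k ∈ range m, point a d s (J k)) ^ 2 := by
  set e := s.orderEmbOfFin hs with he
  set A : Matrix (Fin d) (Fin d) K := Matrix.of fun r k => a r (e k) with hAdef
  have hsol := isSolution_point hs hdet
  have hdetA : colDet a d s = A.det := by rw [colDet, dif_pos hs]
  have hprodA : ∏ v ∈ s, point a d s v = ∏ k, point a d s (e k) := by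
    nth_rewrite 1 [← s.map_orderEmbOfFin_univ hs]
    rw [prod_map]
    rfl
  rw [hdetA] at hdet
  have hDA : ∀ r j i k : Fin d, D r (e j) (A i k) = if r = i ∧ j = k then 1 else 0 := by
    intro r j i k
    rw [hAdef, Matrix.of_apply, hD r r.2 i i.2]
    simp only [Fin.val_inj, e.injective.eq_iff]
  set x : Fin d → K := fun k => point a d s (e k) with hx
  set t : Fin d → K := fun r => if (r : ℕ) + 1 = d then 1 else 0 with ht
  have hDt : ∀ (D : Derivation ℤ K K) r, D (t r) = 0 := fun D r => by
    simp only [ht]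
    split_ifs
    · exact D.map_one_eq_zero
    · exact map_zero _
  have hAx : ∀ r, ∑ k, A r k * x k = t r := fun r => by
    have := hsol.2 r r.2
    rwa [sum_eq_sum_orderEmbOfFin hs] at this
  have hx0 : ∀ i, x i ≠ 0 := fun i => hpt _ (orderEmbOfFin_mem s hs i)
  by_cases hJ : ∀ k < m, J k ∈ s
  · rcases Nat.eq_zero_or_pos m with h0 | h0
    · subst h0
      have hd0 : s = ∅ := by rw [← card_eq_zero, hs, hm]
      have : IsEmpty (Fin d) := by rw [hm]; exact Fin.isEmpty
      rw [hdetA, hd0]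
      simp [iterDer, Matrix.det_isEmpty]
    -- The comparison is with one constant column, where the full iterated derivative is known.
    obtain ⟨j₀, hj₀⟩ := exists_orderEmbOfFin_eq hs (hJ 0 h0)
    have h1 := iterDer_pairs_mul (m := m) (y := colDet a d s * ∏ v ∈ s, point a d s v) hcomm
      (p := point a d s) (fun k hk => by
        obtain ⟨l, hl⟩ := der_der_det_mul_prod (D := fun r j => D r (e j)) (t := t) hDA hdet hAx
          (fun _ _ _ => hDt _ _) hx0 ⟨2 * k, by omega⟩ ⟨2 * k + 1, by omega⟩
        refine ⟨l, fun v hv => ?_⟩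
        obtain ⟨j, rfl⟩ := exists_orderEmbOfFin_eq hs hv
        rw [hdetA, hprodA]
        exact hl j) hJ (J' := fun _ => e j₀) fun k _ => orderEmbOfFin_mem s hs j₀
    have h2 := iterDer_det_mul_prod (D := fun r j => D r (e j)) (t := t) hDA hdet hAx
          (fun _ _ _ => hDt _ _) hx0 (hm ▸ even_two_mul m) j₀ (E := fun r => D r (e j₀)) fun _ => rfl
    rw [hdetA, hprodA] at h1 ⊢
    rw [← hm] at h1 ⊢
    rw [h2, prod_const, card_range, ← pow_mul, ← hm, mul_comm] at h1
    rw [mul_left_cancel₀ (pow_ne_zero d (hx0 j₀)) h1, prod_pow]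
  -- A column outside the facet does not occur in its data, so the derivative vanishes, as does the
  -- corresponding coordinate on the right.
  · push Not at hJ
    obtain ⟨k, hk, hks⟩ := hJ
    have h1 : ∀ r < d, ∀ v ∉ s, D r v (colDet a d s * ∏ v ∈ s, point a d s v) = 0 := by
      intro r hr v hv
      have hev : ∀ i, v ≠ e i := fun i h => hv (h ▸ orderEmbOfFin_mem s hs i)
      have hA0 : ∀ i k, D r v (A i k) = 0 := fun i k => by
        rw [hAdef, Matrix.of_apply, hD r hr i i.2, if_neg fun h => hev k h.2]
      have hx1 : ∀ i, D r v (x i) = 0 := by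
        have h2 : ∀ i, ∑ k, A i k * D r v (x k) = 0 := fun i => by
          have h3 := congrArg (D r v) (hAx i)
          rw [map_sum, hDt] at h3
          rw [← h3]
          exact sum_congr rfl fun k _ => (der_const_mul (hA0 i k) _).symm
        intro i
        rw [mul_inv_apply_eq hdet h2 i]
        simp
      rw [hdetA, hprodA, (D r v).leibniz, der_det_eq_zero hA0, der_prod_eq_zero fun i _ => hx1 i,
        smul_zero, smul_zero, add_zero]
    rw [prod_eq_zero (mem_range.2 hk) (hsol.1 _ hks), zero_pow two_ne_zero]
    refine iterDer_eq_zero (i := 2 * k) (fun i j x => hcomm _ _ _ _ _) (by omega) ?_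
    rw [Nat.mul_div_cancel_left _ two_pos]
    exact h1 _ (by omega) _ hks

lemma iterDer_weight (hcomm : ∀ r v s w x, D r v (D s w x) = D s w (D r v x))
    (hD : ∀ r < d, ∀ s < d, ∀ v w, D r v (a s w) = if r = s ∧ v = w then 1 else 0) {m : ℕ}
    (hm : d = 2 * m) {s : Finset U} (hs : s.card = d) (hdet : colDet a d s ≠ 0)
    (hpt : ∀ v ∈ s, point a d s v ≠ 0) (J : ℕ → U) :
    iterDer (fun r => D r (J (r / 2))) (2 * m) (weight a d s) =
      (weight a d s * ∏ k ∈ range m, point a d s (J k)) ^ 2 := by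
  have h0 : colDet a d s * ∏ v ∈ s, point a d s v ≠ 0 := mul_ne_zero hdet (prod_ne_zero_iff.2 hpt)
  -- Writing w = w² · w⁻¹ reduces to the denominator, since w² is constant for every derivation.
  have h1 : weight a d s = weight a d s ^ 2 * (colDet a d s * ∏ v ∈ s, point a d s v) := by
    rw [weight]
    field_simp
  nth_rewrite 1 [h1]
  rw [iterDer_const_mul fun i _ => der_sq _ _, iterDer_colDet_mul_prod hcomm hD hm hs hdet hpt,
    mul_pow]

end Pairs

/-! ### Extending derivations to the field of fractions by dual numbers -/

section FractionField

variable {R A K : Type*} [CommRing R] [CommRing A] [Algebra R A] [IsDomain A] [Field K] [Algebra A K]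
  [IsFractionRing A K]

variable (K) in
/-- The homomorphism to the dual numbers over the field of fractions given by a derivation. -/
def dualHom (D : Derivation R A A) :
    A →+* TrivSqZeroExt K K where
  toFun x := TrivSqZeroExt.inl (algebraMap A K x) + TrivSqZeroExt.inr (algebraMap A K (D x))
  map_one' := by ext <;> simp [-DualNumber.inr_eq_smul_eps]
  map_zero' := by ext <;> simp [-DualNumber.inr_eq_smul_eps]
  map_add' x y := by ext <;> simp [-DualNumber.inr_eq_smul_eps]
  map_mul' x y := by
    ext
    · simp
    · simp [-DualNumber.inr_eq_smul_eps]
      ring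

variable (K) in
/-- The extension of `dualHom` to the field of fractions. -/
noncomputable def dualHomLift (D : Derivation R A A) : K →+* TrivSqZeroExt K K :=
  IsLocalization.lift (M := nonZeroDivisors A) (g := dualHom K D) fun y => by
    rw [TrivSqZeroExt.isUnit_iff_isUnit_fst]
    simp [dualHom]

lemma dualHomLift_algebraMap (D : Derivation R A A) (x : A) :
    dualHomLift K D (algebraMap A K x) = dualHom K D x :=
  IsLocalization.lift_eq _ x

lemma fst_dualHomLift (D : Derivation R A A) (x : K) : (dualHomLift K D x).fst = x := by
  have h : ((TrivSqZeroExt.fstHom ℤ K K : TrivSqZeroExt K K →+* K).comp (dualHomLift K D)) =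
      RingHom.id K := by
    refine IsLocalization.ringHom_ext (nonZeroDivisors A) (RingHom.ext fun x => ?_)
    simp [dualHomLift_algebraMap, dualHom]
  exact congrArg (fun f : K →+* K => f x) h

variable (K) in
/-- The extension of a derivation to the field of fractions. -/
noncomputable def fractionDer (D : Derivation R A A) : Derivation ℤ K K :=
  Derivation.mk' (AddMonoidHom.toIntLinearMap
    { toFun := fun x => (dualHomLift K D x).snd
      map_zero' := by simp
      map_add' := by simp }) fun x y => by
    simp [fst_dualHomLift]
    ring

lemma fractionDer_algebraMap (D : Derivation R A A) (x : A) :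
    fractionDer K D (algebraMap A K x) = algebraMap A K (D x) := by
  change (dualHomLift K D (algebraMap A K x)).snd = _
  simp [dualHomLift_algebraMap, dualHom, -DualNumber.inr_eq_smul_eps]

/-- The commutator is a derivation vanishing on the ring, hence on all fractions. -/
lemma fractionDer_comm {D D' : Derivation R A A} (h : ∀ x, D (D' x) = D' (D x)) (x : K) :
    fractionDer K D (fractionDer K D' x) = fractionDer K D' (fractionDer K D x) := by
  rw [← sub_eq_zero, ← Derivation.commutator_apply]
  have h1 : ∀ y : A, ⁅fractionDer K D, fractionDer K D'⁆ (algebraMap A K y) = 0 := fun y => by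
    rw [Derivation.commutator_apply, fractionDer_algebraMap, fractionDer_algebraMap,
      fractionDer_algebraMap, fractionDer_algebraMap, h, sub_self]
  obtain ⟨y, z, -, rfl⟩ := IsFractionRing.div_surjective (A := A) x
  rw [Derivation.leibniz_div, h1, h1, smul_zero, smul_zero, sub_zero, smul_zero]

end FractionField

/-! ### The matrix of indeterminates and its partial derivatives -/

section GenericMatrix

variable {W F K : Type*} [Field F] [Field K] {d : ℕ}
  [Algebra (MvPolynomial (Fin d × W) F) K] [IsFractionRing (MvPolynomial (Fin d × W) F) K]

variable (F K d) in
/-- The matrix of the coefficients of the generic linear forms. -/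
noncomputable def genericMatrix (r : ℕ) (v : W) : K :=
  if h : r < d then algebraMap (MvPolynomial (Fin d × W) F) K (X (⟨r, h⟩, v)) else 0

/-- A square submatrix is itself a matrix of distinct indeterminates, with nonzero determinant. -/
lemma isGeneric_genericMatrix [LinearOrder W] : IsGeneric (genericMatrix F K d (W := W)) d := by
  intro R C hR hRC y hy v hv
  set e := C.orderEmbOfFin rfl
  set ρ := R.orderEmbOfFin hRC
  have hρ : ∀ i, ρ i < d := fun i => mem_range.1 (hR (orderEmbOfFin_mem R hRC i))
  let ι : Fin C.card × Fin C.card → Fin d × W := fun p => (⟨ρ p.1, hρ p.1⟩, e p.2)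
  have hι : Function.Injective ι := by
    rintro ⟨i, k⟩ ⟨i', k'⟩ h
    simp only [ι, Prod.mk.injEq, Fin.mk.injEq] at h
    rw [ρ.injective h.1, e.injective h.2]
  let φ : MvPolynomial (Fin C.card × Fin C.card) F →+* K :=
    (algebraMap (MvPolynomial (Fin d × W) F) K).comp (rename ι).toRingHom
  have hφ : Function.Injective φ :=
    (IsFractionRing.injective (MvPolynomial (Fin d × W) F) K).comp (rename_injective ι hι)
  have hM : (Matrix.of fun i k => genericMatrix F K d (ρ i) (e k)) =
      φ.mapMatrix (Matrix.mvPolynomialX (Fin C.card) (Fin C.card) F) := by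
    ext i k
    simp [genericMatrix, hρ, φ, ι]
  have hdet : (Matrix.of fun i k => genericMatrix F K d (ρ i) (e k)).det ≠ 0 := by
    rw [hM, ← RingHom.map_det]
    exact (map_ne_zero_iff φ hφ).2 (Matrix.det_mvPolynomialX_ne_zero _ _)
  obtain ⟨k, rfl⟩ := exists_orderEmbOfFin_eq rfl hv
  refine congrFun (Matrix.eq_zero_of_mulVec_eq_zero hdet (v := fun k => y (e k))
    (funext fun i => ?_)) k
  have := hy (ρ i) (orderEmbOfFin_mem R hRC i)
  rwa [sum_eq_sum_orderEmbOfFin rfl] at this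

variable (F K d) in
/-- The partial derivative with respect to the coefficient of a generic linear form. -/
noncomputable def genericDer [DecidableEq W] (r : ℕ) (v : W) : Derivation ℤ K K :=
  if h : r < d then
    fractionDer K (pderiv (R := F) ((⟨r, h⟩ : Fin d), v))
  else 0

variable [DecidableEq W]

lemma genericDer_comm (r : ℕ) (v : W) (s : ℕ) (w : W) (x : K) :
    genericDer F K d r v (genericDer F K d s w x) =
      genericDer F K d s w (genericDer F K d r v x) := by
  unfold genericDer
  split_ifs
  · refine fractionDer_comm (fun p => ?_) x
    rw [← sub_eq_zero, ← Derivation.commutator_apply]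
    refine DFunLike.congr_fun (f := ⁅_, _⁆) (g := 0) (derivation_ext fun i => ?_) p
    rw [Derivation.commutator_apply, pderiv_X, pderiv_X, Pi.single_apply, Pi.single_apply]
    split_ifs <;> simp
  all_goals simp

lemma genericDer_genericMatrix {r s : ℕ} (hr : r < d) (hs : s < d) (v w : W) :
    genericDer F K d r v (genericMatrix F K d s w) = if r = s ∧ v = w then 1 else 0 := by
  rw [genericDer, dif_pos hr, genericMatrix, dif_pos hs, fractionDer_algebraMap]
  rw [pderiv_X, Pi.single_apply]
  simp only [Prod.mk.injEq, Fin.mk.injEq, eq_comm (a := s), eq_comm (a := w)]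
  split_ifs <;> simp

end GenericMatrix

/-! ### Anisotropy of the generic reduction -/

section Anisotropy

variable {W K : Type*} [LinearOrder W] [Fintype W] [Field K] [CharP K 2]
  {G : Finset (Finset W)} {d m : ℕ} {a : ℕ → W → K} {D : ℕ → W → Derivation ℤ K K}

/-- For each facet g(p_σ)² is constant under derivations, even though g has coefficients in `K`, so
only the weights are differentiated; a sum of squares is a square in characteristic 2. -/
lemma iterDer_degreeMap_sq (ha : IsGeneric a d)
    (hcomm : ∀ r v s w x, D r v (D s w x) = D s w (D r v x))
    (hD : ∀ r < d, ∀ s < d, ∀ v w, D r v (a s w) = if r = s ∧ v = w then 1 else 0)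
    (hm : d = 2 * m) (J : ℕ → W) (g : MvPolynomial W K) :
    iterDer (fun r => D r (J (r / 2))) (2 * m) (degreeMap G a d (g ^ 2)) =
      degreeMap G a d ((∏ k ∈ range m, X (J k)) * g) ^ 2 := by
  rw [degreeMap_apply, degreeMap_apply, iterDer_sum, CharTwo.sum_sq]
  refine sum_congr rfl fun σ hσ => ?_
  have hσd := (mem_filter.1 hσ).2
  rw [map_pow, mul_comm (weight a d σ), iterDer_const_mul fun i _ => der_sq _ _,
    iterDer_weight hcomm hD hm hσd (ha.colDet_ne_zero hσd) fun v hv => ha.point_ne_zero hσd hv,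
    map_mul, map_prod]
  simp only [eval_X]
  ring

/-- The generic Artinian reduction of a homology sphere of odd dimension is anisotropic. -/
theorem sq_notMem_artinIdeal (h : IsModTwoSphere K G d) (ha : IsGeneric a d)
    (hcomm : ∀ r v s w x, D r v (D s w x) = D s w (D r v x))
    (hD : ∀ r < d, ∀ s < d, ∀ v w, D r v (a s w) = if r = s ∧ v = w then 1 else 0)
    (hm : d = 2 * m) (hd : 2 ≤ d) {i : ℕ} (hi : 2 * i ≤ d) {f : MvPolynomial W K}
    (hf : f.IsHomogeneous i) (hfJ : f ∉ artinIdeal G a d) : f ^ 2 ∉ artinIdeal G a d := by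
  intro hf2
  have hprod : ∀ {k : ℕ} (J : Fin k → W), (∏ l, (X (J l) : MvPolynomial W K)).IsHomogeneous k :=
    fun {k} J => by
      have := IsHomogeneous.prod univ (fun l => (X (J l) : MvPolynomial W K)) (fun _ => 1)
        fun l _ => isHomogeneous_X K (J l)
      simpa using this
  -- First f is raised to the middle degree m, which preserves the assumption on its square; then g
  -- is raised to degree d, where the degree map detects it.
  obtain ⟨J₁, hJ₁⟩ := exists_prod_X_mul_notMem_artinIdeal h ha (m - i) (by omega) hf hfJ
  set g := (∏ l, X (J₁ l)) * f with hgdef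
  have hg : g.IsHomogeneous m := by
    have := (hprod J₁).mul hf
    rwa [Nat.sub_add_cancel (by omega)] at this
  obtain ⟨J₂, hJ₂⟩ := exists_prod_X_mul_notMem_artinIdeal h ha m (by omega) hg hJ₁
  have hg2 : g ^ 2 ∈ artinIdeal G a d := by
    rw [hgdef, mul_pow]
    exact Ideal.mul_mem_left _ _ hf2
  have h0 : degreeMap G a d (g ^ 2) = 0 := by
    refine degreeMap_eq_zero_of_mem_artinIdeal h ha hd ?_ hg2
    rw [hm, mul_comm]
    exact hg.pow 2
  let J : ℕ → W := fun k => if hk : k < m then J₂ ⟨k, hk⟩ else J₂ ⟨0, by omega⟩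
  have hJ : ∏ k ∈ range m, (X (J k) : MvPolynomial W K) = ∏ l, X (J₂ l) := by
    rw [← Fin.prod_univ_eq_prod_range fun k => (X (J k) : MvPolynomial W K)]
    exact prod_congr rfl fun l _ => by simp [J]
  have h1 := iterDer_degreeMap_sq (G := G) ha hcomm hD hm J g
  rw [h0, iterDer_zero_right, hJ] at h1
  refine hJ₂ (mem_artinIdeal_of_degreeMap_eq_zero h ha hd ?_ (pow_eq_zero_iff two_ne_zero |>.1 h1.symm))
  have := (hprod J₂).mul hg
  rwa [← two_mul, ← hm] at this

/-- Every variable is nilpotent, because degree d + 1 vanishes; a finitely generated integral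
algebra is finite. -/
lemma finite_quotient_artinIdeal (h : IsModTwoSphere K G d) (ha : IsGeneric a d) :
    Module.Finite K (MvPolynomial W K ⧸ artinIdeal G a d) := by
  have : Algebra.IsIntegral K (MvPolynomial W K ⧸ artinIdeal G a d) := ⟨fun x => by
    obtain ⟨f, rfl⟩ := Ideal.Quotient.mk_surjective x
    induction f using MvPolynomial.induction_on with
    | C c => exact isIntegral_algebraMap (R := K) (x := c)
    | add p q hp hq => rw [map_add]; exact hp.add hq
    | mul_X p v hp =>
      rw [map_mul]
      refine hp.mul (IsIntegral.of_pow d.succ_pos ?_)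
      rw [← map_pow, Ideal.Quotient.eq_zero_iff_mem.2
        (mem_artinIdeal_of_lt_degree h ha d.lt_succ_self (by
          simpa using (isHomogeneous_X K v).pow (d + 1)))]
      exact isIntegral_zero⟩
  exact Algebra.IsIntegral.finite

end Anisotropy

/-! ### Translation back to the complex -/

section Complex

variable {V F : Type*} [LinearOrder V] [Field F] {Δ : FinComplex V}

lemma reductionIdeal_genericForms :
    Δ.reductionIdeal (Δ.genericForms F) = artinIdeal
      (univ.filter fun s : Finset Δ.vertices => s.map (Function.Embedding.subtype _) ∈ Δ.faces)
      (genericMatrix F (Δ.GenericField F) Δ.rank) Δ.rank := by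
  have h1 : ∀ r : Fin Δ.rank, linForm (genericMatrix F (Δ.GenericField F) Δ.rank) r =
      Δ.genericForms F r := fun r => by
    simp [linForm, FinComplex.genericForms, genericMatrix]
  have h2 : linForm (genericMatrix F (Δ.GenericField F) Δ.rank) '' {r | r < Δ.rank} =
      Set.range (Δ.genericForms F) := by
    ext p
    constructor
    · rintro ⟨r, hr, rfl⟩
      exact ⟨⟨r, hr⟩, (h1 ⟨r, hr⟩).symm⟩
    · rintro ⟨r, rfl⟩
      exact ⟨r, r.2, h1 r⟩
  rw [FinComplex.reductionIdeal, artinIdeal, formIdeal, h2, FinComplex.stanleyReisnerIdeal,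
    nonfaceIdeal]
  simp

theorem genericallyAnisotropic_of_isModTwoSphere [CharP F 2] {n : ℕ} (hn : 1 ≤ n)
    (h : IsModTwoSphere F Δ.faces (2 * n)) : Δ.GenericallyAnisotropic F := by
  have hrank := h.rank_eq
  have : CharP (Δ.GenericField F) 2 := charP_of_injective_algebraMap
    (algebraMap F (Δ.GenericField F)).injective 2
  set G := univ.filter fun s : Finset Δ.vertices =>
    s.map (Function.Embedding.subtype _) ∈ Δ.faces with hG
  -- Coefficients are extended to the field of rational functions, and the ambient type is cut down
  -- to the vertices.
  have hS : IsModTwoSphere (Δ.GenericField F) G Δ.rank := by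
    have hb : IsModTwoSphere F Δ.faces Δ.rank := hrank.symm ▸ h
    refine hb.baseChange.comap (Function.Embedding.subtype _) (fun s hs => ?_) (by simp [hG])
    refine ⟨s.subtype (· ∈ Δ.vertices), ?_⟩
    rw [Finset.subtype_map, filter_true_of_mem]
    intro v hv
    exact (Δ.mem_vertices v).2 (Δ.down_closed s hs _ (by simpa using hv))
  have ha : IsGeneric (genericMatrix F (Δ.GenericField F) Δ.rank (W := Δ.vertices)) Δ.rank :=
    isGeneric_genericMatrix
  refine ⟨⟨fun i => ?_, ?_⟩, fun i hi u hu hu0 => ?_⟩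
  · refine IsHomogeneous.sum _ _ _ fun v _ => ?_
    simpa using (isHomogeneous_C _ _).mul (isHomogeneous_X _ v)
  · change Module.Finite _ (MvPolynomial _ _ ⧸ Δ.reductionIdeal _)
    rw [reductionIdeal_genericForms]
    exact finite_quotient_artinIdeal hS ha
  · obtain ⟨f, hf, rfl⟩ := hu
    have hf' : f.IsHomogeneous i := hf
    change Ideal.Quotient.mk _ f ≠ 0 at hu0
    change Ideal.Quotient.mk _ f ^ 2 ≠ 0
    rw [Ne, Ideal.Quotient.eq_zero_iff_mem, reductionIdeal_genericForms] at hu0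
    rw [← map_pow, Ne, Ideal.Quotient.eq_zero_iff_mem, reductionIdeal_genericForms]
    exact sq_notMem_artinIdeal hS ha (D := genericDer F (Δ.GenericField F) Δ.rank)
      (fun r v s w x => genericDer_comm r v s w x)
      (fun r hr s hs v w => genericDer_genericMatrix hr hs v w) hrank (by omega) hi hf' hu0

end Complex

end ModTwo

theorem mainTheorem1 {V : Type*} [LinearOrder V] {F : Type*} [Field F] [CharP F 2]
    (n : ℕ) (hn : 1 ≤ n) (Δ Δ' : FinComplex V) (hΔ : Δ.IsHomologySphere F (2 * n - 1))
    (q : ℕ) (hq : FinComplex.IsBistellarMove q Δ Δ') :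
    Δ.GenericallyAnisotropic F ↔ Δ'.GenericallyAnisotropic F := by
  have h : ModTwo.IsModTwoSphere F Δ.faces (2 * n) := by
    have := ModTwo.isModTwoSphere_of_isHomologySphere hΔ
    rwa [Nat.sub_add_cancel (by omega)] at this
  have hrank := h.rank_eq
  have h' : ModTwo.IsModTwoSphere F Δ'.faces (2 * n) := by
    rw [← hrank] at h ⊢
    exact h.bistellarMove hq
  -- The equivalence holds because Δ and Δ' are both generically anisotropic.
  exact iff_of_true (ModTwo.genericallyAnisotropic_of_isModTwoSphere hn h)
    (ModTwo.genericallyAnisotropic_of_isModTwoSphere hn h')
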